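/- **Theorem 6.5.** Let $K\ge 0$, $n=2K+1$, and for $1\le k\le n$ write $k'=n+1-k$ (counting from the right). Let $0<\zeta_1<\dots<\zeta_K$, $b_1(0),\dots,b_K(0)>0$ and $c>0$ be arbitrary, and let the masses $m_1,\dots,m_n>0$ satisfy, for all odd $k$ with $1\le k\le 2K-1$, $$\frac1{m_{(k+1)'}m_{k'}}<\frac{\zeta_1^{\frac{k+1}2}}{\zeta_K^{\frac{k-1}2}}\min\{1,\hat\beta\},\qquad \frac1{m_{(k+2)'}m_{(k+1)'}}<\frac{\zeta_1^{\frac{k+1}2}}{\zeta_K^{\frac{k-1}2}}\min\{1,\hat\beta_1\},$$ where $\hat\beta=+\infty$ for $k=1$, $\hat\beta_1=+\infty$ if $K=1$, and otherwise $$\hat\beta=\frac{2\zeta_K\min_j(\zeta_{j+1}-\zeta_j)^{k-3}}{\zeta_1(k-1)(\zeta_K-\zeta_1)^{k-1}}\cdot\frac{(1+m_{k'}^2\zeta_1)(1+m_{(k+1)'}^2\zeta_1)}{m_{k'}^2m_{(k+1)'}^2},$$ $$\hat\beta_1=\frac{2\min_j(\zeta_{j+1}-\zeta_j)^{k-1}}{(k+1)(\zeta_K-\zeta_1)^{k+1}}\cdot\frac{(1+m_{(k+1)'}^2\zeta_1)(1+m_{(k+2)'}^2\zeta_1)}{m_{(k+1)'}^2m_{(k+2)'}^2}.$$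 A *global multipeakon solution* with masses $m_j$ is a family $x_1(t)<\dots<x_n(t)$, $t\in\mathbb R$, with $$\dot x_j=2\sum_{k\ne j}m_jm_ke^{-|x_j-x_k|}+4\sum_{i<j<k}m_im_ke^{-|x_i-x_k|},\qquad 1\le j\le n .$$ It has *initial spectral data* $(\zeta,b(0),c)$ if the polynomials given at $t=0$ by $q_0=0$, $p_0=1$, $q_k=q_{k-1}+m_ke^{x_k}p_{k-1}$, $p_k=p_{k-1}-z\,m_ke^{-x_k}q_{k-1}$ are such that the zeros of $p_n(z)$ are exactly $\zeta_1,\dots,\zeta_K$ and $\dfrac{q_n(z)}{p_n(z)}=c+\sum_{j=1}^K\dfrac{b_j(0)}{\zeta_j-z}$. Then a global multipeakon solution with initial spectral data $(\zeta,b(0),c)$ exists, and every such solution has the asymptotics below. Notation: $e_k=1/m_{k'}^2$; $[1,l]=\{1,\dots,l\}$ (empty for $l=0$); $v_I=\prod_{i\in I}v_i$; $\Delta_{I,\{s\}}=\prod_{i\in I}(\zeta_i-\zeta_s)$; $\Gamma_{I,\{s\}}=\prod_{i\in I}(e_i+\zeta_s)$; empty products are $1$; $j^*=K+1-j$ and $[1,l]^*=\{l^*,\dots,1^*\}$.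 The positive constants $\alpha_k,\alpha,\beta_k$ may differ from formula to formula. As $t\to+\infty$: $$x_{k'}=\frac{2t}{\zeta_{\frac{k+1}2}}+\ln\frac{b_{\frac{k+1}2}(0)\,e_{[1,k-1]}\,\Delta^2_{[1,\frac{k-1}2],\{\frac{k+1}2\}}}{m_{k'}\,\Gamma_{[1,k],\{\frac{k+1}2\}}\,\zeta^2_{[1,\frac{k-1}2]}}+O(e^{-\alpha_kt})\quad(k\text{ odd},\ 1\le k\le 2K-1),$$ $$x_{(2K+1)'}=x_1=\ln\frac{c\,e_{[1,2K]}}{m_1\,\zeta^2_{[1,K]}}+O(e^{-\alpha t}),$$ $$x_{k'}=\frac{2t}{\zeta_{\frac k2}}+\ln\frac{b_{\frac k2}(0)\,e_{[1,k-1]}\,\Delta^2_{[1,\frac k2-1],\{\frac k2\}}}{m_{k'}\,\Gamma_{[1,k-1],\{\frac k2\}}\,\zeta^2_{[1,\frac k2-1]}\,\zeta_{\frac k2}}+O(e^{-\alpha_kt})\quad(k\text{ even},\ 2\le k\le 2K),$$ $$x_{k'}-x_{(k+1)'}=\ln\bigl(m_{(k+1)'}m_{k'}\zeta_{\frac{k+1}2}\bigr)+O(e^{-\alpha_kt})\quad(k\text{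 odd},\ 1\le k\le 2K-1).$$ As $t\to-\infty$: $$x_{k'}=\frac{2t}{\zeta_{(\frac{k-1}2)^*}}+\ln\frac{b_{(\frac{k-1}2)^*}(0)\,e_{[1,k-1]}\,\Delta^2_{[1,\frac{k-1}2-1]^*,\{(\frac{k-1}2)^*\}}}{m_{k'}\,\Gamma_{[1,k-1],\{(\frac{k-1}2)^*\}}\,\zeta^2_{[1,\frac{k-1}2-1]^*}\,\zeta_{(\frac{k-1}2)^*}}+O(e^{\beta_kt})\quad(k\text{ odd},\ 3\le k\le 2K+1),$$ $$x_{1'}=x_n=\ln\frac c{m_n}+O(e^{\beta_1t}),$$ $$x_{k'}=\frac{2t}{\zeta_{(\frac k2)^*}}+\ln\frac{b_{(\frac k2)^*}(0)\,e_{[1,k-1]}\,\Delta^2_{[1,\frac k2-1]^*,\{(\frac k2)^*\}}}{m_{k'}\,\Gamma_{[1,k],\{(\frac k2)^*\}}\,\zeta^2_{[1,\frac k2-1]^*}}+O(e^{\beta_kt})\quad(k\text{ even},\ 2\le k\le 2K),$$ $$x_{k'}-x_{(k+1)'}=\ln\bigl(m_{(k+1)'}m_{k'}\zeta_{(\frac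 k2)^*}\bigr)+O(e^{\beta_kt})\quad(k\text{ even},\ 2\le k\le 2K).$$ -/

import Mathlib

namespace MCHPeakon

noncomputable section

open Filter Asymptotics

/-! ### The peakon system -/

/-- The velocity `u(x_j)² - ⟨u_x²⟩(x_j)` of the `j`-th peakon of
`u(x) = ∑ m_j exp (-|x - x_j|)` when `x_1 < ⋯ < x_n` (`⟨·⟩` is the mean of the two one-sided
limits), written out:
`2 ∑_{k ≠ j} m_j m_k e^{-|x_j - x_k|} + 4 ∑_{i < j < k} m_i m_k e^{-|x_i - x_k|}`. -/
def velocity {n : ℕ} (m x : Fin n → ℝ) (j : Fin n) : ℝ :=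
  2 * ∑ k ∈ Finset.univ.erase j, m j * m k * Real.exp (-|x j - x k|) +
    4 * ∑ i ∈ Finset.Iio j, ∑ k ∈ Finset.Ioi j, m i * m k * Real.exp (-|x i - x k|)

/-- A global multipeakon solution with (constant) masses `m`: the positions stay strictly ordered
and satisfy the peakon equations for all `t ∈ ℝ`. -/
structure IsGlobalMultipeakon {n : ℕ} (m : Fin n → ℝ) (x : ℝ → Fin n → ℝ) : Prop where
  ordered : ∀ t, StrictMono (x t)
  hasDerivAt : ∀ t j, HasDerivAt (fun s => x s j) (velocity m (x t) j) t

/-! ### The boundary value problem and its spectral data -/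

/-- The pair `(q_k(z), p_k(z))`, `0 ≤ k ≤ n`, defined by `q_0 = 0`, `p_0 = 1`,
`q_k - q_{k-1} = h_k p_{k-1}`, `p_k - p_{k-1} = - z g_k q_{k-1}`, with
`h_k = m_k e^{x_k}` and `g_k = m_k e^{-x_k}`. -/
def transfer {n : ℕ} (m x : Fin n → ℝ) (z : ℂ) : Fin (n + 1) → ℂ × ℂ :=
  Fin.induction (motive := fun _ => ℂ × ℂ) (0, 1) fun k qp =>
    (qp.1 + ((m k * Real.exp (x k) : ℝ) : ℂ) * qp.2,
      qp.2 - z * ((m k * Real.exp (-x k) : ℝ) : ℂ) * qp.1)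

/-- `q_n(z)`. -/
def qLast {n : ℕ} (m x : Fin n → ℝ) (z : ℂ) : ℂ := (transfer m x z (Fin.last n)).1

/-- `p_n(z)`; its zeros are the eigenvalues of the boundary value problem. -/
def pLast {n : ℕ} (m x : Fin n → ℝ) (z : ℂ) : ℂ := (transfer m x z (Fin.last n)).2

/-- The configuration `(m, x)` has spectral data `(ζ, b, c)`: the eigenvalues are exactly the
`ζ_j`, and the Weyl function is `q_n(z) / p_n(z) = c + ∑_j b_j / (ζ_j - z)`. -/
structure HasSpectralData {n K : ℕ} (m x : Fin n → ℝ) (ζ b : Fin K → ℝ) (c : ℝ) : Prop where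
  eigenvalue_iff : ∀ z : ℂ, pLast m x z = 0 ↔ ∃ j, z = (ζ j : ℂ)
  weyl : ∀ z : ℂ, pLast m x z ≠ 0 →
    qLast m x z / pLast m x z = (c : ℂ) + ∑ j, (b j : ℂ) / ((ζ j : ℂ) - z)

/-! ### Notation: counting from the right, multi-index products

Indices start at `0`. The `k`-th entry from the right (`k = 1, …, n`) of a family `v` is
`fromRight v a` with `a = k - 1`. -/

/-- `v_{k'}`, `k' = n + 1 - k`, where `a = k - 1`. -/
def fromRight {n : ℕ} (v : Fin n → ℝ) (a : Fin n) : ℝ := v a.rev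

/-- `e_k = 1 / m_{k'}²`, where `a = k - 1`. -/
def eVec {n : ℕ} (m : Fin n → ℝ) (a : Fin n) : ℝ := 1 / fromRight m a ^ 2

/-- `v_I = ∏_{i ∈ I} v_i`. -/
def multi {ι : Type*} (v : ι → ℝ) (I : Finset ι) : ℝ := ∏ i ∈ I, v i

/-- `Δ_{I,J}(v; w) = ∏_{i ∈ I} ∏_{j ∈ J} (v_i - w_j)`. -/
def Delta {ι κ : Type*} (I : Finset ι) (J : Finset κ) (v : ι → ℝ) (w : κ → ℝ) : ℝ :=
  ∏ i ∈ I, ∏ j ∈ J, (v i - w j)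

/-- `Γ_{I,J}(v; w) = ∏_{i ∈ I} ∏_{j ∈ J} (v_i + w_j)`. -/
def Gam {ι κ : Type*} (I : Finset ι) (J : Finset κ) (v : ι → ℝ) (w : κ → ℝ) : ℝ :=
  ∏ i ∈ I, ∏ j ∈ J, (v i + w j)

/-- Index (from the right) of the peakon number `k = 2j + 1`, `0 ≤ j < K`. -/
def r₁ {K : ℕ} (j : Fin K) : Fin (2 * K + 1) := ⟨2 * j, by omega⟩

/-- Index (from the right) of the peakon number `k = 2j + 2`, `0 ≤ j < K`. -/
def r₂ {K : ℕ} (j : Fin K) : Fin (2 * K + 1) := ⟨2 * j + 1, by omega⟩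

/-- Index (from the right) of the peakon number `k = 2j + 3`, `0 ≤ j < K`. -/
def r₃ {K : ℕ} (j : Fin K) : Fin (2 * K + 1) := ⟨2 * j + 2, by omega⟩

/-! ### The sufficient conditions for global existence -/

/-- The first entry `ζ_1`; `j` only witnesses that `K ≥ 1`. -/
def firstOf {K : ℕ} (ζ : Fin K → ℝ) (j : Fin K) : ℝ := ζ ⟨0, j.pos⟩

/-- The last entry `ζ_K`; `j` only witnesses that `K ≥ 1`. -/
def lastOf {K : ℕ} (ζ : Fin K → ℝ) (j : Fin K) : ℝ := ζ ⟨K - 1, Nat.sub_lt j.pos one_pos⟩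

/-- `min_j (ζ_{j+1} - ζ_j)` (used only for `K ≥ 2`). -/
def minGap {K : ℕ} (ζ : Fin K → ℝ) : ℝ :=
  ⨅ j : Fin (K - 1), (ζ ⟨j + 1, by omega⟩ - ζ ⟨j, by omega⟩)

/-- `(1 + s² ζ_1)(1 + r² ζ_1) / (s² r²)`. -/
def massFactor (s r ζ₁ : ℝ) : ℝ := (1 + s ^ 2 * ζ₁) * (1 + r ^ 2 * ζ₁) / (s ^ 2 * r ^ 2)

/-- `min {1, β̂}` for `k = 2j + 1`; for `k = 1`, `β̂ = +∞`. -/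
def minBeta {K : ℕ} (m : Fin (2 * K + 1) → ℝ) (ζ : Fin K → ℝ) (j : Fin K) : ℝ :=
  if (j : ℕ) = 0 then 1
  else min 1
    (2 * lastOf ζ j * minGap ζ ^ (2 * (j : ℕ) - 2) /
        (firstOf ζ j * (2 * (j : ℕ)) * (lastOf ζ j - firstOf ζ j) ^ (2 * (j : ℕ))) *
      massFactor (fromRight m (r₁ j)) (fromRight m (r₂ j)) (firstOf ζ j))

/-- `min {1, β̂₁}` for `k = 2j + 1`; for `K = 1` the denominator `(ζ_K - ζ_1)^{k+1}` of `β̂₁`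
vanishes and `β̂₁ = +∞`. -/
def minBetaOne {K : ℕ} (m : Fin (2 * K + 1) → ℝ) (ζ : Fin K → ℝ) (j : Fin K) : ℝ :=
  if K = 1 then 1
  else min 1
    (2 * minGap ζ ^ (2 * (j : ℕ)) /
        ((2 * (j : ℕ) + 2) * (lastOf ζ j - firstOf ζ j) ^ (2 * (j : ℕ) + 2)) *
      massFactor (fromRight m (r₂ j)) (fromRight m (r₃ j)) (firstOf ζ j))

/-- The sufficient conditions on the masses for global existence; `k = 2j + 1` runs through the
odd numbers `1 ≤ k ≤ 2K - 1`. -/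
structure MassCondition {K : ℕ} (m : Fin (2 * K + 1) → ℝ) (ζ : Fin K → ℝ) : Prop where
  first : ∀ j : Fin K, 1 / (fromRight m (r₂ j) * fromRight m (r₁ j)) <
    firstOf ζ j ^ ((j : ℕ) + 1) / lastOf ζ j ^ (j : ℕ) * minBeta m ζ j
  second : ∀ j : Fin K, 1 / (fromRight m (r₃ j) * fromRight m (r₂ j)) <
    firstOf ζ j ^ ((j : ℕ) + 1) / lastOf ζ j ^ (j : ℕ) * minBetaOne m ζ j

/-! ### Asymptotic equality with exponentially small error -/

/-- `f(t) = g(t) + O(e^{-αt})` as `t → +∞`, for some `α > 0`. -/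
def ExpCloseTop (f g : ℝ → ℝ) : Prop :=
  ∃ α > 0, (fun t => f t - g t) =O[atTop] fun t => Real.exp (-α * t)

/-- `f(t) = g(t) + O(e^{βt})` as `t → -∞`, for some `β > 0`. -/
def ExpCloseBot (f g : ℝ → ℝ) : Prop :=
  ∃ β > 0, (fun t => f t - g t) =O[atBot] fun t => Real.exp (β * t)

/-- The asymptotics as `t → +∞`. For `j : Fin K` (so `j + 1` is the eigenvalue number),
`Finset.Iio j` is `[1, j]`, and `Finset.Iio a` with `a` the index of peakon number `k` is
`[1, k-1]`, `Finset.Iic a` is `[1, k]`. -/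
structure AsymptoticsTop {K : ℕ} (m : Fin (2 * K + 1) → ℝ) (ζ b : Fin K → ℝ) (c : ℝ)
    (x : ℝ → Fin (2 * K + 1) → ℝ) : Prop where
  /-- odd `k = 2j + 1 ≤ 2K - 1` -/
  odd : ∀ j : Fin K, ExpCloseTop (fun t => fromRight (x t) (r₁ j)) fun t =>
    2 * t / ζ j + Real.log
      (b j * multi (eVec m) (Finset.Iio (r₁ j)) * Delta (Finset.Iio j) {j} ζ ζ ^ 2 /
        (fromRight m (r₁ j) * Gam (Finset.Iic (r₁ j)) {j} (eVec m) ζ *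
          multi ζ (Finset.Iio j) ^ 2))
  /-- the leftmost peakon, `k = 2K + 1` -/
  leftmost : ExpCloseTop (fun t => fromRight (x t) (Fin.last (2 * K))) fun _ => Real.log
    (c * multi (eVec m) (Finset.Iio (Fin.last (2 * K))) /
      (fromRight m (Fin.last (2 * K)) * multi ζ Finset.univ ^ 2))
  /-- even `k = 2j + 2 ≤ 2K` -/
  even : ∀ j : Fin K, ExpCloseTop (fun t => fromRight (x t) (r₂ j)) fun t =>
    2 * t / ζ j + Real.log
      (b j * multi (eVec m) (Finset.Iio (r₂ j)) * Delta (Finset.Iio j) {j} ζ ζ ^ 2 /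
        (fromRight m (r₂ j) * Gam (Finset.Iio (r₂ j)) {j} (eVec m) ζ *
          multi ζ (Finset.Iio j) ^ 2 * ζ j))
  /-- the pairs `k = 2j + 1`, `k + 1 = 2j + 2` -/
  pair : ∀ j : Fin K,
    ExpCloseTop (fun t => fromRight (x t) (r₁ j) - fromRight (x t) (r₂ j)) fun _ =>
      Real.log (fromRight m (r₂ j) * fromRight m (r₁ j) * ζ j)

/-- The asymptotics as `t → -∞`. For `j : Fin K`, `j.rev` is the index of the reflected eigenvalue
number `(j + 1)^* = K - j`, and `Finset.Ioi j.rev` is the reflected interval `[1, j]^*`. -/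
structure AsymptoticsBot {K : ℕ} (m : Fin (2 * K + 1) → ℝ) (ζ b : Fin K → ℝ) (c : ℝ)
    (x : ℝ → Fin (2 * K + 1) → ℝ) : Prop where
  /-- odd `k = 2j + 3`, `1 < k ≤ 2K + 1` -/
  odd : ∀ j : Fin K, ExpCloseBot (fun t => fromRight (x t) (r₃ j)) fun t =>
    2 * t / ζ j.rev + Real.log
      (b j.rev * multi (eVec m) (Finset.Iio (r₃ j)) *
          Delta (Finset.Ioi j.rev) {j.rev} ζ ζ ^ 2 /
        (fromRight m (r₃ j) * Gam (Finset.Iio (r₃ j)) {j.rev} (eVec m) ζ *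
          multi ζ (Finset.Ioi j.rev) ^ 2 * ζ j.rev))
  /-- the rightmost peakon, `k = 1` -/
  rightmost : ExpCloseBot (fun t => fromRight (x t) 0) fun _ =>
    Real.log (c / fromRight m 0)
  /-- even `k = 2j + 2 ≤ 2K` -/
  even : ∀ j : Fin K, ExpCloseBot (fun t => fromRight (x t) (r₂ j)) fun t =>
    2 * t / ζ j.rev + Real.log
      (b j.rev * multi (eVec m) (Finset.Iio (r₂ j)) *
          Delta (Finset.Ioi j.rev) {j.rev} ζ ζ ^ 2 /
        (fromRight m (r₂ j) * Gam (Finset.Iic (r₂ j)) {j.rev} (eVec m) ζ *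
          multi ζ (Finset.Ioi j.rev) ^ 2))
  /-- the pairs `k = 2j + 2`, `k + 1 = 2j + 3` -/
  pair : ∀ j : Fin K,
    ExpCloseBot (fun t => fromRight (x t) (r₂ j) - fromRight (x t) (r₃ j)) fun _ =>
      Real.log (fromRight m (r₃ j) * fromRight m (r₂ j) * ζ j.rev)

end

end MCHPeakon

/-! The flow is linearised by the spectral data. Put `h_k = m_k e^{x_k}`, `g_k = m_k e^{-x_k}`, `A_k
= ∑_{i<k} h_i`, `B_k = ∑_{i≥k} g_i`. For ordered peakons the velocity is `2 (A_k B_k + A_{k+1}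
B_{k+1})`, and this makes the pairs `(q_k, p_k)` obey linear evolution equations
(`hasDerivAt_chain`). At the right end they say that `p_n` is constant and `q_n' = (2/z)(q_n -
q_n(0) p_n)`. So `ζ` and `c` are conserved and `b_j(t) = b_j(0) e^{2t/ζ_j}`
(`spectralPoly_evolution`).

The positions are recovered from the data. Since `h_k g_k = m_k²` is given, `q_n / p_n` determines
every `h_k`: its value at `z = -1/m_n²` is `h_n`, and the last step can then be peeled off
(`eq_of_polyChain_proportional`). The solution is explicit (`height`): a quotient of sums of squared
Vandermonde determinants over subsets of the nodes `ζ_1, …, ζ_K, ∞`, where `∞ = (1 : 0)` carries the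
weight `c`. In homogeneous coordinates the parameter `y = -z` behaves like one more `e_k`, so a
single bilinear relation, used twice (`numSum_mul_denSum`), verifies the whole recursion
(`chain_height`). That relation exchanges one node between two subsets and evaluates the result by
Lagrange interpolation.

The mass conditions serve to keep the positions ordered. The inequality between neighbouring
positions is of degree one in `c`, and it is proved coefficient by coefficient: one coefficient
needs only the sizes of the `ζ_j` (the `1` in the minima), the other moves one node from a larger to
a smaller subset and pays with gaps and mass factors (`hsum_exchange_le`, the source of the `β̂`
bounds).

For existence, a local solution of the equations through an explicit configuration has the same
spectral polynomials as the explicit curve, hence coincides with it; the same argument identifies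
every global solution with that curve. For the asymptotics, every subset sum is a sum of
exponentials in `t` with one dominant subset: finite nodes have rate `2/ζ_j`, infinity has rate `0`,
so initial segments of nodes win as `t → +∞` and final segments as `t → -∞` (`expClose_log_sum`,
`expClose_position`). -/

namespace MCHPeakon

noncomputable section

open Filter Asymptotics

/-! ### Sums over subsets of nodes in homogeneous coordinates -/

section SubsetSums

variable {ι : Type*}

/-- The determinant of two nodes with homogeneous coordinates `(ζ i : η i)`, `(ζ j : η j)`. -/
def bracket (ζ η : ι → ℝ) (i j : ι) : ℝ := ζ i * η j - ζ j * η i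

lemma bracket_self (ζ η : ι → ℝ) (i : ι) : bracket ζ η i i = 0 := by
  simp [bracket]

lemma bracket_swap (ζ η : ι → ℝ) (i j : ι) : bracket ζ η i j = -bracket ζ η j i := by
  simp [bracket]

variable [DecidableEq ι]

/-- The squared Vandermonde determinant `Δ_I²` of a set of nodes. -/
def discr (ζ η : ι → ℝ) (I : Finset ι) : ℝ := ∏ i ∈ I, ∏ j ∈ I.erase i, |bracket ζ η i j|

/-- `∑ ν_I Δ_I²` over the `l`-element subsets `I` of `S`. -/
def hsum (ζ η : ι → ℝ) (S : Finset ι) (l : ℕ) (ν : ι → ℝ) : ℝ :=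
  ∑ I ∈ S.powersetCard l, (∏ i ∈ I, ν i) * discr ζ η I

lemma discr_nonneg (ζ η : ι → ℝ) (I : Finset ι) : 0 ≤ discr ζ η I :=
  Finset.prod_nonneg fun _ _ => Finset.prod_nonneg fun _ _ => abs_nonneg _

lemma discr_pos {ζ η : ι → ℝ} (h : ∀ i j, i ≠ j → bracket ζ η i j ≠ 0) (I : Finset ι) :
    0 < discr ζ η I :=
  Finset.prod_pos fun _ _ => Finset.prod_pos fun _ hj =>
    abs_pos.2 (h _ _ (Finset.ne_of_mem_erase hj).symm)

/-- `discr` runs over ordered pairs, so each pair involving the new element occurs twice; this is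
where the square comes from. -/
lemma discr_insert (ζ η : ι → ℝ) {i : ι} {I : Finset ι} (hi : i ∉ I) :
    discr ζ η (insert i I) = discr ζ η I * ∏ k ∈ I, bracket ζ η i k ^ 2 := by
  unfold discr
  rw [Finset.prod_insert hi, Finset.erase_insert hi]
  have : ∀ k ∈ I, ∏ j ∈ (insert i I).erase k, |bracket ζ η k j| =
      |bracket ζ η i k| * ∏ j ∈ I.erase k, |bracket ζ η k j| := by
    intro k hk
    have hik : i ≠ k := by rintro rfl; exact hi hk
    rw [Finset.erase_insert_of_ne hik, Finset.prod_insert (by simp [hi]),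
      bracket_swap ζ η k i, abs_neg]
  rw [Finset.prod_congr rfl this, Finset.prod_mul_distrib, ← mul_assoc, ← Finset.prod_mul_distrib,
    mul_comm]
  congr 1
  exact Finset.prod_congr rfl fun k _ => by rw [abs_mul_abs_self, sq]

lemma discr_empty (ζ η : ι → ℝ) : discr ζ η ∅ = 1 := by simp [discr]

lemma hsum_zero (ζ η : ι → ℝ) (S : Finset ι) (ν : ι → ℝ) : hsum ζ η S 0 ν = 1 := by
  simp [hsum, discr_empty]

lemma hsum_one (ζ η : ι → ℝ) (S : Finset ι) (ν : ι → ℝ) : hsum ζ η S 1 ν = ∑ i ∈ S, ν i := by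
  simp [hsum, discr, Finset.powersetCard_one]

lemma hsum_nonneg (ζ η : ι → ℝ) (S : Finset ι) (l : ℕ) {ν : ι → ℝ} (hν : ∀ i ∈ S, 0 ≤ ν i) :
    0 ≤ hsum ζ η S l ν :=
  Finset.sum_nonneg fun _ hI => mul_nonneg (Finset.prod_nonneg fun i hi =>
    hν i ((Finset.mem_powersetCard.1 hI).1 hi)) (discr_nonneg _ _ _)

lemma hsum_pos {ζ η : ι → ℝ} (h : ∀ i j, i ≠ j → bracket ζ η i j ≠ 0) {S S' : Finset ι} {l : ℕ}
    {ν : ι → ℝ} (hν : ∀ i ∈ S, 0 ≤ ν i) (hS' : S' ⊆ S) (hν' : ∀ i ∈ S', 0 < ν i)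
    (hl : l ≤ S'.card) : 0 < hsum ζ η S l ν := by
  obtain ⟨I, hI, hIl⟩ := Finset.exists_subset_card_eq hl
  refine Finset.sum_pos' (fun _ hJ => mul_nonneg (Finset.prod_nonneg fun i hi =>
    hν i ((Finset.mem_powersetCard.1 hJ).1 hi)) (discr_nonneg _ _ _))
    ⟨I, Finset.mem_powersetCard.2 ⟨hI.trans hS', hIl⟩, mul_pos (Finset.prod_pos fun i hi =>
      hν' i (hI hi)) (discr_pos h _)⟩

lemma hsum_congr {ζ η : ι → ℝ} {S : Finset ι} {l : ℕ} {ν ν' : ι → ℝ} (h : ∀ i ∈ S, ν i = ν' i) :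
    hsum ζ η S l ν = hsum ζ η S l ν' :=
  Finset.sum_congr rfl fun I hI => by
    rw [Finset.prod_congr rfl fun i hi => h i ((Finset.mem_powersetCard.1 hI).1 hi)]

/-- Summing over a set with a marked element. -/
lemma sum_powersetCard_succ {M : Type*} [AddCommMonoid M] (S : Finset ι) (l : ℕ)
    (F : ι → Finset ι → M) :
    ∑ L ∈ S.powersetCard l, ∑ i ∈ S \ L, F i L =
      ∑ J ∈ S.powersetCard (l + 1), ∑ i ∈ J, F i (J.erase i) := by
  rw [Finset.sum_sigma', Finset.sum_sigma']
  refine Finset.sum_bij' (fun p _ => ⟨insert p.2 p.1, p.2⟩) (fun p _ => ⟨p.1.erase p.2, p.2⟩)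
    ?_ ?_ ?_ ?_ ?_
  · rintro ⟨L, i⟩ h
    simp only [Finset.mem_sigma, Finset.mem_powersetCard, Finset.mem_sdiff] at h ⊢
    obtain ⟨⟨hL, hc⟩, hi, hiL⟩ := h
    exact ⟨⟨Finset.insert_subset hi hL, by rw [Finset.card_insert_of_notMem hiL, hc]⟩,
      Finset.mem_insert_self _ _⟩
  · rintro ⟨J, i⟩ h
    simp only [Finset.mem_sigma, Finset.mem_powersetCard, Finset.mem_sdiff] at h ⊢
    obtain ⟨⟨hJ, hc⟩, hi⟩ := h
    exact ⟨⟨(Finset.erase_subset _ _).trans hJ, by rw [Finset.card_erase_of_mem hi, hc]; rfl⟩,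
      hJ hi, Finset.notMem_erase _ _⟩
  · rintro ⟨L, i⟩ h
    simp only [Finset.mem_sigma, Finset.mem_sdiff] at h
    simp [Finset.erase_insert h.2.2]
  · rintro ⟨J, i⟩ h
    simp only [Finset.mem_sigma] at h
    simp [Finset.insert_erase h.2]
  · rintro ⟨L, i⟩ h
    simp only [Finset.mem_sigma, Finset.mem_sdiff] at h
    simp [Finset.erase_insert h.2.2]

/-- The factor `[i, i] = 0` removes the terms with `i ∈ L`. For `i ∉ L`, `Δ_L² ∏ [i, k]` is `Δ_{L ∪
i}²` divided by `∏ [i, j]`, so the pairs `(L, i)` regroup by `J = L ∪ {i}` into the partial-fraction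
sums that interpolation evaluates. -/
lemma sum_marked {ζ η : ι → ℝ} (h : ∀ i j, i ≠ j → bracket ζ η i j ≠ 0) (S : Finset ι) (l : ℕ)
    (ν : ι → ℝ) (G : ι → Finset ι → ℝ) :
    ∑ L ∈ S.powersetCard l, ∑ i ∈ S,
        (∏ k ∈ L, ν k) * ν i * discr ζ η L * (∏ k ∈ L, bracket ζ η i k) * G i L =
      ∑ J ∈ S.powersetCard (l + 1), (∏ k ∈ J, ν k) * discr ζ η J *
        ∑ i ∈ J, G i (J.erase i) / ∏ j ∈ J.erase i, bracket ζ η i j := by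
  have h1 : ∀ L ∈ S.powersetCard l, ∑ i ∈ S,
      (∏ k ∈ L, ν k) * ν i * discr ζ η L * (∏ k ∈ L, bracket ζ η i k) * G i L = ∑ i ∈ S \ L,
      (∏ k ∈ L, ν k) * ν i * discr ζ η L * (∏ k ∈ L, bracket ζ η i k) * G i L := by
    intro L _
    refine (Finset.sum_subset Finset.sdiff_subset fun i hi hi' => ?_).symm
    have hiL : i ∈ L := by simpa [hi] using hi'
    rw [Finset.prod_eq_zero hiL (bracket_self ζ η i)]
    ring
  rw [Finset.sum_congr rfl h1, sum_powersetCard_succ]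
  refine Finset.sum_congr rfl fun J _ => ?_
  rw [Finset.mul_sum]
  refine Finset.sum_congr rfl fun i hi => ?_
  have hne : ∏ j ∈ J.erase i, bracket ζ η i j ≠ 0 :=
    Finset.prod_ne_zero_iff.2 fun j hj => h _ _ (Finset.ne_of_mem_erase hj).symm
  have hd := discr_insert ζ η (Finset.notMem_erase i J)
  rw [Finset.insert_erase hi, Finset.prod_pow] at hd
  rw [hd, ← Finset.mul_prod_erase J ν hi]
  field_simp

/-! ### Homogeneous Lagrange interpolation -/

/-- A factor `[i, b]` kills the term of `b` and cancels `b` from all other denominators; this drives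
the inductions on the number of nodes. -/
lemma sum_bracket_div {ζ η : ι → ℝ} (h : ∀ i j, i ≠ j → bracket ζ η i j ≠ 0) {I : Finset ι}
    {b : ι} (hb : b ∈ I) (F : ι → ℝ) :
    ∑ i ∈ I, F i * bracket ζ η i b / ∏ j ∈ I.erase i, bracket ζ η i j =
      ∑ i ∈ I.erase b, F i / ∏ j ∈ (I.erase b).erase i, bracket ζ η i j := by
  rw [← Finset.add_sum_erase I _ hb, bracket_self, mul_zero, zero_div, zero_add]
  refine Finset.sum_congr rfl fun i hi => ?_
  have hib := Finset.ne_of_mem_erase hi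
  rw [← Finset.mul_prod_erase (I.erase i) _ (Finset.mem_erase.2 ⟨hib.symm, hb⟩),
    Finset.erase_right_comm, mul_comm (F i), mul_div_mul_left _ _ (h i b hib)]

/-- The value at node `i` of a product of linear forms. -/
def formProd {κ : Type*} (ζ η : ι → ℝ) (α β : κ → ℝ) (L : Finset κ) (i : ι) : ℝ :=
  ∏ k ∈ L, (α k * ζ i + β k * η i)

/-- A form of degree two less than the number of nodes has vanishing divided difference. In the
induction one linear form is written as a combination of `[·, a]` and `[·, b]`, possible because
`[a, b] ≠ 0`, and each bracket removes a node. -/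
lemma sum_formProd_div_eq_zero {κ : Type*} [DecidableEq κ] {ζ η : ι → ℝ}
    (h : ∀ i j, i ≠ j → bracket ζ η i j ≠ 0) (α β : κ → ℝ) (L : Finset κ) :
    ∀ I : Finset ι, I.card = L.card + 2 →
      ∑ i ∈ I, formProd ζ η α β L i / ∏ j ∈ I.erase i, bracket ζ η i j = 0 := by
  induction L using Finset.induction_on with
  | empty =>
    intro I hI
    obtain ⟨a, b, hab, rfl⟩ := Finset.card_eq_two.1 (by simpa using hI)
    have h1 : ({a, b} : Finset ι).erase a = {b} := by
      ext x; simp only [Finset.mem_erase, Finset.mem_insert, Finset.mem_singleton]; grind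
    have h2 : ({a, b} : Finset ι).erase b = {a} := by
      ext x; simp only [Finset.mem_erase, Finset.mem_insert, Finset.mem_singleton]; grind
    rw [Finset.sum_pair hab, h1, h2]
    have := h a b hab
    simp only [formProd, Finset.prod_empty, Finset.prod_singleton]
    rw [bracket_swap ζ η b a]
    field_simp
    ring
  | insert k L hk ih =>
    intro I hI
    rw [Finset.card_insert_of_notMem hk] at hI
    obtain ⟨a, b, ha, hb, hab⟩ := Finset.one_lt_card_iff.1 (by omega : 1 < I.card)
    have hpt : ∀ i, formProd ζ η α β (insert k L) i =
        (α k * ζ a + β k * η a) / bracket ζ η a b * (formProd ζ η α β L i * bracket ζ η i b) -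
        (α k * ζ b + β k * η b) / bracket ζ η a b * (formProd ζ η α β L i * bracket ζ η i a) := by
      intro i
      have := h a b hab
      simp only [formProd, Finset.prod_insert hk]
      field_simp
      simp only [bracket]
      ring
    simp_rw [hpt, sub_div, mul_div_assoc]
    rw [Finset.sum_sub_distrib, ← Finset.mul_sum, ← Finset.mul_sum]
    simp_rw [← mul_div_assoc]
    rw [sum_bracket_div h hb, sum_bracket_div h ha, ih _ (by rw [Finset.card_erase_of_mem hb, hI]; rfl),
      ih _ (by rw [Finset.card_erase_of_mem ha, hI]; rfl)]
    simp

/-- Lagrange interpolation of a form of degree `|L|` through `|L| + 1` nodes, evaluated at the point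
`(s : r)`. The induction uses the three-term identity `f(i)(s η_b - r ζ_b) = f(s, r) [i, b] + f(b)(s
η_i - r ζ_i)` for a linear form `f`; the last term sums to zero by the previous lemma. -/
lemma sum_formProd_lagrange {κ : Type*} [DecidableEq κ] {ζ η : ι → ℝ}
    (h : ∀ i j, i ≠ j → bracket ζ η i j ≠ 0) (α β : κ → ℝ) (s r : ℝ) (L : Finset κ) :
    ∀ I : Finset ι, I.card = L.card + 1 →
      ∑ i ∈ I, formProd ζ η α β L i * (∏ j ∈ I.erase i, (s * η j - r * ζ j)) /
        ∏ j ∈ I.erase i, bracket ζ η i j = ∏ k ∈ L, (α k * s + β k * r) := by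
  induction L using Finset.induction_on with
  | empty =>
    intro I hI
    obtain ⟨a, rfl⟩ := Finset.card_eq_one.1 (by simpa using hI)
    simp [formProd]
  | insert k L hk ih =>
    intro I hI
    rw [Finset.card_insert_of_notMem hk] at hI
    obtain ⟨b, hb⟩ := Finset.card_pos.1 (by omega : 0 < I.card)
    have hpt : ∀ i ∈ I, formProd ζ η α β (insert k L) i * (∏ j ∈ I.erase i, (s * η j - r * ζ j)) =
        (α k * s + β k * r) * (formProd ζ η α β L i *
          (∏ j ∈ (I.erase b).erase i, (s * η j - r * ζ j)) * bracket ζ η i b) +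
        (α k * ζ b + β k * η b) * (∏ j ∈ I.erase b, (s * η j - r * ζ j)) *
          formProd ζ η α β L i := by
      intro i hi
      rw [formProd, formProd, Finset.prod_insert hk]
      rcases eq_or_ne i b with rfl | hib
      · rw [bracket_self]; ring
      · rw [← Finset.mul_prod_erase (I.erase i) _ (Finset.mem_erase.2 ⟨hib.symm, hb⟩),
          ← Finset.mul_prod_erase (I.erase b) _ (Finset.mem_erase.2 ⟨hib, hi⟩),
          Finset.erase_right_comm, bracket]
        ring
    have hs : ∑ i ∈ I, formProd ζ η α β (insert k L) i *
        (∏ j ∈ I.erase i, (s * η j - r * ζ j)) / ∏ j ∈ I.erase i, bracket ζ η i j =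
        (α k * s + β k * r) * ∑ i ∈ I, formProd ζ η α β L i *
          (∏ j ∈ (I.erase b).erase i, (s * η j - r * ζ j)) * bracket ζ η i b /
            ∏ j ∈ I.erase i, bracket ζ η i j +
        (α k * ζ b + β k * η b) * (∏ j ∈ I.erase b, (s * η j - r * ζ j)) *
          ∑ i ∈ I, formProd ζ η α β L i / ∏ j ∈ I.erase i, bracket ζ η i j := by
      rw [Finset.mul_sum, Finset.mul_sum, ← Finset.sum_add_distrib]
      exact Finset.sum_congr rfl fun i hi => by rw [hpt i hi]; ring
    rw [hs, sum_bracket_div h hb, ih _ (by rw [Finset.card_erase_of_mem hb, hI]; rfl),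
      sum_formProd_div_eq_zero h α β L I (by omega), Finset.prod_insert hk]
    ring

/-- Interpolation of a product of brackets. -/
lemma sum_bracket_lagrange {ζ η : ι → ℝ} (h : ∀ i j, i ≠ j → bracket ζ η i j ≠ 0) (s r : ℝ)
    {L I : Finset ι} (hc : I.card = L.card + 1) :
    ∑ i ∈ I, (∏ k ∈ L, bracket ζ η i k) * (∏ j ∈ I.erase i, (s * η j - r * ζ j)) /
      ∏ j ∈ I.erase i, bracket ζ η i j = ∏ k ∈ L, (s * η k - r * ζ k) := by
  convert sum_formProd_lagrange h η (fun k => -ζ k) s r L I hc using 1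
  · refine Finset.sum_congr rfl fun i _ => ?_
    congr 2
    exact Finset.prod_congr rfl fun k _ => by simp only [bracket]; ring
  · exact Finset.prod_congr rfl fun k _ => by ring

/-- The extra factor `ζ i` is one more linear form, indexed by `none`; its value at `(s : r)` is
`s`. -/
lemma sum_bracket_lagrange_mul {ζ η : ι → ℝ} (h : ∀ i j, i ≠ j → bracket ζ η i j ≠ 0) (s r : ℝ)
    {L I : Finset ι} (hc : I.card = L.card + 2) :
    ∑ i ∈ I, (∏ k ∈ L, bracket ζ η i k) * ζ i * (∏ j ∈ I.erase i, (s * η j - r * ζ j)) /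
      ∏ j ∈ I.erase i, bracket ζ η i j = s * ∏ k ∈ L, (s * η k - r * ζ k) := by
  convert sum_formProd_lagrange h (fun k : Option ι => k.elim 1 η)
    (fun k : Option ι => k.elim 0 fun k => -ζ k) s r (Finset.insertNone L) I
    (by rw [Finset.card_insertNone, hc]) using 1
  · refine Finset.sum_congr rfl fun i _ => ?_
    congr 2
    rw [formProd, Finset.prod_insertNone, mul_comm]
    congr 1
    · simp
    · exact Finset.prod_congr rfl fun k _ => by simp only [bracket, Option.elim]; ring
  · rw [Finset.prod_insertNone]
    congr 1
    · simp
    · exact Finset.prod_congr rfl fun k _ => by simp only [Option.elim]; ring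

/-- For a fixed `k ∈ L`, `[i, k] = η_k (ζ_i + y η_i) - (ζ_k + y η_k) η_i`. Each term completes one
of the two products over `I.erase i` to a product over `I`, and what remains is ordinary
interpolation at `(1 : 0)` or at `(y : -1)`. -/
lemma sum_bracket_lagrange_two {ζ η : ι → ℝ} (h : ∀ i j, i ≠ j → bracket ζ η i j ≠ 0) (y : ℝ)
    {L I : Finset ι} (hc : I.card = L.card) (hI : I.Nonempty) :
    ∑ i ∈ I, (∏ k ∈ L, bracket ζ η i k) *
        (∏ j ∈ I.erase i, η j) * (∏ j ∈ I.erase i, (ζ j + y * η j)) /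
      ∏ j ∈ I.erase i, bracket ζ η i j =
    (∏ k ∈ L, η k) * ∏ i ∈ I, (ζ i + y * η i) - (∏ k ∈ L, (ζ k + y * η k)) * ∏ i ∈ I, η i := by
  obtain ⟨k, hk⟩ : L.Nonempty := by rw [← Finset.card_pos, ← hc]; exact hI.card_pos
  have hc' : I.card = (L.erase k).card + 1 := by rw [Finset.card_erase_add_one hk, hc]
  have h1 := sum_bracket_lagrange h 1 0 hc'
  have h2 := sum_bracket_lagrange h y (-1) hc'
  have e1 : ∀ S : Finset ι, ∏ j ∈ S, (1 * η j - 0 * ζ j) = ∏ j ∈ S, η j := fun S =>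
    Finset.prod_congr rfl fun j _ => by ring
  have e2 : ∀ S : Finset ι, ∏ j ∈ S, (y * η j - -1 * ζ j) = ∏ j ∈ S, (ζ j + y * η j) := fun S =>
    Finset.prod_congr rfl fun j _ => by ring
  simp only [e1, e2] at h1 h2
  have hpt : ∀ i ∈ I, (∏ k ∈ L, bracket ζ η i k) *
        (∏ j ∈ I.erase i, η j) * (∏ j ∈ I.erase i, (ζ j + y * η j)) /
      ∏ j ∈ I.erase i, bracket ζ η i j =
      η k * (∏ i ∈ I, (ζ i + y * η i)) *
        ((∏ k ∈ L.erase k, bracket ζ η i k) * (∏ j ∈ I.erase i, η j) /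
          ∏ j ∈ I.erase i, bracket ζ η i j) -
      (ζ k + y * η k) * (∏ i ∈ I, η i) *
        ((∏ k ∈ L.erase k, bracket ζ η i k) * (∏ j ∈ I.erase i, (ζ j + y * η j)) /
          ∏ j ∈ I.erase i, bracket ζ η i j) := by
    intro i hi
    rw [← Finset.mul_prod_erase L _ hk, ← Finset.mul_prod_erase I η hi,
      ← Finset.mul_prod_erase I (fun i => ζ i + y * η i) hi]
    simp only [bracket]
    ring
  rw [Finset.sum_congr rfl hpt, Finset.sum_sub_distrib, ← Finset.mul_sum, ← Finset.mul_sum, h1, h2,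
    ← Finset.mul_prod_erase L η hk, ← Finset.mul_prod_erase L (fun k => ζ k + y * η k) hk]
  ring

end SubsetSums

/-! ### Bilinear relations between subset sums -/

section BilinearIdentity

variable {ι : Type*} [DecidableEq ι]

lemma hsum_mul_hsum (ζ η : ι → ℝ) (S : Finset ι) (k l : ℕ) (ν ν' : ι → ℝ) :
    hsum ζ η S k ν * hsum ζ η S l ν' = ∑ I ∈ S.powersetCard k, ∑ L ∈ S.powersetCard l,
      (∏ i ∈ I, ν i) * discr ζ η I * ((∏ i ∈ L, ν' i) * discr ζ η L) := by
  rw [hsum, hsum, Finset.sum_mul_sum]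

/-- Exchange of an element between two subsets: the sum over triples `(K, L, i)` can be collected
according to `(K, L ∪ {i})` or to `(K ∪ {i}, L)`. -/
lemma sum_exchange {ζ η : ι → ℝ} (h : ∀ i j, i ≠ j → bracket ζ η i j ≠ 0) (S : Finset ι) (k l : ℕ)
    (ν : ι → ℝ) (φ : Finset ι → Finset ι → ι → ℝ) :
    ∑ K ∈ S.powersetCard k, ∑ J ∈ S.powersetCard (l + 1),
      (∏ i ∈ K, ν i) * discr ζ η K * ((∏ i ∈ J, ν i) * discr ζ η J *
        ∑ i ∈ J, (∏ j ∈ K, bracket ζ η i j) * φ K (J.erase i) i /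
          ∏ j ∈ J.erase i, bracket ζ η i j) =
    ∑ I ∈ S.powersetCard (k + 1), ∑ L ∈ S.powersetCard l,
      (∏ i ∈ L, ν i) * discr ζ η L * ((∏ i ∈ I, ν i) * discr ζ η I *
        ∑ i ∈ I, (∏ j ∈ L, bracket ζ η i j) * φ (I.erase i) L i /
          ∏ j ∈ I.erase i, bracket ζ η i j) := by
  rw [Finset.sum_comm (s := S.powersetCard (k + 1))]
  -- Undoing the marking on either side gives the same sum over triples `(K, L, i)`, whose summand
  -- carries `∏_K [i, j] ∏_L [i, j]` and is therefore symmetric in the roles of `K` and `L`.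
  have h1 : ∀ K ∈ S.powersetCard k, _ := fun K _ =>
    (sum_marked h S l ν fun i L => (∏ j ∈ K, bracket ζ η i j) * φ K L i).symm
  have h2 : ∀ L ∈ S.powersetCard l, _ := fun L _ =>
    (sum_marked h S k ν fun i K => (∏ j ∈ L, bracket ζ η i j) * φ K L i).symm
  simp_rw [← Finset.mul_sum]
  rw [Finset.sum_congr rfl fun K hK => congrArg _ (h1 K hK),
    Finset.sum_congr rfl fun L hL => congrArg _ (h2 L hL)]
  simp_rw [Finset.mul_sum]
  rw [Finset.sum_comm]
  refine Finset.sum_congr rfl fun L _ => Finset.sum_congr rfl fun K _ =>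
    Finset.sum_congr rfl fun i _ => ?_
  ring

/-- Both sides are one sum over triples `(K, L, i)` with `|K| = |L| = l`. Adding `i` to `L` leads to
one interpolation at `(y : -1)`; adding it to `K` splits `ζ_i + x η_i` into two, at `(1 : 0)` and
`(0 : -1)`. -/
lemma hsum_bilinear_odd {ζ η : ι → ℝ} (h : ∀ i j, i ≠ j → bracket ζ η i j ≠ 0) (S : Finset ι)
    (l : ℕ) (ν : ι → ℝ) (x y : ℝ) :
    hsum ζ η S (l + 1) (fun i => ν i * (ζ i + x * η i)) *
      hsum ζ η S l (fun i => ν i * (ζ i * η i * (ζ i + y * η i))) =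
    x * (hsum ζ η S (l + 1) (fun i => ν i * η i) *
      hsum ζ η S l (fun i => ν i * (ζ i * ((ζ i + x * η i) * (ζ i + y * η i))))) +
    hsum ζ η S (l + 1) (fun i => ν i * ζ i) *
      hsum ζ η S l (fun i => ν i * (η i * ((ζ i + x * η i) * (ζ i + y * η i)))) := by
  -- After adding `i` to `L`, the factors `ζ + x η` form the full product over `J`, and `ζ + y η`
  -- remains over `J.erase i` as the interpolation kernel.
  have key := sum_exchange h S l l ν fun K L i => (∏ j ∈ K, (ζ j * η j)) *
    (∏ j ∈ L, ((ζ j + x * η j) * (ζ j + y * η j))) * (ζ i + x * η i)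
  rw [mul_comm, hsum_mul_hsum, hsum_mul_hsum, hsum_mul_hsum, Finset.mul_sum,
    ← Finset.sum_add_distrib]
  simp_rw [Finset.mul_sum (s := S.powersetCard l), ← Finset.sum_add_distrib]
  have e1 : ∀ S : Finset ι, ∏ j ∈ S, (1 * η j - 0 * ζ j) = ∏ j ∈ S, η j := fun S =>
    Finset.prod_congr rfl fun j _ => by ring
  have e2 : ∀ S : Finset ι, ∏ j ∈ S, (y * η j - -1 * ζ j) = ∏ j ∈ S, (ζ j + y * η j) := fun S =>
    Finset.prod_congr rfl fun j _ => by ring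
  have e3 : ∀ S : Finset ι, ∏ j ∈ S, (0 * η j - -1 * ζ j) = ∏ j ∈ S, ζ j := fun S =>
    Finset.prod_congr rfl fun j _ => by ring
  refine Eq.trans ?_ (key.trans ?_)
  · refine Finset.sum_congr rfl fun K hK => Finset.sum_congr rfl fun J hJ => ?_
    have hc : J.card = K.card + 1 := by
      rw [(Finset.mem_powersetCard.1 hK).2, (Finset.mem_powersetCard.1 hJ).2]
    have hl := sum_bracket_lagrange h y (-1) hc
    simp only [e2] at hl
    have : ∑ i ∈ J, (∏ j ∈ K, bracket ζ η i j) * ((∏ j ∈ K, (ζ j * η j)) *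
        (∏ j ∈ J.erase i, ((ζ j + x * η j) * (ζ j + y * η j))) * (ζ i + x * η i)) /
          ∏ j ∈ J.erase i, bracket ζ η i j =
        (∏ j ∈ K, (ζ j * η j)) * (∏ j ∈ J, (ζ j + x * η j)) * ∏ j ∈ K, (ζ j + y * η j) := by
      rw [← hl, Finset.mul_sum]
      refine Finset.sum_congr rfl fun i hi => ?_
      rw [Finset.prod_mul_distrib (s := J.erase i),
        ← Finset.mul_prod_erase J (fun j => ζ j + x * η j) hi]
      ring
    rw [this]
    simp only [Finset.prod_mul_distrib]
    ring
  · refine Finset.sum_congr rfl fun I hI => Finset.sum_congr rfl fun L hL => ?_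
    have hc : I.card = L.card + 1 := by
      rw [(Finset.mem_powersetCard.1 hI).2, (Finset.mem_powersetCard.1 hL).2]
    have hl := sum_bracket_lagrange h 1 0 hc
    have hl' := sum_bracket_lagrange h 0 (-1) hc
    simp only [e1, e3] at hl hl'
    have : ∑ i ∈ I, (∏ j ∈ L, bracket ζ η i j) * ((∏ j ∈ I.erase i, (ζ j * η j)) *
        (∏ j ∈ L, ((ζ j + x * η j) * (ζ j + y * η j))) * (ζ i + x * η i)) /
          ∏ j ∈ I.erase i, bracket ζ η i j =
        (∏ j ∈ L, ((ζ j + x * η j) * (ζ j + y * η j))) *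
          ((∏ i ∈ I, ζ i) * (∏ k ∈ L, η k) + x * (∏ i ∈ I, η i) * ∏ k ∈ L, ζ k) := by
      rw [← hl, ← hl', Finset.mul_sum, Finset.mul_sum, ← Finset.sum_add_distrib, Finset.mul_sum]
      refine Finset.sum_congr rfl fun i hi => ?_
      rw [Finset.prod_mul_distrib (s := I.erase i), ← Finset.mul_prod_erase I ζ hi,
        ← Finset.mul_prod_erase I η hi]
      ring
    rw [this]
    simp only [Finset.prod_mul_distrib]
    ring

/-- Here `|L| = |K| + 1`. Adding `i` to `L` gives two spare degrees, which the factor `ζ_i` turns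
into a factor `x`; adding it to `K` gives two sets of equal size and hence a difference of two
products. -/
lemma hsum_bilinear_even {ζ η : ι → ℝ} (h : ∀ i j, i ≠ j → bracket ζ η i j ≠ 0) (S : Finset ι)
    (l : ℕ) (ν : ι → ℝ) (x y : ℝ) :
    hsum ζ η S (l + 1) (fun i => ν i * (η i * (ζ i + x * η i))) *
      hsum ζ η S (l + 1) (fun i => ν i * (ζ i * (ζ i + y * η i))) =
    x * (hsum ζ η S (l + 2) ν *
      hsum ζ η S l (fun i => ν i * (ζ i * η i * ((ζ i + x * η i) * (ζ i + y * η i))))) +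
    hsum ζ η S (l + 1) (fun i => ν i * (ζ i * η i)) *
      hsum ζ η S (l + 1) (fun i => ν i * ((ζ i + x * η i) * (ζ i + y * η i))) := by
  have key := sum_exchange h S l (l + 1) ν fun K L i =>
    (∏ j ∈ K, (ζ j * η j * (ζ j + y * η j))) * (∏ j ∈ L, (ζ j + x * η j)) * ζ i
  rw [← sub_eq_iff_eq_add, mul_comm (hsum ζ η S (l + 2) ν), mul_comm (hsum ζ η S (l + 1) _),
    hsum_mul_hsum, hsum_mul_hsum, hsum_mul_hsum, Finset.mul_sum, ← Finset.sum_sub_distrib]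
  simp_rw [Finset.mul_sum (s := S.powersetCard (l + 2)), ← Finset.sum_sub_distrib]
  have e2 : ∀ S : Finset ι, ∏ j ∈ S, (x * η j - -1 * ζ j) = ∏ j ∈ S, (ζ j + x * η j) := fun S =>
    Finset.prod_congr rfl fun j _ => by ring
  refine Eq.trans ?_ (key.symm.trans ?_)
  · refine Finset.sum_congr rfl fun I hI => Finset.sum_congr rfl fun L hL => ?_
    have hc : I.card = L.card := by
      rw [(Finset.mem_powersetCard.1 hI).2, (Finset.mem_powersetCard.1 hL).2]
    have hne : I.Nonempty := by
      rw [← Finset.card_pos, (Finset.mem_powersetCard.1 hI).2]; omega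
    have : ∑ i ∈ I, (∏ j ∈ L, bracket ζ η i j) *
        ((∏ j ∈ I.erase i, (ζ j * η j * (ζ j + y * η j))) * (∏ j ∈ L, (ζ j + x * η j)) * ζ i) /
          ∏ j ∈ I.erase i, bracket ζ η i j =
        (∏ j ∈ L, (ζ j + x * η j)) * (∏ j ∈ I, ζ j) *
        ((∏ k ∈ L, η k) * ∏ i ∈ I, (ζ i + y * η i) -
          (∏ k ∈ L, (ζ k + y * η k)) * ∏ i ∈ I, η i) := by
      rw [← sum_bracket_lagrange_two h y hc hne, Finset.mul_sum]
      refine Finset.sum_congr rfl fun i hi => ?_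
      rw [Finset.prod_mul_distrib (s := I.erase i), Finset.prod_mul_distrib (s := I.erase i),
        ← Finset.mul_prod_erase I ζ hi]
      ring
    rw [this]
    simp only [Finset.prod_mul_distrib]
    ring
  · refine Finset.sum_congr rfl fun K hK => Finset.sum_congr rfl fun J hJ => ?_
    have hc : J.card = K.card + 2 := by
      rw [(Finset.mem_powersetCard.1 hK).2, (Finset.mem_powersetCard.1 hJ).2]
    have hl := sum_bracket_lagrange_mul h x (-1) hc
    simp only [e2] at hl
    have : ∑ i ∈ J, (∏ j ∈ K, bracket ζ η i j) *
        ((∏ j ∈ K, (ζ j * η j * (ζ j + y * η j))) * (∏ j ∈ J.erase i, (ζ j + x * η j)) * ζ i) /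
          ∏ j ∈ J.erase i, bracket ζ η i j =
        (∏ j ∈ K, (ζ j * η j * (ζ j + y * η j))) * (x * ∏ k ∈ K, (ζ k + x * η k)) := by
      rw [← hl, Finset.mul_sum]
      exact Finset.sum_congr rfl fun i _ => by ring
    rw [this]
    simp only [Finset.prod_mul_distrib]
    ring

/-- The numerator sums: `⌈k/2⌉`-element subsets, with an extra factor `η` for even `k`. -/
def numSum (ζ η : ι → ℝ) (S : Finset ι) (k : ℕ) (ν : ι → ℝ) : ℝ :=
  hsum ζ η S ((k + 1) / 2) fun i => ν i * if Even k then η i else 1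

/-- The denominator sums: `⌊k/2⌋`-element subsets, with an extra factor `ζ` for even `k` and
`ζ η` for odd `k`. -/
def denSum (ζ η : ι → ℝ) (S : Finset ι) (k : ℕ) (ν : ι → ℝ) : ℝ :=
  hsum ζ η S (k / 2) fun i => ν i * if Even k then ζ i else ζ i * η i

lemma numSum_even (ζ η : ι → ℝ) (S : Finset ι) (j : ℕ) (ν : ι → ℝ) :
    numSum ζ η S (2 * j) ν = hsum ζ η S j fun i => ν i * η i := by
  simp [numSum, show (2 * j + 1) / 2 = j by omega]

lemma numSum_odd (ζ η : ι → ℝ) (S : Finset ι) (j : ℕ) (ν : ι → ℝ) :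
    numSum ζ η S (2 * j + 1) ν = hsum ζ η S (j + 1) ν := by
  simp [numSum, show (2 * j + 1 + 1) / 2 = j + 1 by omega]

lemma denSum_even (ζ η : ι → ℝ) (S : Finset ι) (j : ℕ) (ν : ι → ℝ) :
    denSum ζ η S (2 * j) ν = hsum ζ η S j fun i => ν i * ζ i := by
  simp [denSum]

lemma denSum_odd (ζ η : ι → ℝ) (S : Finset ι) (j : ℕ) (ν : ι → ℝ) :
    denSum ζ η S (2 * j + 1) ν = hsum ζ η S j fun i => ν i * (ζ i * η i) := by
  simp [denSum, show (2 * j + 1) / 2 = j by omega]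

/-- The roles of `x` and `y` are not symmetric: interchanging them changes the left side and the
coefficient `x`, but not the products on the right. The two versions together give both components
of one step of the string recursion. -/
lemma numSum_mul_denSum {ζ η : ι → ℝ} (h : ∀ i j, i ≠ j → bracket ζ η i j ≠ 0) (S : Finset ι)
    (k : ℕ) (ν : ι → ℝ) (x y : ℝ) :
    numSum ζ η S (k + 1) (fun i => ν i * (ζ i + x * η i)) *
      denSum ζ η S (k + 1) (fun i => ν i * (ζ i + y * η i)) =
    x * (numSum ζ η S (k + 2) ν *
      denSum ζ η S k (fun i => ν i * ((ζ i + x * η i) * (ζ i + y * η i)))) +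
    denSum ζ η S (k + 2) ν *
      numSum ζ η S k (fun i => ν i * ((ζ i + x * η i) * (ζ i + y * η i))) := by
  rcases Nat.even_or_odd' k with ⟨j, rfl | rfl⟩
  · rw [numSum_odd, denSum_odd, show 2 * j + 2 = 2 * (j + 1) by ring, numSum_even, denSum_even,
      numSum_even, denSum_even]
    have := hsum_bilinear_odd h S j ν x y
    simp only [mul_comm, mul_left_comm] at this ⊢
    linarith
  · rw [show 2 * j + 1 + 1 = 2 * (j + 1) by ring, show 2 * j + 1 + 2 = 2 * (j + 1) + 1 by ring,
      numSum_even, denSum_even, numSum_odd, denSum_odd, numSum_odd, denSum_odd]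
    have := hsum_bilinear_even h S j ν x y
    simp only [mul_comm, mul_left_comm] at this ⊢
    linarith

end BilinearIdentity

/-! ### The discrete string recursion over a commutative ring -/

section Chain

open Polynomial

/-- The recursion `q_{k+1} = q_k + h_k p_k`, `p_{k+1} = p_k - z g_k q_k` with `q_0 = 0`,
`p_0 = 1`. -/
def chain {R : Type*} [CommRing R] (h g : ℕ → R) (z : R) : ℕ → R × R
  | 0 => (0, 1)
  | k + 1 => ((chain h g z k).1 + h k * (chain h g z k).2,
      (chain h g z k).2 - z * g k * (chain h g z k).1)

/-- Applied to evaluation maps, this lets one polynomial pair serve both the real computations and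
the complex spectral problem. -/
lemma map_chain {R S : Type*} [CommRing R] [CommRing S] (f : R →+* S) (h g : ℕ → R) (z : R)
    (k : ℕ) : chain (fun i => f (h i)) (fun i => f (g i)) (f z) k =
      (f (chain h g z k).1, f (chain h g z k).2) := by
  induction k with
  | zero => simp [chain]
  | succ k ih => simp [chain, ih]

lemma chain_zero_param {R : Type*} [CommRing R] (h g : ℕ → R) (n : ℕ) :
    chain h g 0 n = (∑ i ∈ Finset.range n, h i, 1) := by
  induction n with
  | zero => rfl
  | succ k ih => simp [chain, ih, Finset.sum_range_succ]

/-- For `z < 0` every step adds nonnegative terms, so nothing vanishes on the negative axis; the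
identification of the polynomials takes place there. -/
lemma chain_nonneg {h g : ℕ → ℝ} {z : ℝ} (hz : z < 0) {n : ℕ} (hh : ∀ i < n, 0 < h i)
    (hg : ∀ i < n, 0 < g i) : 0 ≤ (chain h g z n).1 ∧ 1 ≤ (chain h g z n).2 := by
  induction n with
  | zero => simp [chain]
  | succ k ih =>
    obtain ⟨h1, h2⟩ := ih (fun i hi => hh i (by omega)) (fun i hi => hg i (by omega))
    have hk := hh k (by omega)
    have gk := hg k (by omega)
    simp only [chain]
    have := mul_nonneg (mul_nonneg (neg_nonneg.2 hz.le) gk.le) h1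
    constructor
    · have := mul_nonneg hk.le (zero_le_one.trans h2)
      linarith
    · linarith

lemma chain_fst_pos {h g : ℕ → ℝ} {z : ℝ} (hz : z < 0) {n : ℕ} (hh : ∀ i < n + 1, 0 < h i)
    (hg : ∀ i < n + 1, 0 < g i) : 0 < (chain h g z (n + 1)).1 := by
  obtain ⟨h1, h2⟩ := chain_nonneg hz (fun i (hi : i < n) => hh i (by omega))
    (fun i hi => hg i (by omega))
  simp only [chain]
  have := mul_pos (hh n (by omega)) (zero_lt_one.trans_le h2)
  linarith

/-- The chain as a pair of polynomials in the spectral parameter. -/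
def polyChain (h g : ℕ → ℝ) (n : ℕ) : ℝ[X] × ℝ[X] :=
  chain (fun i => C (h i)) (fun i => C (g i)) X n

lemma eval_polyChain (h g : ℕ → ℝ) (n : ℕ) (z : ℝ) :
    ((polyChain h g n).1.eval z, (polyChain h g n).2.eval z) = chain h g z n := by
  have := map_chain (evalRingHom z) (fun i => C (h i)) (fun i => C (g i)) X n
  simpa [polyChain] using this.symm

lemma eval_polyChain_fst (h g : ℕ → ℝ) (n : ℕ) (z : ℝ) :
    (polyChain h g n).1.eval z = (chain h g z n).1 := by rw [← eval_polyChain]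

lemma eval_polyChain_snd (h g : ℕ → ℝ) (n : ℕ) (z : ℝ) :
    (polyChain h g n).2.eval z = (chain h g z n).2 := by rw [← eval_polyChain]

/-- Only the step from `q` to `p` carries a factor `z`, so the degree grows once in two steps. -/
lemma natDegree_polyChain (h g : ℕ → ℝ) (n : ℕ) :
    (polyChain h g n).1.natDegree ≤ (n - 1) / 2 ∧ (polyChain h g n).2.natDegree ≤ n / 2 ∧
      (n = 0 → (polyChain h g n).1 = 0) := by
  induction n with
  | zero => simp [polyChain, chain]
  | succ k ih =>
    obtain ⟨h1, h2, h3⟩ := ih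
    simp only [polyChain, chain] at *
    refine ⟨(natDegree_add_le_of_degree_le (n := k / 2) (h1.trans (by omega))
      ((natDegree_C_mul_le _ _).trans h2)).trans (by omega), ?_, by simp⟩
    rcases Nat.eq_zero_or_pos k with rfl | hk
    · simp [chain]
    · refine natDegree_sub_le_of_le (h2.trans (by omega)) ?_ |>.trans (le_of_eq (max_self _))
      rw [mul_assoc]
      refine natDegree_mul_le.trans ?_
      rw [natDegree_X]
      have := (natDegree_C_mul_le (g k) (chain (fun i => C (h i)) (fun i => C (g i)) X k).1)
      omega

/-- The quotient of the two polynomials and the products `h_k g_k` determine the chain. -/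
lemma eq_of_polyChain_proportional {h g h' g' : ℕ → ℝ} {n : ℕ} (hh : ∀ i < n, 0 < h i)
    (hg : ∀ i < n, 0 < g i) (hh' : ∀ i < n, 0 < h' i) (hg' : ∀ i < n, 0 < g' i)
    (hprod : ∀ i < n, h i * g i = h' i * g' i)
    (hpq : (polyChain h g n).1 * (polyChain h' g' n).2 =
      (polyChain h' g' n).1 * (polyChain h g n).2) : ∀ i < n, h i = h' i := by
  induction n with
  | zero => intro i hi; omega
  | succ k ih =>
    have hk := hh k (by omega)
    have gk := hg k (by omega)
    have hk' := hh' k (by omega)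
    have gk' := hg' k (by omega)
    have hpk := hprod k (by omega)
    have hlast : h k = h' k := by
      -- At this point `-z g_k = 1 / h_k`, hence `h_k p_{k+1} = q_{k+1}`: the quotient `q / p` takes
      -- the value `h_k`. Both chains use the same point because their products `h_k g_k` agree.
      have hz : -(1 / (h k * g k)) < 0 := by
        have : 0 < 1 / (h k * g k) := by positivity
        linarith
      have e := congrArg (eval (-(1 / (h k * g k)))) hpq
      rw [eval_mul, eval_mul, eval_polyChain_fst, eval_polyChain_fst, eval_polyChain_snd,
        eval_polyChain_snd] at e
      have q1 := chain_fst_pos hz hh hg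
      have q2 := chain_fst_pos hz hh' hg'
      have p1 : (chain h g (-(1 / (h k * g k))) (k + 1)).2 * h k =
          (chain h g (-(1 / (h k * g k))) (k + 1)).1 := by
        simp only [chain]; field_simp; ring
      have p2 : (chain h' g' (-(1 / (h k * g k))) (k + 1)).2 * h' k =
          (chain h' g' (-(1 / (h k * g k))) (k + 1)).1 := by
        rw [hpk]
        simp only [chain]; field_simp; ring
      rw [← p1, ← p2] at e
      rw [← p1] at q1
      rw [← p2] at q2
      have a1 := pos_of_mul_pos_left q1 hk.le
      have a2 := pos_of_mul_pos_left q2 hk'.le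
      have : (chain h g (-(1 / (h k * g k))) (k + 1)).2 *
        (chain h' g' (-(1 / (h k * g k))) (k + 1)).2 * (h k - h' k) = 0 := by linarith
      have := (mul_eq_zero.1 this).resolve_left (mul_pos a1 a2).ne'
      linarith
    have glast : g k = g' k := by
      rw [← hlast] at hpk
      exact mul_left_cancel₀ hk.ne' hpk
    have hrest : ∀ i < k, h i = h' i := by
      refine ih (fun i hi => hh i (by omega)) (fun i hi => hg i (by omega))
        (fun i hi => hh' i (by omega)) (fun i hi => hg' i (by omega))
        (fun i hi => hprod i (by omega)) ?_
      -- This is the determinant of the last step matrix. The cross product `q p' - q' p` after the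
      -- step is the determinant times the one before it.
      have hne : (1 + C (h k * g k) * X : ℝ[X]) ≠ 0 := by
        intro h0
        have := congrArg (eval 0) h0
        simp at this
      refine mul_left_cancel₀ hne ?_
      simp only [polyChain, chain] at hpq ⊢
      rw [← hlast, ← glast] at hpq
      rw [C_mul]
      linear_combination hpq
    intro i hi
    rcases Nat.lt_succ_iff_lt_or_eq.1 hi with hi | rfl
    · exact hrest i hi
    · exact hlast

/-- The time evolution of the chain under the peakon flow. -/
lemma hasDerivAt_chain {h g : ℝ → ℕ → ℝ} {n : ℕ} {t z : ℝ} (hz : z ≠ 0)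
    {v : ℕ → ℝ} (hh : ∀ k < n, HasDerivAt (fun s => h s k) (h t k * v k) t)
    (hg : ∀ k < n, HasDerivAt (fun s => g s k) (-(g t k * v k)) t)
    (hv : ∀ k < n, v k =
      2 * (∑ i ∈ Finset.range (k + 1), h t i) * (∑ i ∈ Finset.Ico (k + 1) n, g t i) +
        2 * (∑ i ∈ Finset.range k, h t i) * ∑ i ∈ Finset.Ico k n, g t i) :
    ∀ k ≤ n,
      HasDerivAt (fun s => (chain (h s) (g s) z k).1)
        ((2 / z + 2 * (∑ i ∈ Finset.range k, h t i) * ∑ i ∈ Finset.Ico k n, g t i) *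
          (chain (h t) (g t) z k).1 -
          2 / z * (∑ i ∈ Finset.range k, h t i) * (chain (h t) (g t) z k).2) t ∧
      HasDerivAt (fun s => (chain (h s) (g s) z k).2)
        (2 * (∑ i ∈ Finset.Ico k n, g t i) * (chain (h t) (g t) z k).1 -
          2 * (∑ i ∈ Finset.range k, h t i) * (∑ i ∈ Finset.Ico k n, g t i) *
            (chain (h t) (g t) z k).2) t := by
  intro k
  induction k with
  | zero => simp [chain, hasDerivAt_const]
  | succ k ih =>
    intro hk
    obtain ⟨h1, h2⟩ := ih (by omega)
    have hA := Finset.sum_range_succ (h t) k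
    have hB := Finset.sum_eq_sum_Ico_succ_bot (show k < n by omega) (g t)
    have hvk := hv k (by omega)
    have dh := hh k (by omega)
    have dg := hg k (by omega)
    simp only [chain]
    rw [hA] at hvk ⊢
    rw [hB] at hvk h1 h2
    constructor
    · refine (h1.add (dh.mul h2)).congr_deriv ?_
      rw [hvk]
      field_simp
      ring
    · refine (h2.sub ((dg.const_mul z).mul h1)).congr_deriv ?_
      rw [hvk]
      field_simp
      ring

end Chain

/-! ### Spectral polynomials and their evolution in time -/

section SpectralData

open Polynomial

/-- Extension of a finite sequence by zero. -/
def extendZero {n : ℕ} (f : Fin n → ℝ) (k : ℕ) : ℝ := if hk : k < n then f ⟨k, hk⟩ else 0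

lemma extendZero_val {n : ℕ} (f : Fin n → ℝ) (k : Fin n) : extendZero f k = f k := by
  simp [extendZero]

/-- The coefficients `h_k = m_k e^{x_k}`. -/
def hCoeff {n : ℕ} (m x : Fin n → ℝ) : ℕ → ℝ := extendZero fun k => m k * Real.exp (x k)

/-- The coefficients `g_k = m_k e^{-x_k}`. -/
def gCoeff {n : ℕ} (m x : Fin n → ℝ) : ℕ → ℝ := extendZero fun k => m k * Real.exp (-x k)

/-- The polynomials `(q_n, p_n)`. -/
def spectralPoly {n : ℕ} (m x : Fin n → ℝ) : ℝ[X] × ℝ[X] :=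
  polyChain (hCoeff m x) (gCoeff m x) n

lemma transfer_eq_chain {n : ℕ} (m x : Fin n → ℝ) (z : ℂ) (k : ℕ) (hk : k < n + 1) :
    transfer m x z ⟨k, hk⟩ =
      chain (fun i => (hCoeff m x i : ℂ)) (fun i => (gCoeff m x i : ℂ)) z k := by
  induction k with
  | zero => rfl
  | succ k ih =>
    have hk' : k < n := by omega
    have hs : (⟨k + 1, hk⟩ : Fin (n + 1)) = Fin.succ ⟨k, hk'⟩ := rfl
    rw [hs, transfer, Fin.induction_succ]
    have := ih (by omega)
    rw [transfer] at this
    have e : (⟨k, hk'⟩ : Fin n).castSucc = ⟨k, by omega⟩ := rfl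
    rw [e, this]
    simp only [chain, hCoeff, gCoeff, extendZero, hk', dif_pos]

lemma transfer_last {n : ℕ} (m x : Fin n → ℝ) (z : ℂ) :
    transfer m x z (Fin.last n) =
      (aeval z (spectralPoly m x).1, aeval z (spectralPoly m x).2) := by
  rw [Fin.last, transfer_eq_chain]
  have := map_chain (aeval z : ℝ[X] →ₐ[ℝ] ℂ).toRingHom (fun i => C (hCoeff m x i))
    (fun i => C (gCoeff m x i)) X n
  simpa [spectralPoly, polyChain] using this

lemma qLast_eq {n : ℕ} (m x : Fin n → ℝ) (z : ℂ) :
    qLast m x z = aeval z (spectralPoly m x).1 := by rw [qLast, transfer_last]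

lemma pLast_eq {n : ℕ} (m x : Fin n → ℝ) (z : ℂ) :
    pLast m x z = aeval z (spectralPoly m x).2 := by rw [pLast, transfer_last]

/-- The polynomial `∏_j (1 - z / ζ_j)`. -/
def denPoly {K : ℕ} (ζ : Fin K → ℝ) : ℝ[X] := ∏ j, (1 - C (1 / ζ j) * X)

/-- The polynomial `(c + ∑_j b_j / (ζ_j - z)) ∏_j (1 - z / ζ_j)`. -/
def numPoly {K : ℕ} (ζ b : Fin K → ℝ) (c : ℝ) : ℝ[X] :=
  C c * denPoly ζ + ∑ j, C (b j / ζ j) * ∏ i ∈ Finset.univ.erase j, (1 - C (1 / ζ i) * X)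

lemma natDegree_factor (a : ℝ) : (1 - C a * X : ℝ[X]).natDegree ≤ 1 := by
  refine natDegree_sub_le_of_le (by simp) (natDegree_C_mul_le _ _ |>.trans natDegree_X_le)
    |>.trans (le_of_eq (max_self _))

lemma natDegree_denPoly {K : ℕ} (ζ : Fin K → ℝ) : (denPoly ζ).natDegree ≤ K := by
  refine (natDegree_prod_le _ _).trans ((Finset.sum_le_card_nsmul _ _ 1
    fun j _ => natDegree_factor _).trans ?_)
  simp

lemma natDegree_numPoly {K : ℕ} (ζ b : Fin K → ℝ) (c : ℝ) : (numPoly ζ b c).natDegree ≤ K := by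
  refine natDegree_add_le_of_degree_le ((natDegree_C_mul_le _ _).trans (natDegree_denPoly ζ))
    (natDegree_sum_le_of_forall_le _ _ fun j _ => (natDegree_C_mul_le _ _).trans ?_)
  refine (natDegree_prod_le _ _).trans ((Finset.sum_le_card_nsmul _ _ 1
    fun j _ => natDegree_factor _).trans ?_)
  rw [Finset.card_erase_of_mem (Finset.mem_univ j)]
  simp

lemma aeval_denPoly {K : ℕ} (ζ : Fin K → ℝ) (z : ℂ) :
    aeval z (denPoly ζ) = ∏ j, (1 - z / (ζ j : ℂ)) := by
  simp only [denPoly, map_prod, map_sub, map_one, map_mul, aeval_C, aeval_X]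
  refine Finset.prod_congr rfl fun j _ => ?_
  simp [div_eq_mul_inv, mul_comm]

lemma aeval_denPoly_eq_zero {K : ℕ} {ζ : Fin K → ℝ} (hζ : ∀ j, 0 < ζ j) (z : ℂ) :
    aeval z (denPoly ζ) = 0 ↔ ∃ j, z = (ζ j : ℂ) := by
  rw [aeval_denPoly, Finset.prod_eq_zero_iff]
  simp only [Finset.mem_univ, true_and]
  refine exists_congr fun j => ?_
  have : (ζ j : ℂ) ≠ 0 := by exact_mod_cast (hζ j).ne'
  rw [sub_eq_zero, eq_div_iff this, one_mul, eq_comm]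

lemma aeval_numPoly {K : ℕ} {ζ : Fin K → ℝ} (hζ : ∀ j, 0 < ζ j) (b : Fin K → ℝ) (c : ℝ) {z : ℂ}
    (hz : ∀ j, z ≠ ζ j) :
    aeval z (numPoly ζ b c) =
      aeval z (denPoly ζ) * ((c : ℂ) + ∑ j, (b j : ℂ) / ((ζ j : ℂ) - z)) := by
  rw [mul_add, numPoly, map_add, map_mul, aeval_C, map_sum, Finset.mul_sum, mul_comm]
  congr 1
  refine Finset.sum_congr rfl fun j _ => ?_
  rw [denPoly, ← Finset.mul_prod_erase Finset.univ _ (Finset.mem_univ j)]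
  simp only [map_mul, map_sub, map_one, aeval_C, aeval_X]
  have h1 : (ζ j : ℂ) ≠ 0 := by exact_mod_cast (hζ j).ne'
  have h2 : (ζ j : ℂ) - z ≠ 0 := sub_ne_zero.2 (hz j).symm
  simp only [Complex.coe_algebraMap, Complex.ofReal_div, Complex.ofReal_one]
  field_simp

lemma eval_denPoly {K : ℕ} (ζ : Fin K → ℝ) (z : ℝ) :
    (denPoly ζ).eval z = ∏ j, (1 - z / ζ j) := by
  simp only [denPoly, eval_prod, eval_sub, eval_one, eval_mul, eval_C, eval_X]
  exact Finset.prod_congr rfl fun j _ => by ring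

lemma eval_denPoly_pos {K : ℕ} {ζ : Fin K → ℝ} (hζ : ∀ j, 0 < ζ j) {z : ℝ} (hz : z ≤ 0) :
    0 < (denPoly ζ).eval z := by
  rw [eval_denPoly]
  refine Finset.prod_pos fun j _ => ?_
  have := div_nonneg (neg_nonneg.2 hz) (hζ j).le
  rw [neg_div] at this
  linarith

lemma eval_denPoly_zero {K : ℕ} (ζ : Fin K → ℝ) : (denPoly ζ).eval 0 = 1 := by
  simp [eval_denPoly]

lemma eval_denPoly_self {K : ℕ} {ζ : Fin K → ℝ} (hζ : ∀ j, 0 < ζ j) (j : Fin K) :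
    (denPoly ζ).eval (ζ j) = 0 := by
  rw [eval_denPoly]
  exact Finset.prod_eq_zero (Finset.mem_univ j) (by rw [div_self (hζ j).ne', sub_self])

lemma eval_numPoly {K : ℕ} {ζ : Fin K → ℝ} (hζ : ∀ j, 0 < ζ j) (b : Fin K → ℝ) (c : ℝ) {z : ℝ}
    (hz : ∀ j, z ≠ ζ j) :
    (numPoly ζ b c).eval z = (denPoly ζ).eval z * (c + ∑ j, b j / (ζ j - z)) := by
  have := aeval_numPoly hζ b c (z := (z : ℂ)) fun j => by exact_mod_cast hz j
  rw [← Complex.coe_algebraMap, aeval_algebraMap_apply, aeval_algebraMap_apply] at this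
  simp only [Complex.coe_algebraMap, coe_aeval_eq_eval] at this
  exact_mod_cast this

lemma eval_numPoly_self {K : ℕ} {ζ : Fin K → ℝ} (hζ : ∀ j, 0 < ζ j) (b : Fin K → ℝ) (c : ℝ)
    (j : Fin K) : (numPoly ζ b c).eval (ζ j) =
      b j / ζ j * ∏ i ∈ Finset.univ.erase j, (1 - ζ j / ζ i) := by
  rw [numPoly, eval_add, eval_mul, eval_denPoly_self hζ, mul_zero, zero_add, eval_finsetSum,
    Finset.sum_eq_single j]
  · simp only [eval_prod, eval_sub, eval_one, eval_mul, eval_C, eval_X]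
    congr 1
    exact Finset.prod_congr rfl fun j _ => by ring
  · intro i _ hij
    rw [eval_mul, eval_prod, Finset.prod_eq_zero (Finset.mem_erase.2 ⟨hij.symm, Finset.mem_univ j⟩),
      mul_zero]
    have := (hζ j).ne'
    simp [this]
  · simp

/-- A polynomial of degree at most `K` is determined by its values at `0, ζ_1, …, ζ_K`. -/
lemma eq_of_eval_nodes {K : ℕ} {ζ : Fin K → ℝ} (hζ : ∀ j, 0 < ζ j) (hinj : Function.Injective ζ)
    {P Q : ℝ[X]} (hP : P.natDegree ≤ K) (hQ : Q.natDegree ≤ K) (h0 : P.eval 0 = Q.eval 0)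
    (h : ∀ j, P.eval (ζ j) = Q.eval (ζ j)) : P = Q := by
  rw [← sub_eq_zero]
  have hinj' : Function.Injective (Option.elim · (0 : ℝ) ζ) := by
    rintro (_ | i) (_ | j) hij
    · rfl
    · exact absurd hij (hζ j).ne
    · exact absurd hij (hζ i).ne'
    · exact congrArg some (hinj hij)
  refine eq_zero_of_natDegree_lt_card_of_eval_eq_zero _ hinj' ?_ ?_
  · rintro (_ | j)
    · simp [h0]
    · simp [h j]
  · rw [Fintype.card_option, Fintype.card_fin]
    exact Nat.lt_succ_of_le (natDegree_sub_le_of_le hP hQ |>.trans (le_of_eq (max_self _)))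

lemma eq_of_eval_neg {P Q : ℝ[X]} (h : ∀ z < 0, P.eval z = Q.eval z) : P = Q :=
  eq_of_infinite_eval_eq P Q ((Set.Iio_infinite (0 : ℝ)).mono h)

lemma natDegree_spectralPoly {K : ℕ} (m x : Fin (2 * K + 1) → ℝ) :
    (spectralPoly m x).1.natDegree ≤ K ∧ (spectralPoly m x).2.natDegree ≤ K := by
  obtain ⟨h1, h2, -⟩ := natDegree_polyChain (hCoeff m x) (gCoeff m x) (2 * K + 1)
  exact ⟨h1.trans (by omega), h2.trans (by omega)⟩

lemma eval_spectralPoly_zero {n : ℕ} (m x : Fin n → ℝ) :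
    (spectralPoly m x).1.eval 0 = ∑ i ∈ Finset.range n, hCoeff m x i ∧
      (spectralPoly m x).2.eval 0 = 1 := by
  have := eval_polyChain (hCoeff m x) (gCoeff m x) n 0
  rw [chain_zero_param] at this
  exact Prod.mk.inj this

/-- `p_n` has degree at most `K`, value `1` at `0` and the `K` prescribed zeros, which fixes it. The
Weyl formula then fixes `q_n` on the negative axis, where `p_n` has no zero, and thus everywhere. -/
lemma HasSpectralData.spectralPoly_eq {K : ℕ} {m x : Fin (2 * K + 1) → ℝ} {ζ b : Fin K → ℝ}
    {c : ℝ} (hζ : ∀ j, 0 < ζ j) (hinj : Function.Injective ζ) (h : HasSpectralData m x ζ b c) :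
    spectralPoly m x = (numPoly ζ b c, denPoly ζ) := by
  have hp : (spectralPoly m x).2 = denPoly ζ := by
    refine eq_of_eval_nodes hζ hinj (natDegree_spectralPoly m x).2 (natDegree_denPoly ζ)
      (by rw [(eval_spectralPoly_zero m x).2, eval_denPoly_zero]) fun j => ?_
    rw [eval_denPoly_self hζ]
    have := (h.eigenvalue_iff (ζ j)).2 ⟨j, rfl⟩
    rw [pLast_eq, ← Complex.coe_algebraMap, aeval_algebraMap_apply] at this
    simpa using this
  refine Prod.ext (eq_of_eval_neg fun z hz => ?_) hp
  have hne : ∀ j, z ≠ ζ j := fun j => (hz.trans (hζ j)).ne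
  have hne' : ∀ j, (z : ℂ) ≠ ζ j := fun j => by exact_mod_cast hne j
  have hd : aeval (z : ℂ) (denPoly ζ) ≠ 0 := by
    rw [Ne, aeval_denPoly_eq_zero hζ]
    rintro ⟨j, hj⟩
    exact hne' j hj
  have := h.weyl z (by rwa [pLast_eq, hp])
  rw [pLast_eq, qLast_eq, hp, div_eq_iff hd, mul_comm ((c : ℂ) + _), ← aeval_numPoly hζ b c hne',
    ← Complex.coe_algebraMap, aeval_algebraMap_apply, aeval_algebraMap_apply] at this
  simpa using this

lemma HasSpectralData.of_spectralPoly_eq {K : ℕ} {m x : Fin (2 * K + 1) → ℝ} {ζ b : Fin K → ℝ}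
    {c : ℝ} (hζ : ∀ j, 0 < ζ j) (h : spectralPoly m x = (numPoly ζ b c, denPoly ζ)) :
    HasSpectralData m x ζ b c where
  eigenvalue_iff z := by rw [pLast_eq, h, aeval_denPoly_eq_zero hζ]
  weyl z hz := by
    rw [pLast_eq, h] at hz
    rw [pLast_eq, qLast_eq, h, div_eq_iff hz, mul_comm]
    refine aeval_numPoly hζ b c fun j hj => hz ?_
    exact (aeval_denPoly_eq_zero hζ z).2 ⟨j, hj⟩

lemma coeff_pos {n : ℕ} {m : Fin n → ℝ} (hm : ∀ i, 0 < m i) (x : Fin n → ℝ) :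
    (∀ i < n, 0 < hCoeff m x i) ∧ ∀ i < n, 0 < gCoeff m x i := by
  constructor <;> intro i hi
  · simpa [hCoeff, extendZero, hi] using mul_pos (hm ⟨i, hi⟩) (Real.exp_pos _)
  · simpa [gCoeff, extendZero, hi] using mul_pos (hm ⟨i, hi⟩) (Real.exp_pos _)

/-- The positions are determined by the masses and the spectral polynomials. -/
lemma eq_of_spectralPoly_eq {n : ℕ} {m : Fin n → ℝ} (hm : ∀ i, 0 < m i) {x x' : Fin n → ℝ}
    (h : spectralPoly m x = spectralPoly m x') : x = x' := by
  have key := eq_of_polyChain_proportional (coeff_pos hm x).1 (coeff_pos hm x).2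
    (coeff_pos hm x').1 (coeff_pos hm x').2 (fun i hi => ?_)
    (by
      have e1 := congrArg Prod.fst h
      have e2 := congrArg Prod.snd h
      simp only [spectralPoly] at e1 e2
      rw [e1, e2])
  · ext i
    have := key i i.2
    rw [hCoeff, hCoeff, extendZero_val, extendZero_val] at this
    exact Real.exp_injective (mul_left_cancel₀ (hm i).ne' this)
  · simp only [hCoeff, gCoeff, extendZero, hi, dif_pos, Real.exp_neg]
    field_simp

/-! ### Evolution of the spectral data -/

lemma sum_Iio_eq_range {n : ℕ} (f : Fin n → ℝ) (j : Fin n) :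
    ∑ i ∈ Finset.Iio j, f i = ∑ i ∈ Finset.range j, extendZero f i := by
  refine Finset.sum_bij' (fun i _ => (i : ℕ)) (fun i hi => ⟨i, by
    have := Finset.mem_range.1 hi; omega⟩) ?_ ?_ ?_ ?_ ?_
  · intro i hi; simpa using hi
  · intro i hi; simpa [Fin.lt_def] using hi
  · intro i hi; rfl
  · intro i hi; rfl
  · intro i hi; rw [extendZero_val]

lemma sum_Ioi_eq_Ico {n : ℕ} (f : Fin n → ℝ) (j : Fin n) :
    ∑ i ∈ Finset.Ioi j, f i = ∑ i ∈ Finset.Ico (j + 1 : ℕ) n, extendZero f i := by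
  refine Finset.sum_bij' (fun i _ => (i : ℕ)) (fun i hi => ⟨i, (Finset.mem_Ico.1 hi).2⟩)
    ?_ ?_ ?_ ?_ ?_
  · intro i hi
    have := Finset.mem_Ioi.1 hi
    rw [Fin.lt_def] at this
    exact Finset.mem_Ico.2 ⟨this, i.2⟩
  · intro i hi
    rw [Finset.mem_Ioi, Fin.lt_def]
    exact (Finset.mem_Ico.1 hi).1
  · intro i hi; rfl
  · intro i hi; rfl
  · intro i hi; rw [extendZero_val]

/-- In a gap between peakons `u² - u_x²` is the constant `4 A_k B_k`; the velocity is the mean of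
the values in the two adjacent gaps. The ordering is needed to open the absolute values. -/
lemma velocity_eq {n : ℕ} (m : Fin n → ℝ) {x : Fin n → ℝ} (hx : StrictMono x) (j : Fin n) :
    velocity m x j =
      2 * (∑ i ∈ Finset.range (j + 1), hCoeff m x i) *
          (∑ i ∈ Finset.Ico (j + 1 : ℕ) n, gCoeff m x i) +
        2 * (∑ i ∈ Finset.range j, hCoeff m x i) * ∑ i ∈ Finset.Ico (j : ℕ) n, gCoeff m x i := by
  rw [Finset.sum_range_succ, Finset.sum_eq_sum_Ico_succ_bot j.2]
  rw [hCoeff, gCoeff, extendZero_val, extendZero_val, ← sum_Iio_eq_range, ← sum_Ioi_eq_Ico, velocity]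
  have hsplit : Finset.univ.erase j = Finset.Iio j ∪ Finset.Ioi j := by
    ext i; simp
  have hdisj : Disjoint (Finset.Iio j) (Finset.Ioi j) :=
    Finset.disjoint_left.2 fun i h1 h2 =>
      lt_asymm (Finset.mem_Iio.1 h1) (Finset.mem_Ioi.1 h2)
  have e1 : ∑ k ∈ Finset.Iio j, m j * m k * Real.exp (-|x j - x k|) =
      m j * Real.exp (-x j) * ∑ k ∈ Finset.Iio j, m k * Real.exp (x k) := by
    rw [Finset.mul_sum]
    refine Finset.sum_congr rfl fun k hk => ?_
    rw [abs_of_pos (sub_pos.2 (hx (Finset.mem_Iio.1 hk))), neg_sub, sub_eq_add_neg, Real.exp_add]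
    ring
  have e2 : ∑ k ∈ Finset.Ioi j, m j * m k * Real.exp (-|x j - x k|) =
      m j * Real.exp (x j) * ∑ k ∈ Finset.Ioi j, m k * Real.exp (-x k) := by
    rw [Finset.mul_sum]
    refine Finset.sum_congr rfl fun k hk => ?_
    rw [abs_of_neg (sub_neg.2 (hx (Finset.mem_Ioi.1 hk))), neg_neg, sub_eq_add_neg, Real.exp_add]
    ring
  have e3 : ∑ i ∈ Finset.Iio j, ∑ k ∈ Finset.Ioi j, m i * m k * Real.exp (-|x i - x k|) =
      (∑ i ∈ Finset.Iio j, m i * Real.exp (x i)) * ∑ k ∈ Finset.Ioi j, m k * Real.exp (-x k) := by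
    rw [Finset.sum_mul_sum]
    refine Finset.sum_congr rfl fun i hi => Finset.sum_congr rfl fun k hk => ?_
    rw [abs_of_neg (sub_neg.2 (hx ((Finset.mem_Iio.1 hi).trans (Finset.mem_Ioi.1 hk)))), neg_neg,
      sub_eq_add_neg, Real.exp_add]
    ring
  rw [hsplit, Finset.sum_union hdisj, e1, e2, e3]
  ring

/-- At `k = n` the sum over the `g_i` with `i ≥ k` is empty, and `∑ h_i` is `q_n(0)`. -/
lemma hasDerivAt_spectralPoly {n : ℕ} {m : Fin n → ℝ} {x : ℝ → Fin n → ℝ} {t : ℝ}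
    (hx : StrictMono (x t)) (hd : ∀ j, HasDerivAt (fun s => x s j) (velocity m (x t) j) t)
    {z : ℝ} (hz : z ≠ 0) :
    HasDerivAt (fun s => (spectralPoly m (x s)).1.eval z)
      (2 / z * ((spectralPoly m (x t)).1.eval z -
        (spectralPoly m (x t)).1.eval 0 * (spectralPoly m (x t)).2.eval z)) t ∧
    HasDerivAt (fun s => (spectralPoly m (x s)).2.eval z) 0 t := by
  have key := hasDerivAt_chain (h := fun s => hCoeff m (x s)) (g := fun s => gCoeff m (x s))
    (v := extendZero (velocity m (x t))) hz (n := n) (t := t)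
    (fun k hk => ?_) (fun k hk => ?_) (fun k hk => ?_) n le_rfl
  · rw [(eval_spectralPoly_zero m (x t)).1]
    simp only [spectralPoly, eval_polyChain_fst, eval_polyChain_snd]
    simp only [Finset.Ico_self, Finset.sum_empty, mul_zero, zero_mul, add_zero, sub_zero] at key
    exact ⟨key.1.congr_deriv (by ring), key.2⟩
  · simp only [hCoeff, extendZero, hk, dif_pos]
    exact ((hd ⟨k, hk⟩).exp.const_mul _).congr_deriv (by ring)
  · simp only [gCoeff, extendZero, hk, dif_pos]
    exact ((hd ⟨k, hk⟩).neg.exp.const_mul _).congr_deriv (by simp only [Pi.neg_apply]; ring)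
  · have := velocity_eq m hx ⟨k, hk⟩
    simpa only [extendZero, hk, dif_pos] using this

lemma eqOn_of_hasDerivAt_zero {J : Set ℝ} (hJ : IsOpen J) (hJc : IsPreconnected J) {f : ℝ → ℝ}
    (hf : ∀ t ∈ J, HasDerivAt f 0 t) {s t : ℝ} (hs : s ∈ J) (ht : t ∈ J) : f t = f s :=
  hJ.is_const_of_deriv_eq_zero hJc (fun u hu => (hf u hu).differentiableAt.differentiableWithinAt)
    (fun u hu => (hf u hu).deriv) ht hs

/-- Along the peakon flow the eigenvalues and `c` are constant and `b_j` grows like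
`e^{2t/ζ_j}`. -/
lemma spectralPoly_evolution {K : ℕ} {m : Fin (2 * K + 1) → ℝ} {ζ b : Fin K → ℝ} {c : ℝ}
    (hζ : ∀ j, 0 < ζ j) (hinj : Function.Injective ζ) {J : Set ℝ} (hJ : IsOpen J)
    (hJc : IsPreconnected J) {x : ℝ → Fin (2 * K + 1) → ℝ} (hx : ∀ t ∈ J, StrictMono (x t))
    (hd : ∀ t ∈ J, ∀ j, HasDerivAt (fun s => x s j) (velocity m (x t) j) t) {t₀ : ℝ}
    (ht₀ : t₀ ∈ J) (h0 : spectralPoly m (x t₀) = (numPoly ζ b c, denPoly ζ)) {t : ℝ}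
    (ht : t ∈ J) : spectralPoly m (x t) =
      (numPoly ζ (fun j => b j * Real.exp (2 * (t - t₀) / ζ j)) c, denPoly ζ) := by
  have hp : ∀ t ∈ J, (spectralPoly m (x t)).2 = denPoly ζ := by
    intro t ht
    refine eq_of_eval_neg fun z hz => ?_
    rw [← show (spectralPoly m (x t₀)).2 = denPoly ζ by rw [h0]]
    exact eqOn_of_hasDerivAt_zero hJ hJc
      (fun u hu => (hasDerivAt_spectralPoly (hx u hu) (hd u hu) hz.ne).2) ht₀ ht
  have hq : ∀ t ∈ J, ∀ z ≠ 0, HasDerivAt (fun s => (spectralPoly m (x s)).1.eval z)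
      (2 / z * ((spectralPoly m (x t)).1.eval z -
        (spectralPoly m (x t)).1.eval 0 * (denPoly ζ).eval z)) t := by
    intro t ht z hz
    rw [← hp t ht]
    exact (hasDerivAt_spectralPoly (hx t ht) (hd t ht) hz).1
  have hnode : ∀ t ∈ J, ∀ j, (spectralPoly m (x t)).1.eval (ζ j) =
      (numPoly ζ (fun j => b j * Real.exp (2 * (t - t₀) / ζ j)) c).eval (ζ j) := by
    intro t ht j
    -- At an eigenvalue `p_n = 0`, so the evolution of `q_n` is the pure growth law `q' = (2/ζ_j)
    -- q`.
    have hc := eqOn_of_hasDerivAt_zero hJ hJc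
      (f := fun s => (spectralPoly m (x s)).1.eval (ζ j) * Real.exp (-(2 * (s - t₀) / ζ j)))
      (fun u hu => by
        have h1 := hq u hu (ζ j) (hζ j).ne'
        rw [eval_denPoly_self hζ, mul_zero, sub_zero] at h1
        have h2 : HasDerivAt (fun s : ℝ => -(2 * (s - t₀) / ζ j)) (-(2 * 1 / ζ j)) u :=
          (((hasDerivAt_id u).sub_const t₀).const_mul 2 |>.div_const (ζ j)).neg
        exact (h1.mul h2.exp).congr_deriv (by ring)) ht₀ ht
    simp only [sub_self, mul_zero, zero_div, neg_zero, Real.exp_zero, mul_one] at hc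
    rw [h0] at hc
    simp only at hc
    rw [eval_numPoly_self hζ, Real.exp_neg, ← div_eq_mul_inv, div_eq_iff (Real.exp_ne_zero _)] at hc
    rw [hc, eval_numPoly_self hζ]
    ring
  -- `q_n` and the expected numerator agree at the `K` eigenvalues and have degree at most `K`, so
  -- they differ by a multiple of `denPoly ζ`, with a factor that may still depend on `t`.
  have hdiff : ∀ t ∈ J, (spectralPoly m (x t)).1 -
      numPoly ζ (fun j => b j * Real.exp (2 * (t - t₀) / ζ j)) c =
      C ((spectralPoly m (x t)).1.eval 0 -
        (numPoly ζ (fun j => b j * Real.exp (2 * (t - t₀) / ζ j)) c).eval 0) * denPoly ζ := by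
    intro t ht
    refine eq_of_eval_nodes hζ hinj
      (natDegree_sub_le_of_le (natDegree_spectralPoly m (x t)).1 (natDegree_numPoly _ _ _) |>.trans
        (le_of_eq (max_self _)))
      ((natDegree_C_mul_le _ _).trans (natDegree_denPoly ζ)) ?_ fun j => ?_
    · simp [eval_denPoly_zero]
    · rw [eval_sub, hnode t ht, sub_self, eval_mul, eval_denPoly_self hζ, mul_zero]
  have hneg : ∀ j, (-1 : ℝ) ≠ ζ j := fun j => by have := hζ j; linarith
  -- Both polynomials obey the same evolution equation, whose right side vanishes on multiples of
  -- `denPoly ζ`, since that polynomial is `1` at `0`. Hence the factor is constant, and it is zero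
  -- at `t₀`. Any negative point would do in place of `-1`.
  have hconst := eqOn_of_hasDerivAt_zero hJ hJc
    (f := fun s => (spectralPoly m (x s)).1.eval (-1) -
      (numPoly ζ (fun j => b j * Real.exp (2 * (s - t₀) / ζ j)) c).eval (-1))
    (fun u hu => by
      have h1 := hq u hu (-1) (by norm_num)
      have h2 : HasDerivAt (fun s =>
          (numPoly ζ (fun j => b j * Real.exp (2 * (s - t₀) / ζ j)) c).eval (-1))
          (-2 * ((numPoly ζ (fun j => b j * Real.exp (2 * (u - t₀) / ζ j)) c).eval (-1) -
            (numPoly ζ (fun j => b j * Real.exp (2 * (u - t₀) / ζ j)) c).eval 0 *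
              (denPoly ζ).eval (-1))) u := by
        simp only [eval_numPoly hζ _ c hneg, eval_numPoly hζ _ c fun j => (hζ j).ne,
          eval_denPoly_zero]
        have h3 : ∀ j ∈ Finset.univ, HasDerivAt
            (fun s => b j * Real.exp (2 * (s - t₀) / ζ j) / (ζ j - -1))
            (b j * (Real.exp (2 * (u - t₀) / ζ j) * (2 * 1 / ζ j)) / (ζ j - -1)) u := fun j _ =>
          ((((hasDerivAt_id u).sub_const t₀).const_mul 2 |>.div_const (ζ j)).exp.const_mul
            (b j)).div_const _
        refine (((HasDerivAt.fun_sum h3).const_add c).const_mul _).congr_deriv ?_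
        rw [one_mul, mul_comm (c + _) (eval (-1) (denPoly ζ)), ← mul_sub, add_sub_add_left_eq_sub,
          ← Finset.sum_sub_distrib, mul_left_comm, Finset.mul_sum (a := (-2 : ℝ))]
        congr 1
        refine Finset.sum_congr rfl fun j _ => ?_
        have h4 := (hζ j).ne'
        have h5 : ζ j - -1 ≠ 0 := by have := hζ j; linarith
        field_simp
        ring
      refine (h1.sub h2).congr_deriv ?_
      have := congrArg (eval (-1)) (hdiff u hu)
      rw [eval_sub, eval_mul, eval_C] at this
      linear_combination (-2) * this) ht₀ ht
  refine Prod.ext ?_ (hp t ht)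
  have h1 := congrArg (eval (-1)) (hdiff t ht)
  rw [eval_sub, hconst, eval_mul, eval_C, h0] at h1
  simp only [sub_self, mul_zero, zero_div, Real.exp_zero, mul_one] at h1
  have h2 := (mul_eq_zero.1 h1.symm).resolve_right (eval_denPoly_pos hζ (by norm_num)).ne'
  have h3 := hdiff t ht
  rw [h2, C_0, zero_mul, sub_eq_zero] at h3
  exact h3

end SpectralData

/-! ### Explicit solution of the inverse problem -/

section InverseProblem

/-- The first homogeneous coordinates of the nodes `ζ_1, …, ζ_K, ∞`. -/
def nodeZ {K : ℕ} (ζ : Fin K → ℝ) : Fin (K + 1) → ℝ := Fin.snoc ζ 1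

/-- The second homogeneous coordinates of the nodes `ζ_1, …, ζ_K, ∞`. -/
def nodeE (K : ℕ) : Fin (K + 1) → ℝ := Fin.snoc (fun _ : Fin K => (1 : ℝ)) 0

/-- The weights of the nodes `ζ_1, …, ζ_K, ∞`. -/
def nodeB {K : ℕ} (b : Fin K → ℝ) (c : ℝ) : Fin (K + 1) → ℝ := Fin.snoc b c

variable {K : ℕ}

@[simp] lemma nodeZ_castSucc (ζ : Fin K → ℝ) (j : Fin K) : nodeZ ζ j.castSucc = ζ j := by
  simp [nodeZ]

@[simp] lemma nodeZ_last (ζ : Fin K → ℝ) : nodeZ ζ (Fin.last K) = 1 := by simp [nodeZ]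

@[simp] lemma nodeE_castSucc (j : Fin K) : nodeE K j.castSucc = 1 := by simp [nodeE]

@[simp] lemma nodeE_last : nodeE K (Fin.last K) = 0 := by simp [nodeE]

@[simp] lemma nodeB_castSucc (b : Fin K → ℝ) (c : ℝ) (j : Fin K) :
    nodeB b c j.castSucc = b j := by simp [nodeB]

@[simp] lemma nodeB_last (b : Fin K → ℝ) (c : ℝ) : nodeB b c (Fin.last K) = c := by simp [nodeB]

lemma nodeZ_pos {ζ : Fin K → ℝ} (hζ : ∀ j, 0 < ζ j) (i : Fin (K + 1)) : 0 < nodeZ ζ i := by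
  induction i using Fin.lastCases with
  | last => simp
  | cast j => simpa using hζ j

lemma nodeE_nonneg (i : Fin (K + 1)) : 0 ≤ nodeE K i := by
  induction i using Fin.lastCases with
  | last => simp
  | cast j => simp

lemma nodeB_pos {b : Fin K → ℝ} {c : ℝ} (hb : ∀ j, 0 < b j) (hc : 0 < c) (i : Fin (K + 1)) :
    0 < nodeB b c i := by
  induction i using Fin.lastCases with
  | last => simpa using hc
  | cast j => simpa using hb j

lemma node_bracket_ne_zero {ζ : Fin K → ℝ} (hinj : Function.Injective ζ) (i j : Fin (K + 1))
    (hij : i ≠ j) : bracket (nodeZ ζ) (nodeE K) i j ≠ 0 := by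
  induction i using Fin.lastCases with
  | last =>
    induction j using Fin.lastCases with
    | last => exact absurd rfl hij
    | cast j => simp [bracket]
  | cast i =>
    induction j using Fin.lastCases with
    | last => simp [bracket]
    | cast j =>
      have : i ≠ j := fun h => hij (by rw [h])
      simpa [bracket, sub_eq_zero] using hinj.ne this

lemma node_add_pos {ζ : Fin K → ℝ} (hζ : ∀ j, 0 < ζ j) {x : ℝ} (hx : 0 ≤ x) (i : Fin (K + 1)) :
    0 < nodeZ ζ i + x * nodeE K i :=
  add_pos_of_pos_of_nonneg (nodeZ_pos hζ i) (mul_nonneg hx (nodeE_nonneg i))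

/-- The weights `b_i / ∏_{a < k} (ζ_i + e_a η_i)`. -/
def tauWeight (ζ b : Fin K → ℝ) (c : ℝ) (e : ℕ → ℝ) (k : ℕ) (i : Fin (K + 1)) : ℝ :=
  nodeB b c i / ∏ a ∈ Finset.range k, (nodeZ ζ i + e a * nodeE K i)

/-- The sums entering the numerators of the explicit solution. -/
def numTau (ζ b : Fin K → ℝ) (c : ℝ) (e : ℕ → ℝ) (k : ℕ) : ℝ :=
  numSum (nodeZ ζ) (nodeE K) Finset.univ k (tauWeight ζ b c e k)

/-- The sums entering the denominators of the explicit solution. -/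
def denTau (ζ b : Fin K → ℝ) (c : ℝ) (e : ℕ → ℝ) (k : ℕ) : ℝ :=
  denSum (nodeZ ζ) (nodeE K) Finset.univ k (tauWeight ζ b c e k)

/-- The explicit solution of the inverse problem for `m_{k'} e^{x_{k'}}`, `k = a + 1`. -/
def height (ζ b : Fin K → ℝ) (c : ℝ) (e : ℕ → ℝ) (a : ℕ) : ℝ :=
  (∏ i ∈ Finset.range a, e i) * (numTau ζ b c e (a + 1) * numTau ζ b c e a) /
    (denTau ζ b c e (a + 1) * denTau ζ b c e a)

lemma tauWeight_pos {ζ b : Fin K → ℝ} {c : ℝ} {e : ℕ → ℝ} (hζ : ∀ j, 0 < ζ j) (hb : ∀ j, 0 < b j)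
    (hc : 0 < c) (he : ∀ a, 0 < e a) (k : ℕ) (i : Fin (K + 1)) : 0 < tauWeight ζ b c e k i :=
  div_pos (nodeB_pos hb hc i) (Finset.prod_pos fun a _ => node_add_pos hζ (he a).le i)

lemma tauWeight_succ {ζ : Fin K → ℝ} (hζ : ∀ j, 0 < ζ j) (b : Fin K → ℝ) (c : ℝ) {e : ℕ → ℝ}
    (he : ∀ a, 0 < e a) (k : ℕ) (i : Fin (K + 1)) :
    tauWeight ζ b c e (k + 1) i * (nodeZ ζ i + e k * nodeE K i) = tauWeight ζ b c e k i := by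
  rw [tauWeight, tauWeight, Finset.prod_range_succ, ← div_div,
    div_mul_cancel₀ _ (node_add_pos hζ (he k).le i).ne']

/-- For even `k` the factor `η` removes the node at infinity, so `k / 2` elements must come from the
`K` finite nodes; for odd `k` all `K + 1` nodes are available. In `denTau_pos` the parities are
interchanged. -/
lemma numTau_pos {ζ b : Fin K → ℝ} {c : ℝ} {e : ℕ → ℝ} (hζ : ∀ j, 0 < ζ j)
    (hinj : Function.Injective ζ) (hb : ∀ j, 0 < b j) (hc : 0 < c) (he : ∀ a, 0 < e a) {k : ℕ}
    (hk : k ≤ 2 * K + 1) : 0 < numTau ζ b c e k := by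
  rcases Nat.even_or_odd' k with ⟨j, rfl | rfl⟩
  · rw [numTau, numSum_even]
    refine hsum_pos (node_bracket_ne_zero hinj)
      (S' := Finset.univ.map Fin.castSuccEmb) (fun i _ => mul_nonneg
        (tauWeight_pos hζ hb hc he _ i).le (nodeE_nonneg i)) (Finset.subset_univ _) ?_ ?_
    · intro i hi
      obtain ⟨j, -, rfl⟩ := Finset.mem_map.1 hi
      simpa using tauWeight_pos hζ hb hc he _ j.castSucc
    · rw [Finset.card_map, Finset.card_univ, Fintype.card_fin]; omega
  · rw [numTau, numSum_odd]
    refine hsum_pos (node_bracket_ne_zero hinj) (S' := Finset.univ) (fun i _ =>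
      (tauWeight_pos hζ hb hc he _ i).le) (Finset.subset_univ _)
      (fun i _ => tauWeight_pos hζ hb hc he _ i) ?_
    rw [Finset.card_univ, Fintype.card_fin]; omega

lemma denTau_pos {ζ b : Fin K → ℝ} {c : ℝ} {e : ℕ → ℝ} (hζ : ∀ j, 0 < ζ j)
    (hinj : Function.Injective ζ) (hb : ∀ j, 0 < b j) (hc : 0 < c) (he : ∀ a, 0 < e a) {k : ℕ}
    (hk : k ≤ 2 * K + 1) : 0 < denTau ζ b c e k := by
  rcases Nat.even_or_odd' k with ⟨j, rfl | rfl⟩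
  · rw [denTau, denSum_even]
    refine hsum_pos (node_bracket_ne_zero hinj) (S' := Finset.univ) (fun i _ =>
      (mul_pos (tauWeight_pos hζ hb hc he _ i) (nodeZ_pos hζ i)).le) (Finset.subset_univ _)
      (fun i _ => mul_pos (tauWeight_pos hζ hb hc he _ i) (nodeZ_pos hζ i)) ?_
    rw [Finset.card_univ, Fintype.card_fin]; omega
  · rw [denTau, denSum_odd]
    refine hsum_pos (node_bracket_ne_zero hinj)
      (S' := Finset.univ.map Fin.castSuccEmb) (fun i _ => mul_nonneg
        (tauWeight_pos hζ hb hc he _ i).le (mul_nonneg (nodeZ_pos hζ i).le (nodeE_nonneg i)))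
        (Finset.subset_univ _) ?_ ?_
    · intro i hi
      obtain ⟨j, -, rfl⟩ := Finset.mem_map.1 hi
      simpa using mul_pos (tauWeight_pos hζ hb hc he _ j.castSucc) (hζ j)
    · rw [Finset.card_map, Finset.card_univ, Fintype.card_fin]; omega

lemma height_pos {ζ b : Fin K → ℝ} {c : ℝ} {e : ℕ → ℝ} (hζ : ∀ j, 0 < ζ j)
    (hinj : Function.Injective ζ) (hb : ∀ j, 0 < b j) (hc : 0 < c) (he : ∀ a, 0 < e a) {a : ℕ}
    (ha : a < 2 * K + 1) : 0 < height ζ b c e a :=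
  div_pos (mul_pos (Finset.prod_pos fun i _ => he i)
    (mul_pos (numTau_pos hζ hinj hb hc he ha) (numTau_pos hζ hinj hb hc he ha.le)))
    (mul_pos (denTau_pos hζ hinj hb hc he ha) (denTau_pos hζ hinj hb hc he ha.le))

/-- The numerator and denominator at a partially peeled stage, as functions of `y = -z`. -/
def numStage (ζ b : Fin K → ℝ) (c : ℝ) (e : ℕ → ℝ) (y : ℝ) (r : ℕ) : ℝ :=
  numSum (nodeZ ζ) (nodeE K) Finset.univ (r + 1)
    fun i => tauWeight ζ b c e r i / (nodeZ ζ i + y * nodeE K i)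

/-- See `numStage`. -/
def denStage (ζ b : Fin K → ℝ) (c : ℝ) (e : ℕ → ℝ) (y : ℝ) (r : ℕ) : ℝ :=
  denSum (nodeZ ζ) (nodeE K) Finset.univ (r + 1)
    fun i => tauWeight ζ b c e r i / (nodeZ ζ i + y * nodeE K i)

/-- With `ν` the stage weights at `r + 1`, multiplying by `ζ + e_r η`, by `ζ + y η`, or by both
gives the weights of stage `r`, of `tau` at `r + 1`, and of `tau` at `r`. The two relations are the
bilinear identity for `(e_r, y)` and for `(y, e_r)`. -/
lemma numStage_mul_denTau {ζ : Fin K → ℝ} (hζ : ∀ j, 0 < ζ j) (hinj : Function.Injective ζ)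
    (b : Fin K → ℝ) (c : ℝ) {e : ℕ → ℝ} (he : ∀ a, 0 < e a) {y : ℝ} (hy : 0 < y) (r : ℕ) :
    numStage ζ b c e y r * denTau ζ b c e (r + 1) =
      e r * (numStage ζ b c e y (r + 1) * denTau ζ b c e r) +
        denStage ζ b c e y (r + 1) * numTau ζ b c e r ∧
    numTau ζ b c e (r + 1) * denStage ζ b c e y r =
      y * (numStage ζ b c e y (r + 1) * denTau ζ b c e r) +
        denStage ζ b c e y (r + 1) * numTau ζ b c e r := by
  have hY := fun i => (node_add_pos hζ hy.le i).ne'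
  set ν : Fin (K + 1) → ℝ :=
    fun i => tauWeight ζ b c e (r + 1) i / (nodeZ ζ i + y * nodeE K i) with hν
  have e1 : ∀ i, ν i * (nodeZ ζ i + e r * nodeE K i) =
      tauWeight ζ b c e r i / (nodeZ ζ i + y * nodeE K i) := fun i => by
    rw [← tauWeight_succ hζ b c he r i]; ring
  have e2 : ∀ i, ν i * (nodeZ ζ i + y * nodeE K i) = tauWeight ζ b c e (r + 1) i := fun i =>
    div_mul_cancel₀ _ (hY i)
  have e3 : ∀ i, ν i * ((nodeZ ζ i + e r * nodeE K i) * (nodeZ ζ i + y * nodeE K i)) =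
      tauWeight ζ b c e r i := fun i => by
    rw [← mul_assoc, e1, div_mul_cancel₀ _ (hY i)]
  have e4 : ∀ i, ν i * ((nodeZ ζ i + y * nodeE K i) * (nodeZ ζ i + e r * nodeE K i)) =
      tauWeight ζ b c e r i := fun i => by rw [mul_comm (_ + _) (_ + _), e3]
  have k1 := numSum_mul_denSum (node_bracket_ne_zero hinj) Finset.univ r ν (e r) y
  have k2 := numSum_mul_denSum (node_bracket_ne_zero hinj) Finset.univ r ν y (e r)
  simp only [e1, e2, e3, e4] at k1 k2
  exact ⟨k1, k2⟩

lemma powersetCard_univ_self (n : ℕ) :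
    (Finset.univ : Finset (Fin n)).powersetCard n = {Finset.univ} := by
  ext I
  rw [Finset.mem_powersetCard, Finset.mem_singleton, ← Finset.card_eq_iff_eq_univ, Fintype.card_fin]
  simp

/-- The only subset of size `K + 1` contains infinity, where `η = 0`; this reproduces `q_0 = 0`. -/
lemma numStage_top (ζ b : Fin K → ℝ) (c : ℝ) (e : ℕ → ℝ) (y : ℝ) :
    numStage ζ b c e y (2 * K + 1) = 0 := by
  rw [numStage, show 2 * K + 1 + 1 = 2 * (K + 1) by ring, numSum_even, hsum,
    powersetCard_univ_self, Finset.sum_singleton,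
    Finset.prod_eq_zero (Finset.mem_univ (Fin.last K)) (by simp), zero_mul]

/-- Again only the full set contributes, so the determinants cancel; the leftover factor `∏ ζ_i /
(ζ_i + y η_i)` is the inverse of `denPoly ζ` at `-y`. This reproduces `p_0 = 1`. -/
lemma denStage_top {ζ : Fin K → ℝ} (hζ : ∀ j, 0 < ζ j) (b : Fin K → ℝ) (c : ℝ) (e : ℕ → ℝ)
    {y : ℝ} (hy : 0 < y) :
    (denPoly ζ).eval (-y) * denStage ζ b c e y (2 * K + 1) = numTau ζ b c e (2 * K + 1) := by
  rw [denStage, numTau, show 2 * K + 1 + 1 = 2 * (K + 1) by ring, denSum_even, numSum_odd, hsum,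
    hsum, powersetCard_univ_self, Finset.sum_singleton, Finset.sum_singleton, ← mul_assoc]
  congr 1
  rw [eval_denPoly]
  have : ∏ j, (1 - -y / ζ j) = ∏ i, (nodeZ ζ i + y * nodeE K i) / nodeZ ζ i := by
    rw [Fin.prod_univ_castSucc]
    simp only [nodeZ_castSucc, nodeE_castSucc, nodeZ_last, nodeE_last]
    rw [mul_zero, add_zero, div_one, mul_one]
    refine Finset.prod_congr rfl fun j _ => ?_
    have := (hζ j).ne'
    field_simp
    ring
  rw [this, ← Finset.prod_mul_distrib]
  refine Finset.prod_congr rfl fun i _ => ?_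
  have h1 := (node_add_pos hζ hy.le i).ne'
  have h2 := (nodeZ_pos hζ i).ne'
  field_simp

/-- The string is built from the left while the formulas count from the right, so the stage index
`r` decreases as `s` grows: `r = 2K + 1` is the initial value `(0, 1)`, and `r = 0` is the full
string. -/
lemma chain_height {ζ b : Fin K → ℝ} {c : ℝ} {e : ℕ → ℝ} (hζ : ∀ j, 0 < ζ j)
    (hinj : Function.Injective ζ) (hb : ∀ j, 0 < b j) (hc : 0 < c) (he : ∀ a, 0 < e a)
    {h g : ℕ → ℝ} (hh : ∀ a < 2 * K + 1, h (2 * K - a) = height ζ b c e a)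
    (hg : ∀ a < 2 * K + 1, g (2 * K - a) = 1 / (e a * height ζ b c e a)) {y : ℝ} (hy : 0 < y)
    (s : ℕ) : ∀ r, s + r = 2 * K + 1 →
    chain h g (-y) s =
      ((denPoly ζ).eval (-y) * ((∏ i ∈ Finset.range r, e i) * numStage ζ b c e y r /
        denTau ζ b c e r),
      (denPoly ζ).eval (-y) * (denStage ζ b c e y r / numTau ζ b c e r)) := by
  induction s with
  | zero =>
    intro r hr
    obtain rfl : r = 2 * K + 1 := by omega
    have := (numTau_pos hζ hinj hb hc he le_rfl).ne'
    rw [numStage_top, ← mul_div_assoc _ (denStage ζ b c e y _), denStage_top hζ b c e hy,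
      div_self this]
    simp [chain]
  | succ s ih =>
    intro r hr
    have hs := ih (r + 1) (by omega)
    have hsr : s = 2 * K - r := by omega
    have h1 := hh r (by omega)
    have h2 := hg r (by omega)
    rw [← hsr] at h1 h2
    obtain ⟨k1, k2⟩ := numStage_mul_denTau hζ hinj b c he hy r
    have u0 := (numTau_pos hζ hinj hb hc he (show r ≤ 2 * K + 1 by omega)).ne'
    have u1 := (numTau_pos hζ hinj hb hc he (show r + 1 ≤ 2 * K + 1 by omega)).ne'
    have v0 := (denTau_pos hζ hinj hb hc he (show r ≤ 2 * K + 1 by omega)).ne'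
    have v1 := (denTau_pos hζ hinj hb hc he (show r + 1 ≤ 2 * K + 1 by omega)).ne'
    have hE : ∏ i ∈ Finset.range r, e i ≠ 0 := (Finset.prod_pos fun i _ => he i).ne'
    have her := (he r).ne'
    simp only [chain]
    rw [hs, h1, h2, height, Finset.prod_range_succ]
    -- The bilinear relations express stage `r` through stage `r + 1`; after substitution the
    -- recursion is an identity of rational expressions.
    have q : numStage ζ b c e y r = (e r * (numStage ζ b c e y (r + 1) * denTau ζ b c e r) +
        denStage ζ b c e y (r + 1) * numTau ζ b c e r) / denTau ζ b c e (r + 1) := by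
      rw [← k1]; field_simp
    have p : denStage ζ b c e y r = (y * (numStage ζ b c e y (r + 1) * denTau ζ b c e r) +
        denStage ζ b c e y (r + 1) * numTau ζ b c e r) / numTau ζ b c e (r + 1) := by
      rw [← k2]; field_simp
    rw [q, p]
    refine Prod.ext ?_ ?_
    · simp only
      field_simp
    · simp only
      field_simp
      ring

/-- The numbers `e_k = 1 / m_{k'}²`, continued by `1`. -/
def eSeq {n : ℕ} (m : Fin n → ℝ) (a : ℕ) : ℝ := if h : a < n then eVec m ⟨a, h⟩ else 1

lemma eSeq_pos {n : ℕ} {m : Fin n → ℝ} (hm : ∀ i, 0 < m i) (a : ℕ) : 0 < eSeq m a := by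
  unfold eSeq
  split
  · exact one_div_pos.2 (pow_pos (hm _) 2)
  · exact one_pos

/-- The positions with given masses and spectral data. -/
def position (m : Fin (2 * K + 1) → ℝ) (ζ b : Fin K → ℝ) (c : ℝ) (k : Fin (2 * K + 1)) : ℝ :=
  Real.log (height ζ b c (eSeq m) k.rev / m k)

/-- At stage `0` the numerator is a sum over single nodes, `∑ b_j / (ζ_j - z)` plus the term `c`
from infinity, which is the Weyl function; the other three sums are `1`. Agreement for all `z < 0`
is enough for polynomials. -/
lemma spectralPoly_position {m : Fin (2 * K + 1) → ℝ} {ζ b : Fin K → ℝ} {c : ℝ}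
    (hm : ∀ i, 0 < m i) (hζ : ∀ j, 0 < ζ j) (hinj : Function.Injective ζ) (hb : ∀ j, 0 < b j)
    (hc : 0 < c) : spectralPoly m (position m ζ b c) = (numPoly ζ b c, denPoly ζ) := by
  have hexp : ∀ k, Real.exp (position m ζ b c k) = height ζ b c (eSeq m) k.rev / m k := fun k =>
    Real.exp_log (div_pos (height_pos hζ hinj hb hc (eSeq_pos hm) k.rev.2) (hm k))
  have key : ∀ z < 0, chain (hCoeff m (position m ζ b c)) (gCoeff m (position m ζ b c)) z
      (2 * K + 1) = ((numPoly ζ b c).eval z, (denPoly ζ).eval z) := by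
    intro z hz
    have hrev : ∀ a (ha : a < 2 * K + 1) (ha' : 2 * K - a < 2 * K + 1),
        (Fin.rev ⟨2 * K - a, ha'⟩ : Fin (2 * K + 1)) = ⟨a, ha⟩ := fun a ha ha' => by
      ext; simp [Fin.val_rev]; omega
    have := chain_height hζ hinj hb hc (eSeq_pos hm) (h := hCoeff m (position m ζ b c))
      (g := gCoeff m (position m ζ b c)) (fun a ha => ?_) (fun a ha => ?_) (neg_pos.2 hz)
      (2 * K + 1) 0 (by ring)
    · rw [neg_neg] at this
      rw [this, eval_numPoly hζ b c fun j => (hz.trans (hζ j)).ne]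
      have e1 : numStage ζ b c (eSeq m) (-z) 0 = c + ∑ j, b j / (ζ j - z) := by
        rw [numStage, show 0 + 1 = 2 * 0 + 1 by rfl, numSum_odd, zero_add, hsum_one,
          Fin.sum_univ_castSucc, add_comm]
        simp [tauWeight, sub_eq_add_neg]
      have e2 : denStage ζ b c (eSeq m) (-z) 0 = 1 := by
        rw [denStage, show 0 + 1 = 2 * 0 + 1 by rfl, denSum_odd, hsum_zero]
      have e3 : denTau ζ b c (eSeq m) 0 = 1 := by
        rw [denTau, show 0 = 2 * 0 by rfl, denSum_even, hsum_zero]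
      have e4 : numTau ζ b c (eSeq m) 0 = 1 := by
        rw [numTau, show 0 = 2 * 0 by rfl, numSum_even, hsum_zero]
      rw [e1, e2, e3, e4]
      simp
    · have ha' : 2 * K - a < 2 * K + 1 := by omega
      simp only [hCoeff, extendZero, ha', dif_pos, hexp, hrev a ha ha']
      rw [mul_div_cancel₀ _ (hm _).ne']
    · have ha' : 2 * K - a < 2 * K + 1 := by omega
      simp only [gCoeff, extendZero, ha', dif_pos, Real.exp_neg, hexp, hrev a ha ha']
      have h1 := (hm ⟨2 * K - a, ha'⟩).ne'
      have h2 := (height_pos hζ hinj hb hc (eSeq_pos hm) ha).ne'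
      have h3 : (Fin.rev ⟨a, ha⟩ : Fin (2 * K + 1)) = ⟨2 * K - a, ha'⟩ := by
        rw [← hrev a ha ha', Fin.rev_rev]
      rw [eSeq, dif_pos ha, eVec, fromRight, h3]
      field_simp
  refine Prod.ext (eq_of_eval_neg fun z hz => ?_) (eq_of_eval_neg fun z hz => ?_)
  · rw [spectralPoly, eval_polyChain_fst, key z hz]
  · rw [spectralPoly, eval_polyChain_snd, key z hz]

end InverseProblem

/-! ### Inequalities between subset sums -/

section Comparison

variable {ι : Type*} [DecidableEq ι]

lemma hsum_insert_succ (ζ η : ι → ℝ) {S : Finset ι} {s : ι} (hs : s ∉ S) (l : ℕ) (ν : ι → ℝ) :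
    hsum ζ η (insert s S) (l + 1) ν = hsum ζ η S (l + 1) ν +
      ν s * hsum ζ η S l fun i => ν i * bracket ζ η s i ^ 2 := by
  have hnot : ∀ I ∈ S.powersetCard l, s ∉ I := fun I hI h =>
    hs ((Finset.mem_powersetCard.1 hI).1 h)
  rw [hsum, Finset.powersetCard_succ_insert hs, Finset.sum_union, Finset.sum_image]
  · congr 1
    rw [hsum, Finset.mul_sum]
    refine Finset.sum_congr rfl fun I hI => ?_
    rw [Finset.prod_insert (hnot I hI), discr_insert ζ η (hnot I hI), Finset.prod_mul_distrib]
    ring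
  · intro I hI J hJ h
    have := congrArg (Finset.erase · s) h
    simpa [Finset.erase_insert (hnot I hI), Finset.erase_insert (hnot J hJ)] using this
  · refine Finset.disjoint_left.2 fun I hI hI' => ?_
    obtain ⟨J, -, rfl⟩ := Finset.mem_image.1 hI'
    exact hs ((Finset.mem_powersetCard.1 hI).1 (Finset.mem_insert_self s J))

lemma hsum_mul_le {ζ η : ι → ℝ} {S : Finset ι} (l : ℕ) {ν f : ι → ℝ} {B : ℝ}
    (hν : ∀ i ∈ S, 0 ≤ ν i) (hf : ∀ i ∈ S, 0 ≤ f i) (hB : ∀ i ∈ S, f i ≤ B) :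
    hsum ζ η S l (fun i => ν i * f i) ≤ B ^ l * hsum ζ η S l ν := by
  rw [hsum, hsum, Finset.mul_sum]
  refine Finset.sum_le_sum fun I hI => ?_
  obtain ⟨hIS, hIl⟩ := Finset.mem_powersetCard.1 hI
  rw [← mul_assoc, Finset.prod_mul_distrib, mul_comm (B ^ l)]
  refine mul_le_mul_of_nonneg_right (mul_le_mul_of_nonneg_left ?_
    (Finset.prod_nonneg fun i hi => hν i (hIS hi))) (discr_nonneg _ _ _)
  rw [← hIl, ← Finset.prod_const]
  exact Finset.prod_le_prod (fun i hi => hf i (hIS hi)) fun i hi => hB i (hIS hi)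

lemma le_hsum_mul {ζ η : ι → ℝ} {S : Finset ι} (l : ℕ) {ν f : ι → ℝ} {B : ℝ} (hB0 : 0 ≤ B)
    (hν : ∀ i ∈ S, 0 ≤ ν i) (hB : ∀ i ∈ S, B ≤ f i) :
    B ^ l * hsum ζ η S l ν ≤ hsum ζ η S l (fun i => ν i * f i) := by
  rw [hsum, hsum, Finset.mul_sum]
  refine Finset.sum_le_sum fun I hI => ?_
  obtain ⟨hIS, hIl⟩ := Finset.mem_powersetCard.1 hI
  rw [← mul_assoc, Finset.prod_mul_distrib, mul_comm (B ^ l)]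
  refine mul_le_mul_of_nonneg_right (mul_le_mul_of_nonneg_left ?_
    (Finset.prod_nonneg fun i hi => hν i (hIS hi))) (discr_nonneg _ _ _)
  rw [← hIl, ← Finset.prod_const]
  exact Finset.prod_le_prod (fun _ _ => hB0) fun i hi => hB i (hIS hi)

/-- Moving one element from the larger to the smaller subset. -/
lemma hsum_exchange_le {ζ η : ι → ℝ} {S : Finset ι} (l : ℕ) {μ ν f : ι → ℝ} {κ a A p q : ℝ}
    (hκ : 0 ≤ κ) (ha : 0 ≤ a) (hq : 0 ≤ q) (hp : 0 ≤ p) (hμ : ∀ i ∈ S, 0 ≤ μ i) (hμν : ∀ i ∈ S, κ * μ i ≤ ν i)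
    (haf : ∀ i ∈ S, a ≤ f i) (hfA : ∀ i ∈ S, f i ≤ A)
    (hbr : ∀ i ∈ S, ∀ j ∈ S, i ≠ j → q ≤ bracket ζ η i j ^ 2 ∧ bracket ζ η i j ^ 2 ≤ p) :
    κ * a ^ (l + 1) * q ^ l *
        (hsum ζ η S (l + 2) μ * hsum ζ η S l (fun i => ν i * f i)) ≤
      (l + 1) * (p ^ (l + 1) * A ^ l) *
        (hsum ζ η S (l + 1) (fun i => μ i * f i) * hsum ζ η S (l + 1) ν) := by
  have hν : ∀ i ∈ S, 0 ≤ ν i := fun i hi => (mul_nonneg hκ (hμ i hi)).trans (hμν i hi)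
  have hf : ∀ i ∈ S, 0 ≤ f i := fun i hi => ha.trans (haf i hi)
  set t : Finset ι → Finset ι → ℝ := fun J L =>
    (∏ i ∈ J, μ i) * discr ζ η J * ((∏ i ∈ L, ν i * f i) * discr ζ η L) with ht
  set u : Finset ι → Finset ι → ℝ := fun I L =>
    (∏ i ∈ I, μ i * f i) * discr ζ η I * ((∏ i ∈ L, ν i) * discr ζ η L) with hu
  have ht0 : ∀ J ⊆ S, ∀ L ⊆ S, 0 ≤ t J L := fun J hJ L hL =>
    mul_nonneg (mul_nonneg (Finset.prod_nonneg fun i hi => hμ i (hJ hi)) (discr_nonneg _ _ _))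
      (mul_nonneg (Finset.prod_nonneg fun i hi => mul_nonneg (hν i (hL hi)) (hf i (hL hi)))
        (discr_nonneg _ _ _))
  have hu0 : ∀ I ⊆ S, ∀ L ⊆ S, 0 ≤ u I L := fun I hI L hL =>
    mul_nonneg (mul_nonneg (Finset.prod_nonneg fun i hi =>
      mul_nonneg (hμ i (hI hi)) (hf i (hI hi))) (discr_nonneg _ _ _))
      (mul_nonneg (Finset.prod_nonneg fun i hi => hν i (hL hi)) (discr_nonneg _ _ _))
  have hbound : ∀ I ∈ S.powersetCard (l + 1), ∀ L ∈ S.powersetCard l, ∀ i ∈ S, i ∉ I → i ∉ L →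
      κ * a ^ (l + 1) * q ^ l * t (insert i I) L ≤ p ^ (l + 1) * A ^ l * u I (insert i L) := by
    intro I hI L hL i hi hiI hiL
    obtain ⟨hIS, hIc⟩ := Finset.mem_powersetCard.1 hI
    obtain ⟨hLS, hLc⟩ := Finset.mem_powersetCard.1 hL
    have b1 : ∏ k ∈ I, bracket ζ η i k ^ 2 ≤ p ^ (l + 1) := by
      rw [← hIc, ← Finset.prod_const]
      exact Finset.prod_le_prod (fun _ _ => sq_nonneg _) fun k hk =>
        (hbr i hi k (hIS hk) fun h => hiI (h ▸ hk)).2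
    have b2 : q ^ l ≤ ∏ k ∈ L, bracket ζ η i k ^ 2 := by
      rw [← hLc, ← Finset.prod_const]
      exact Finset.prod_le_prod (fun _ _ => hq) fun k hk =>
        (hbr i hi k (hLS hk) fun h => hiL (h ▸ hk)).1
    have b3 : a ^ (l + 1) ≤ ∏ k ∈ I, f k := by
      rw [← hIc, ← Finset.prod_const]
      exact Finset.prod_le_prod (fun _ _ => ha) fun k hk => haf k (hIS hk)
    have b4 : ∏ k ∈ L, f k ≤ A ^ l := by
      rw [← hLc, ← Finset.prod_const]
      exact Finset.prod_le_prod (fun k hk => hf k (hLS hk)) fun k hk => hfA k (hLS hk)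
    have n1 : 0 ≤ ∏ k ∈ L, f k := Finset.prod_nonneg fun k hk => hf k (hLS hk)
    have n2 : 0 ≤ ∏ k ∈ I, bracket ζ η i k ^ 2 := Finset.prod_nonneg fun _ _ => sq_nonneg _
    have n3 : 0 ≤ ∏ k ∈ I, μ k := Finset.prod_nonneg fun k hk => hμ k (hIS hk)
    have n4 : 0 ≤ ∏ k ∈ L, ν k := Finset.prod_nonneg fun k hk => hν k (hLS hk)
    have n5 := discr_nonneg ζ η I
    have n6 := discr_nonneg ζ η L
    have n7 := hμ i hi
    have n8 := hν i hi
    have n9 : 0 ≤ a ^ (l + 1) := pow_nonneg ha _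
    have n10 : 0 ≤ q ^ l := pow_nonneg hq _
    have e1 : κ * a ^ (l + 1) * q ^ l * t (insert i I) L =
        (κ * μ i) * a ^ (l + 1) * q ^ l * (∏ k ∈ I, bracket ζ η i k ^ 2) * (∏ k ∈ L, f k) *
          ((∏ k ∈ I, μ k) * (∏ k ∈ L, ν k) * discr ζ η I * discr ζ η L) := by
      simp only [ht]
      rw [Finset.prod_insert hiI, discr_insert ζ η hiI, Finset.prod_mul_distrib]
      ring
    have e2 : p ^ (l + 1) * A ^ l * u I (insert i L) =
        ν i * (∏ k ∈ I, f k) * (∏ k ∈ L, bracket ζ η i k ^ 2) * p ^ (l + 1) * A ^ l *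
          ((∏ k ∈ I, μ k) * (∏ k ∈ L, ν k) * discr ζ η I * discr ζ η L) := by
      simp only [hu]
      rw [Finset.prod_insert hiL, discr_insert ζ η hiL, Finset.prod_mul_distrib]
      ring
    rw [e1, e2]
    refine mul_le_mul_of_nonneg_right ?_ (by positivity)
    have h1 := hμν i hi
    have m0 := n2.trans b1
    have m1 := n9.trans b3
    gcongr
  rw [hsum_mul_hsum, hsum_mul_hsum, Finset.sum_comm]
  calc κ * a ^ (l + 1) * q ^ l * ∑ L ∈ S.powersetCard l, ∑ J ∈ S.powersetCard (l + 2), t J L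
      ≤ κ * a ^ (l + 1) * q ^ l * ∑ L ∈ S.powersetCard l, ∑ J ∈ S.powersetCard (l + 2),
          ∑ i ∈ J, if i ∈ L then 0 else t (insert i (J.erase i)) L := by
        refine mul_le_mul_of_nonneg_left ?_ (by positivity)
        refine Finset.sum_le_sum fun L hL => Finset.sum_le_sum fun J hJ => ?_
        obtain ⟨hJS, hJc⟩ := Finset.mem_powersetCard.1 hJ
        obtain ⟨hLS, hLc⟩ := Finset.mem_powersetCard.1 hL
        -- The set of size `l + 2` has an element outside the set of size `l`; that element can be
        -- moved. Summing over all movable elements only increases the bound.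
        obtain ⟨i, hi, hiL⟩ := Finset.exists_mem_notMem_of_card_lt_card
          (show L.card < J.card by omega)
        have := Finset.single_le_sum (s := J)
          (f := fun i => if i ∈ L then 0 else t (insert i (J.erase i)) L) (fun k hk => by
            split
            · exact le_rfl
            · rw [Finset.insert_erase hk]; exact ht0 J hJS L hLS) hi
        simpa [hiL, Finset.insert_erase hi] using this
    _ = ∑ L ∈ S.powersetCard l, ∑ I ∈ S.powersetCard (l + 1), ∑ i ∈ S \ I,
          κ * a ^ (l + 1) * q ^ l * if i ∈ L then 0 else t (insert i I) L := by
        rw [Finset.mul_sum]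
        refine Finset.sum_congr rfl fun L _ => ?_
        rw [← sum_powersetCard_succ S (l + 1) fun i I => if i ∈ L then 0 else t (insert i I) L,
          Finset.mul_sum]
        exact Finset.sum_congr rfl fun I _ => Finset.mul_sum _ _ _
    _ ≤ ∑ L ∈ S.powersetCard l, ∑ I ∈ S.powersetCard (l + 1), ∑ i ∈ S \ L,
          p ^ (l + 1) * A ^ l * u I (insert i L) := by
        refine Finset.sum_le_sum fun L hL => Finset.sum_le_sum fun I hI => ?_
        obtain ⟨hIS, hIc⟩ := Finset.mem_powersetCard.1 hI
        obtain ⟨hLS, hLc⟩ := Finset.mem_powersetCard.1 hL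
        have hnn : ∀ i ∈ S \ L, 0 ≤ p ^ (l + 1) * A ^ l * u I (insert i L) := by
          intro i hi
          rw [Finset.mem_sdiff] at hi
          exact mul_nonneg (mul_nonneg (pow_nonneg hp _)
            (pow_nonneg ((hf i hi.1).trans (hfA i hi.1)) _))
            (hu0 I hIS _ (Finset.insert_subset hi.1 hLS))
        calc ∑ i ∈ S \ I, κ * a ^ (l + 1) * q ^ l * (if i ∈ L then 0 else t (insert i I) L)
            ≤ ∑ i ∈ S \ I, if i ∈ L then 0 else p ^ (l + 1) * A ^ l * u I (insert i L) := by
              refine Finset.sum_le_sum fun i hi => ?_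
              rw [Finset.mem_sdiff] at hi
              split
              · simp
              · exact hbound I hI L hL i hi.1 hi.2 ‹_›
          _ ≤ ∑ i ∈ S, if i ∈ L then 0 else p ^ (l + 1) * A ^ l * u I (insert i L) := by
              refine Finset.sum_le_sum_of_subset_of_nonneg Finset.sdiff_subset fun i hi _ => ?_
              split
              · exact le_rfl
              · exact hnn i (Finset.mem_sdiff.2 ⟨hi, ‹_›⟩)
          _ = _ := by
              rw [← Finset.sum_subset (Finset.sdiff_subset (s := S) (t := L)) fun i hi hi' =>
                if_pos (by simpa [hi] using hi')]
              exact Finset.sum_congr rfl fun i hi => if_neg (Finset.mem_sdiff.1 hi).2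
    _ = ∑ I ∈ S.powersetCard (l + 1), ∑ J ∈ S.powersetCard (l + 1), ∑ i ∈ J,
          p ^ (l + 1) * A ^ l * u I (insert i (J.erase i)) := by
        rw [Finset.sum_comm]
        exact Finset.sum_congr rfl fun I _ =>
          sum_powersetCard_succ S l fun i L => p ^ (l + 1) * A ^ l * u I (insert i L)
    _ = _ := by
        rw [Finset.mul_sum]
        refine Finset.sum_congr rfl fun I _ => ?_
        rw [Finset.mul_sum]
        refine Finset.sum_congr rfl fun J hJ => ?_
        -- A pair of `(l + 1)`-sets arises once for each choice of the moved element in the second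
        -- set, whence the factor `l + 1`.
        rw [Finset.sum_congr rfl fun i hi => by rw [Finset.insert_erase hi], Finset.sum_const,
          (Finset.mem_powersetCard.1 hJ).2, nsmul_eq_mul]
        push_cast
        ring

end Comparison

/-! ### The mass conditions imply the ordering -/

section Ordering

variable {K : ℕ}

/-- The finite nodes. -/
def finNodes (K : ℕ) : Finset (Fin (K + 1)) := Finset.univ.erase (Fin.last K)

lemma insert_last_finNodes : insert (Fin.last K) (finNodes K) = Finset.univ :=
  Finset.insert_erase (Finset.mem_univ _)

lemma last_notMem_finNodes : Fin.last K ∉ finNodes K := Finset.notMem_erase _ _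

lemma card_finNodes : (finNodes K).card = K := by simp [finNodes]

lemma exists_castSucc_of_mem_finNodes {i : Fin (K + 1)} (hi : i ∈ finNodes K) :
    ∃ j : Fin K, i = j.castSucc := by
  obtain ⟨j, hj⟩ := Fin.exists_castSucc_eq.2 (Finset.ne_of_mem_erase hi)
  exact ⟨j, hj.symm⟩

lemma nodeE_of_mem {i : Fin (K + 1)} (hi : i ∈ finNodes K) : nodeE K i = 1 := by
  obtain ⟨j, rfl⟩ := exists_castSucc_of_mem_finNodes hi
  simp

/-- Splitting off the node at infinity. -/
lemma hsum_univ_succ (ζ : Fin K → ℝ) (l : ℕ) (ν : Fin (K + 1) → ℝ) :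
    hsum (nodeZ ζ) (nodeE K) Finset.univ (l + 1) ν =
      hsum (nodeZ ζ) (nodeE K) (finNodes K) (l + 1) ν +
        ν (Fin.last K) * hsum (nodeZ ζ) (nodeE K) (finNodes K) l ν := by
  rw [← insert_last_finNodes, hsum_insert_succ _ _ last_notMem_finNodes]
  congr 2
  -- The bracket of infinity with a finite node is `1`, so infinity contributes only its weight.
  refine hsum_congr fun i hi => ?_
  simp [bracket, nodeE_of_mem hi]

lemma hsum_univ_of_last {ζ : Fin K → ℝ} (l : ℕ) {ν : Fin (K + 1) → ℝ} (h : ν (Fin.last K) = 0) :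
    hsum (nodeZ ζ) (nodeE K) Finset.univ l ν = hsum (nodeZ ζ) (nodeE K) (finNodes K) l ν := by
  rcases l with _ | l
  · rw [hsum_zero, hsum_zero]
  · rw [hsum_univ_succ, h, zero_mul, add_zero]

lemma minGap_le {ζ : Fin K → ℝ} (hmono : StrictMono ζ) {i j : Fin K} (hij : i < j) :
    minGap ζ ≤ ζ j - ζ i := by
  have hlt : (i : ℕ) < K - 1 := by have := j.2; rw [Fin.lt_def] at hij; omega
  refine (ciInf_le (Set.finite_range _).bddBelow (⟨i, hlt⟩ : Fin (K - 1))).trans ?_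
  have : (⟨i + 1, by omega⟩ : Fin K) ≤ j := by rw [Fin.le_def]; exact hij
  simpa using hmono.monotone this

lemma minGap_pos {ζ : Fin K → ℝ} (hmono : StrictMono ζ) (hK : 2 ≤ K) : 0 < minGap ζ := by
  have : Nonempty (Fin (K - 1)) := ⟨⟨0, by omega⟩⟩
  obtain ⟨j, hj⟩ := exists_eq_ciInf_of_finite
    (f := fun j : Fin (K - 1) => ζ ⟨j + 1, by omega⟩ - ζ ⟨j, by omega⟩)
  rw [minGap, ← hj]
  exact sub_pos.2 (hmono (by rw [Fin.lt_def]; simp))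

lemma firstOf_le {ζ : Fin K → ℝ} (hmono : StrictMono ζ) (j i : Fin K) : firstOf ζ j ≤ ζ i :=
  hmono.monotone (by rw [Fin.le_def]; simp)

lemma le_lastOf {ζ : Fin K → ℝ} (hmono : StrictMono ζ) (j i : Fin K) : ζ i ≤ lastOf ζ j :=
  hmono.monotone (by rw [Fin.le_def]; have := i.2; simp; omega)

lemma node_bracket_sq_bounds {ζ : Fin K → ℝ} (hmono : StrictMono ζ) (j₀ : Fin K)
    {i j : Fin (K + 1)} (hi : i ∈ finNodes K) (hj : j ∈ finNodes K) (hij : i ≠ j) :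
    minGap ζ ^ 2 ≤ bracket (nodeZ ζ) (nodeE K) i j ^ 2 ∧
      bracket (nodeZ ζ) (nodeE K) i j ^ 2 ≤ (lastOf ζ j₀ - firstOf ζ j₀) ^ 2 := by
  obtain ⟨i, rfl⟩ := exists_castSucc_of_mem_finNodes hi
  obtain ⟨j, rfl⟩ := exists_castSucc_of_mem_finNodes hj
  have hne : i ≠ j := fun h => hij (by rw [h])
  have hK : 2 ≤ K := by
    have := i.2; have := j.2
    have := Fin.val_ne_of_ne hne
    omega
  have hg := minGap_pos hmono hK
  simp only [bracket, nodeZ_castSucc, nodeE_castSucc, mul_one]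
  have h1 := firstOf_le hmono j₀ i
  have h2 := firstOf_le hmono j₀ j
  have h3 := le_lastOf hmono j₀ i
  have h4 := le_lastOf hmono j₀ j
  constructor
  · rw [sq_le_sq, abs_of_pos hg]
    rcases lt_or_gt_of_ne hne with h | h
    · rw [abs_sub_comm]
      exact (minGap_le hmono h).trans (le_abs_self _)
    · exact (minGap_le hmono h).trans (le_abs_self _)
  · rw [sq_le_sq]
    rw [abs_of_nonneg (a := lastOf ζ j₀ - firstOf ζ j₀) (by linarith), abs_le]
    constructor <;> linarith

/-- The first half of the comparison: only the sizes of the nodes enter. -/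
lemma hsum_finNodes_lt {ζ : Fin K → ℝ} (hζ : ∀ j, 0 < ζ j) (hmono : StrictMono ζ) (j : Fin K)
    {μ ν : Fin (K + 1) → ℝ} (hμ : ∀ i, 0 < μ i) (hν : ∀ i, 0 < ν i) {M : ℝ}
    (hM : lastOf ζ j ^ (j : ℕ) < M * firstOf ζ j ^ ((j : ℕ) + 1)) :
    hsum (nodeZ ζ) (nodeE K) (finNodes K) (j + 1) μ *
        hsum (nodeZ ζ) (nodeE K) (finNodes K) j (fun i => ν i * nodeZ ζ i) <
      M * (hsum (nodeZ ζ) (nodeE K) (finNodes K) (j + 1) (fun i => μ i * nodeZ ζ i) *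
        hsum (nodeZ ζ) (nodeE K) (finNodes K) j ν) := by
  have hz1 : ∀ i ∈ finNodes K, firstOf ζ j ≤ nodeZ ζ i := by
    intro i hi
    obtain ⟨i, rfl⟩ := exists_castSucc_of_mem_finNodes hi
    simpa using firstOf_le hmono j i
  have hz2 : ∀ i ∈ finNodes K, nodeZ ζ i ≤ lastOf ζ j := by
    intro i hi
    obtain ⟨i, rfl⟩ := exists_castSucc_of_mem_finNodes hi
    simpa using le_lastOf hmono j i
  have hf : 0 < firstOf ζ j := hζ _
  have hl : 0 < lastOf ζ j := hζ _
  have hbr := node_bracket_ne_zero hmono.injective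
  have hc1 : (j : ℕ) + 1 ≤ (finNodes K).card := by rw [card_finNodes]; exact j.2
  have p1 := hsum_pos hbr (S := finNodes K) (l := j + 1) (fun i _ => (hμ i).le)
    subset_rfl (fun i _ => hμ i) hc1
  have p2 := hsum_pos hbr (S := finNodes K) (l := j) (fun i _ => (hν i).le)
    subset_rfl (fun i _ => hν i) ((Nat.le_succ _).trans hc1)
  -- On the left `j` factors are at most `ζ_K`, on the right `j + 1` factors are at least `ζ_1`;
  -- this is the power quotient in the mass conditions.
  have b1 := hsum_mul_le (ζ := nodeZ ζ) (η := nodeE K) (S := finNodes K) j (fun i _ => (hν i).le)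
    (fun i _ => (nodeZ_pos hζ i).le) hz2
  have b2 := le_hsum_mul (ζ := nodeZ ζ) (η := nodeE K) (S := finNodes K) (j + 1) hf.le
    (fun i _ => (hμ i).le) hz1
  have hMpos : 0 < M := by
    have : 0 < M * firstOf ζ j ^ ((j : ℕ) + 1) := (pow_pos hl _).trans hM
    exact pos_of_mul_pos_left this (pow_pos hf _).le
  calc _ ≤ hsum (nodeZ ζ) (nodeE K) (finNodes K) (j + 1) μ *
        (lastOf ζ j ^ (j : ℕ) * hsum (nodeZ ζ) (nodeE K) (finNodes K) j ν) :=
        mul_le_mul_of_nonneg_left b1 p1.le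
    _ = lastOf ζ j ^ (j : ℕ) * (hsum (nodeZ ζ) (nodeE K) (finNodes K) (j + 1) μ *
        hsum (nodeZ ζ) (nodeE K) (finNodes K) j ν) := by ring
    _ < M * firstOf ζ j ^ ((j : ℕ) + 1) * (hsum (nodeZ ζ) (nodeE K) (finNodes K) (j + 1) μ *
        hsum (nodeZ ζ) (nodeE K) (finNodes K) j ν) :=
        mul_lt_mul_of_pos_right hM (mul_pos p1 p2)
    _ = M * (firstOf ζ j ^ ((j : ℕ) + 1) * hsum (nodeZ ζ) (nodeE K) (finNodes K) (j + 1) μ *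
        hsum (nodeZ ζ) (nodeE K) (finNodes K) j ν) := by ring
    _ ≤ _ := by
        refine mul_le_mul_of_nonneg_left (mul_le_mul_of_nonneg_right b2 p2.le) hMpos.le

/-- The second half of the comparison: the gaps between the nodes enter. -/
lemma hsum_finNodes_exchange_le {ζ : Fin K → ℝ} (hζ : ∀ j, 0 < ζ j) (hmono : StrictMono ζ)
    (j : Fin K) (hK : 2 ≤ K) (l : ℕ) {μ ν : Fin (K + 1) → ℝ} (hμ : ∀ i, 0 < μ i)
    (hν : ∀ i, 0 < ν i) {κ M : ℝ} (hκ : 0 < κ) (hμν : ∀ i ∈ finNodes K, κ * μ i ≤ ν i)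
    (hM : (l + 1) * ((lastOf ζ j - firstOf ζ j) ^ (2 * l + 2) * lastOf ζ j ^ l) <
      M * (κ * firstOf ζ j ^ (l + 1) * minGap ζ ^ (2 * l))) :
    hsum (nodeZ ζ) (nodeE K) (finNodes K) (l + 2) μ *
        hsum (nodeZ ζ) (nodeE K) (finNodes K) l (fun i => ν i * nodeZ ζ i) ≤
      M * (hsum (nodeZ ζ) (nodeE K) (finNodes K) (l + 1) (fun i => μ i * nodeZ ζ i) *
        hsum (nodeZ ζ) (nodeE K) (finNodes K) (l + 1) ν) := by
  have hf : 0 < firstOf ζ j := hζ _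
  have hg := minGap_pos hmono hK
  have key := hsum_exchange_le (ζ := nodeZ ζ) (η := nodeE K) (S := finNodes K) l (f := nodeZ ζ)
    (κ := κ) (a := firstOf ζ j) (A := lastOf ζ j) (q := minGap ζ ^ 2)
    (p := (lastOf ζ j - firstOf ζ j) ^ 2) hκ.le hf.le (sq_nonneg _) (sq_nonneg _)
    (fun i _ => (hμ i).le) hμν
    (fun i hi => by
      obtain ⟨i, rfl⟩ := exists_castSucc_of_mem_finNodes hi
      simpa using firstOf_le hmono j i)
    (fun i hi => by
      obtain ⟨i, rfl⟩ := exists_castSucc_of_mem_finNodes hi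
      simpa using le_lastOf hmono j i)
    (fun i hi i' hi' h => node_bracket_sq_bounds hmono j hi hi' h)
  rw [← pow_mul, ← pow_mul, mul_add, mul_one] at key
  have hpos : 0 < κ * firstOf ζ j ^ (l + 1) * minGap ζ ^ (2 * l) := by positivity
  have hu : 0 ≤ hsum (nodeZ ζ) (nodeE K) (finNodes K) (l + 1) (fun i => μ i * nodeZ ζ i) *
      hsum (nodeZ ζ) (nodeE K) (finNodes K) (l + 1) ν :=
    mul_nonneg (hsum_nonneg _ _ _ _ fun i _ => (mul_pos (hμ i) (nodeZ_pos hζ i)).le)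
      (hsum_nonneg _ _ _ _ fun i _ => (hν i).le)
  have := key.trans (mul_le_mul_of_nonneg_right hM.le hu)
  refine le_of_mul_le_mul_left ?_ hpos
  linarith

lemma tauWeight_last (ζ b : Fin K → ℝ) (c : ℝ) (e : ℕ → ℝ) (k : ℕ) :
    tauWeight ζ b c e k (Fin.last K) = c := by simp [tauWeight]

/-- The weights two levels apart differ by `(ζ_i + e_k)(ζ_i + e_{k+1})`, smallest at `ζ_1`; by
`massFactor_eq` this minimum is the mass factor in `β̂` and `β̂₁`. -/
lemma mul_tauWeight_le {ζ b : Fin K → ℝ} {c : ℝ} {e : ℕ → ℝ} (hζ : ∀ j, 0 < ζ j)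
    (hmono : StrictMono ζ) (hb : ∀ j, 0 < b j) (hc : 0 < c) (he : ∀ a, 0 < e a) (k : ℕ)
    (j : Fin K) {i : Fin (K + 1)} (hi : i ∈ finNodes K) :
    (firstOf ζ j + e k) * (firstOf ζ j + e (k + 1)) * tauWeight ζ b c e (k + 2) i ≤
      tauWeight ζ b c e k i := by
  rw [← tauWeight_succ hζ b c he k i, ← tauWeight_succ hζ b c he (k + 1) i, mul_comm, mul_assoc]
  have hf : 0 < firstOf ζ j := hζ _
  have h1 : firstOf ζ j ≤ nodeZ ζ i := by
    obtain ⟨i, rfl⟩ := exists_castSucc_of_mem_finNodes hi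
    simpa using firstOf_le hmono j i
  refine mul_le_mul_of_nonneg_left ?_ (tauWeight_pos hζ hb hc he _ _).le
  rw [nodeE_of_mem hi, mul_one, mul_one, mul_comm]
  have h2 := he k
  have h3 := he (k + 1)
  exact mul_le_mul (by linarith) (by linarith) (by linarith) (by linarith)

lemma massFactor_eq {s r z : ℝ} (hs : 0 < s) (hr : 0 < r) :
    massFactor s r z = (z + 1 / s ^ 2) * (z + 1 / r ^ 2) := by
  rw [massFactor]
  field_simp
  ring

lemma eSeq_eq {n : ℕ} (m : Fin n → ℝ) (a : Fin n) : eSeq m a = 1 / fromRight m a ^ 2 := by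
  rw [eSeq, dif_pos a.2, eVec]

lemma pow_lt_of_mass {M f l B : ℝ} {k : ℕ} (hM : 0 < M) (hf : 0 < f) (hl : 0 < l)
    (h : 1 / M < f ^ (k + 1) / l ^ k * B) (hB : B ≤ 1) : l ^ k < M * f ^ (k + 1) := by
  have h1 : 1 / M < f ^ (k + 1) / l ^ k :=
    h.trans_le (mul_le_of_le_one_right (by positivity) hB)
  rw [div_lt_div_iff₀ hM (pow_pos hl _)] at h1
  linarith

/-- Only the two denominators involve infinity, so both sides have degree at most one in `c`. The
constant terms are compared by node size, the coefficients of `c` by moving a node. -/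
lemma tau_even_lt {m : Fin (2 * K + 1) → ℝ} {ζ b : Fin K → ℝ} {c : ℝ} (hm : ∀ i, 0 < m i)
    (hζ : ∀ j, 0 < ζ j) (hmono : StrictMono ζ) (hb : ∀ j, 0 < b j) (hc : 0 < c)
    (hmass : MassCondition m ζ) (j : Fin K) :
    numTau ζ b c (eSeq m) (2 * j + 2) * denTau ζ b c (eSeq m) (2 * j) <
      fromRight m (r₂ j) * fromRight m (r₁ j) *
        (denTau ζ b c (eSeq m) (2 * j + 2) * numTau ζ b c (eSeq m) (2 * j)) := by
  have hf : 0 < firstOf ζ j := hζ _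
  have hl : 0 < lastOf ζ j := hζ _
  have m1 : 0 < fromRight m (r₁ j) := hm _
  have m2 : 0 < fromRight m (r₂ j) := hm _
  have he := eSeq_pos hm
  have hμ := tauWeight_pos hζ hb hc he (2 * j + 2)
  have hν := tauWeight_pos hζ hb hc he (2 * (j : ℕ))
  have hM : 0 < fromRight m (r₂ j) * fromRight m (r₁ j) := mul_pos m2 m1
  have hcond := hmass.first j
  have hlt := hsum_finNodes_lt hζ hmono j hμ hν (pow_lt_of_mass hM hf hl hcond (by
    unfold minBeta; split
    · exact le_rfl
    · exact min_le_left _ _))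
  have d0 : hsum (nodeZ ζ) (nodeE K) (finNodes K) j
      (fun i => tauWeight ζ b c (eSeq m) (2 * j) i * nodeE K i) =
      hsum (nodeZ ζ) (nodeE K) (finNodes K) j (tauWeight ζ b c (eSeq m) (2 * j)) :=
    hsum_congr fun i hi => by rw [nodeE_of_mem hi, mul_one]
  have d1 : hsum (nodeZ ζ) (nodeE K) (finNodes K) (j + 1)
      (fun i => tauWeight ζ b c (eSeq m) (2 * j + 2) i * nodeE K i) =
      hsum (nodeZ ζ) (nodeE K) (finNodes K) (j + 1) (tauWeight ζ b c (eSeq m) (2 * j + 2)) :=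
    hsum_congr fun i hi => by rw [nodeE_of_mem hi, mul_one]
  have u0 : numTau ζ b c (eSeq m) (2 * j) =
      hsum (nodeZ ζ) (nodeE K) (finNodes K) j (tauWeight ζ b c (eSeq m) (2 * j)) := by
    rw [numTau, numSum_even, hsum_univ_of_last _ (by simp), d0]
  have u1 : numTau ζ b c (eSeq m) (2 * j + 2) =
      hsum (nodeZ ζ) (nodeE K) (finNodes K) (j + 1) (tauWeight ζ b c (eSeq m) (2 * j + 2)) := by
    rw [← d1, numTau, show 2 * (j : ℕ) + 2 = 2 * (j + 1) by ring, numSum_even,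
      hsum_univ_of_last _ (by simp)]
  have v1 : denTau ζ b c (eSeq m) (2 * j + 2) =
      hsum (nodeZ ζ) (nodeE K) (finNodes K) (j + 1)
        (fun i => tauWeight ζ b c (eSeq m) (2 * j + 2) i * nodeZ ζ i) +
      c * hsum (nodeZ ζ) (nodeE K) (finNodes K) j
        (fun i => tauWeight ζ b c (eSeq m) (2 * j + 2) i * nodeZ ζ i) := by
    rw [denTau, show 2 * (j : ℕ) + 2 = 2 * (j + 1) by ring, denSum_even, hsum_univ_succ,
      tauWeight_last, nodeZ_last, mul_one]
  rw [u0, u1, v1, denTau, denSum_even]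
  rcases hj : (j : ℕ) with _ | l
  -- For `j = 0` there is no smaller subset, so the left side has no term in `c`; this is the case
  -- `β̂ = +∞`.
  · have hp := hsum_pos (node_bracket_ne_zero hmono.injective) (S := finNodes K) (l := 0)
      (ν := fun i => tauWeight ζ b c (eSeq m) (2 * 0 + 2) i * nodeZ ζ i)
      (fun i _ => (mul_pos (tauWeight_pos hζ hb hc he _ i) (nodeZ_pos hζ i)).le) subset_rfl
      (fun i _ => mul_pos (tauWeight_pos hζ hb hc he _ i) (nodeZ_pos hζ i)) (Nat.zero_le _)
    rw [hj] at hlt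
    simp only [hsum_zero, mul_one] at hlt ⊢
    have := mul_pos hM hc
    linarith
  · have hK : 2 ≤ K := by have := j.2; omega
    have hex := hsum_finNodes_exchange_le hζ hmono j hK l hμ hν
      (κ := (firstOf ζ j + eSeq m (2 * j)) * (firstOf ζ j + eSeq m (2 * j + 1)))
      (M := fromRight m (r₂ j) * fromRight m (r₁ j))
      (mul_pos (add_pos hf (he _)) (add_pos hf (he _)))
      (fun i hi => mul_tauWeight_le hζ hmono hb hc he (2 * j) j hi) (by
        have e1 : eSeq m (2 * j) = 1 / fromRight m (r₁ j) ^ 2 := eSeq_eq m (r₁ j)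
        have e2 : eSeq m (2 * j + 1) = 1 / fromRight m (r₂ j) ^ 2 := eSeq_eq m (r₂ j)
        rw [e1, e2, ← massFactor_eq m1 m2]
        have hg := minGap_pos hmono hK
        have hD : 0 < lastOf ζ j - firstOf ζ j := by
          have : (⟨0, j.pos⟩ : Fin K) < ⟨K - 1, Nat.sub_lt j.pos one_pos⟩ := by
            rw [Fin.lt_def]; simp; omega
          exact sub_pos.2 (hmono this)
        have hmf : 0 < massFactor (fromRight m (r₁ j)) (fromRight m (r₂ j)) (firstOf ζ j) := by
          rw [massFactor_eq m1 m2]; positivity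
        -- With `j = l + 1` the exponents `k - 3` and `k - 1` are `2l` and `2l + 2`. The factor `ζ_K
        -- / ζ_1` of `β̂` lowers both powers in the prefactor by one, leaving exactly the constant
        -- of the exchange inequality.
        rw [minBeta, if_neg (by omega)] at hcond
        have h2 := hcond.trans_le (mul_le_mul_of_nonneg_left (min_le_right _ _) (by positivity))
        rw [hj, show 2 * (l + 1) - 2 = 2 * l by omega, show 2 * (l + 1) = 2 * l + 2 by ring] at h2
        rw [div_lt_iff₀ hM] at h2
        push_cast at h2
        set F := firstOf ζ j
        set A := lastOf ζ j
        set D := A - F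
        have : F ^ (l + 1 + 1) / A ^ (l + 1) * (2 * A * minGap ζ ^ (2 * l) /
            (F * (2 * (l + 1)) * D ^ (2 * l + 2)) *
            massFactor (fromRight m (r₁ j)) (fromRight m (r₂ j)) F) *
            (fromRight m (r₂ j) * fromRight m (r₁ j)) =
            fromRight m (r₂ j) * fromRight m (r₁ j) *
            (massFactor (fromRight m (r₁ j)) (fromRight m (r₂ j)) F * F ^ (l + 1) *
              minGap ζ ^ (2 * l)) / ((l + 1) * (D ^ (2 * l + 2) * A ^ l)) := by
          field_simp
          ring
        rw [this, one_lt_div (by positivity)] at h2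
        exact h2)
    rw [hsum_univ_succ, tauWeight_last, nodeZ_last, mul_one]
    rw [hj] at hlt hex
    have := mul_le_mul_of_nonneg_left hex hc.le
    linarith

/-- Now only the two numerators involve infinity. The coefficients of `c` are compared by node size
and the constant terms by moving a node. -/
lemma tau_odd_lt {m : Fin (2 * K + 1) → ℝ} {ζ b : Fin K → ℝ} {c : ℝ} (hm : ∀ i, 0 < m i)
    (hζ : ∀ j, 0 < ζ j) (hmono : StrictMono ζ) (hb : ∀ j, 0 < b j) (hc : 0 < c)
    (hmass : MassCondition m ζ) (j : Fin K) :
    numTau ζ b c (eSeq m) (2 * j + 1 + 2) * denTau ζ b c (eSeq m) (2 * j + 1) <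
      fromRight m (r₃ j) * fromRight m (r₂ j) *
        (denTau ζ b c (eSeq m) (2 * j + 1 + 2) * numTau ζ b c (eSeq m) (2 * j + 1)) := by
  have hf : 0 < firstOf ζ j := hζ _
  have hl : 0 < lastOf ζ j := hζ _
  have m2 : 0 < fromRight m (r₂ j) := hm _
  have m3 : 0 < fromRight m (r₃ j) := hm _
  have he := eSeq_pos hm
  have hμ := tauWeight_pos hζ hb hc he (2 * j + 1 + 2)
  have hν := tauWeight_pos hζ hb hc he (2 * (j : ℕ) + 1)
  have hM : 0 < fromRight m (r₃ j) * fromRight m (r₂ j) := mul_pos m3 m2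
  have hcond := hmass.second j
  have hlt := hsum_finNodes_lt hζ hmono j hμ hν (pow_lt_of_mass hM hf hl hcond (by
    unfold minBetaOne; split
    · exact le_rfl
    · exact min_le_left _ _))
  have d0 : ∀ k l : ℕ, hsum (nodeZ ζ) (nodeE K) (finNodes K) l
      (fun i => tauWeight ζ b c (eSeq m) k i * (nodeZ ζ i * nodeE K i)) =
      hsum (nodeZ ζ) (nodeE K) (finNodes K) l
      (fun i => tauWeight ζ b c (eSeq m) k i * nodeZ ζ i) := fun k l =>
    hsum_congr fun i hi => by rw [nodeE_of_mem hi, mul_one]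
  have hex : hsum (nodeZ ζ) (nodeE K) (finNodes K) (j + 2) (tauWeight ζ b c (eSeq m) (2 * j + 1 + 2)) *
        hsum (nodeZ ζ) (nodeE K) (finNodes K) j
          (fun i => tauWeight ζ b c (eSeq m) (2 * j + 1) i * nodeZ ζ i) ≤
      fromRight m (r₃ j) * fromRight m (r₂ j) *
        (hsum (nodeZ ζ) (nodeE K) (finNodes K) (j + 1)
          (fun i => tauWeight ζ b c (eSeq m) (2 * j + 1 + 2) i * nodeZ ζ i) *
        hsum (nodeZ ζ) (nodeE K) (finNodes K) (j + 1) (tauWeight ζ b c (eSeq m) (2 * j + 1))) := by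
    rcases eq_or_ne K 1 with hK1 | hK1
    -- A single finite node has no subset of size two, so the exchange inequality is trivial; this
    -- is the case `β̂₁ = +∞`.
    · have h0 : hsum (nodeZ ζ) (nodeE K) (finNodes K) (j + 2)
          (tauWeight ζ b c (eSeq m) (2 * j + 1 + 2)) = 0 := by
        rw [hsum, Finset.powersetCard_eq_empty.2 (by rw [card_finNodes]; omega), Finset.sum_empty]
      rw [h0, zero_mul]
      exact mul_nonneg hM.le (mul_nonneg (hsum_nonneg _ _ _ _ fun i _ =>
        (mul_pos (hμ i) (nodeZ_pos hζ i)).le) (hsum_nonneg _ _ _ _ fun i _ => (hν i).le))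
    · have hK : 2 ≤ K := by have := j.2; omega
      refine hsum_finNodes_exchange_le hζ hmono j hK j hμ hν
        (κ := (firstOf ζ j + eSeq m (2 * j + 1)) * (firstOf ζ j + eSeq m (2 * j + 1 + 1)))
        (M := fromRight m (r₃ j) * fromRight m (r₂ j))
        (mul_pos (add_pos hf (he _)) (add_pos hf (he _)))
        (fun i hi => mul_tauWeight_le hζ hmono hb hc he (2 * j + 1) j hi) ?_
      have e1 : eSeq m (2 * j + 1) = 1 / fromRight m (r₂ j) ^ 2 := eSeq_eq m (r₂ j)
      have e2 : eSeq m (2 * j + 1 + 1) = 1 / fromRight m (r₃ j) ^ 2 := eSeq_eq m (r₃ j)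
      rw [e1, e2, ← massFactor_eq m2 m3]
      have hg := minGap_pos hmono hK
      have hD : 0 < lastOf ζ j - firstOf ζ j := by
        have : (⟨0, j.pos⟩ : Fin K) < ⟨K - 1, Nat.sub_lt j.pos one_pos⟩ := by
          rw [Fin.lt_def]; simp; omega
        exact sub_pos.2 (hmono this)
      have hmf : 0 < massFactor (fromRight m (r₂ j)) (fromRight m (r₃ j)) (firstOf ζ j) := by
        rw [massFactor_eq m2 m3]; positivity
      rw [minBetaOne, if_neg hK1] at hcond
      have h2 := hcond.trans_le (mul_le_mul_of_nonneg_left (min_le_right _ _) (by positivity))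
      rw [div_lt_iff₀ hM] at h2
      set F := firstOf ζ j
      set A := lastOf ζ j
      set D := A - F
      have : F ^ ((j : ℕ) + 1) / A ^ (j : ℕ) * (2 * minGap ζ ^ (2 * (j : ℕ)) /
          ((2 * ((j : ℕ) : ℝ) + 2) * D ^ (2 * (j : ℕ) + 2)) *
          massFactor (fromRight m (r₂ j)) (fromRight m (r₃ j)) F) *
          (fromRight m (r₃ j) * fromRight m (r₂ j)) =
          fromRight m (r₃ j) * fromRight m (r₂ j) *
          (massFactor (fromRight m (r₂ j)) (fromRight m (r₃ j)) F * F ^ ((j : ℕ) + 1) *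
            minGap ζ ^ (2 * (j : ℕ))) /
          ((((j : ℕ) : ℝ) + 1) * (D ^ (2 * (j : ℕ) + 2) * A ^ (j : ℕ))) := by
        field_simp
      rw [this, one_lt_div (by positivity)] at h2
      exact h2
  have hlt' := mul_lt_mul_of_pos_left hlt hc
  have v : ∀ l : ℕ, denTau ζ b c (eSeq m) (2 * l + 1) = hsum (nodeZ ζ) (nodeE K) (finNodes K) l
      (fun i => tauWeight ζ b c (eSeq m) (2 * l + 1) i * nodeZ ζ i) := fun l => by
    rw [denTau, denSum_odd, hsum_univ_of_last _ (by simp), d0]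
  have u : ∀ l : ℕ, numTau ζ b c (eSeq m) (2 * l + 1) =
      hsum (nodeZ ζ) (nodeE K) (finNodes K) (l + 1) (tauWeight ζ b c (eSeq m) (2 * l + 1)) +
        c * hsum (nodeZ ζ) (nodeE K) (finNodes K) l (tauWeight ζ b c (eSeq m) (2 * l + 1)) :=
    fun l => by rw [numTau, numSum_odd, hsum_univ_succ, tauWeight_last]
  rw [show 2 * (j : ℕ) + 1 + 2 = 2 * (j + 1) + 1 by ring] at hlt' hex ⊢
  rw [u, u, v, v]
  linarith

/-- In the quotient of two neighbouring heights the middle factors at `a + 1` cancel, and `e_a` is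
an inverse square mass. What is left is the `tau` inequality at `a`, even or odd. -/
lemma strictMono_position {m : Fin (2 * K + 1) → ℝ} {ζ b : Fin K → ℝ} {c : ℝ}
    (hm : ∀ i, 0 < m i) (hζ : ∀ j, 0 < ζ j) (hmono : StrictMono ζ) (hb : ∀ j, 0 < b j)
    (hc : 0 < c) (hmass : MassCondition m ζ) : StrictMono (position m ζ b c) := by
  have he := eSeq_pos hm
  have hinj := hmono.injective
  have key : ∀ a (ha : a < 2 * K), numTau ζ b c (eSeq m) (a + 2) * denTau ζ b c (eSeq m) a <
      fromRight m ⟨a + 1, by omega⟩ * fromRight m ⟨a, by omega⟩ *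
        (denTau ζ b c (eSeq m) (a + 2) * numTau ζ b c (eSeq m) a) := by
    intro a ha
    rcases Nat.even_or_odd' a with ⟨j, rfl | rfl⟩
    · exact tau_even_lt hm hζ hmono hb hc hmass ⟨j, by omega⟩
    · exact tau_odd_lt hm hζ hmono hb hc hmass ⟨j, by omega⟩
  refine Fin.strictMono_iff_lt_succ.2 fun i => ?_
  obtain ⟨a, ha⟩ : ∃ a : Fin (2 * K), a = i.rev := ⟨_, rfl⟩
  obtain rfl : i = a.rev := by rw [ha, Fin.rev_rev]
  have h1 : (a.rev.castSucc).rev = a.succ := by rw [Fin.rev_castSucc, Fin.rev_rev]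
  have h2 : (a.rev.succ).rev = a.castSucc := by rw [Fin.rev_succ, Fin.rev_rev]
  have h1' : a.rev.castSucc = a.succ.rev := by rw [← h1, Fin.rev_rev]
  have h2' : a.rev.succ = a.castSucc.rev := by rw [← h2, Fin.rev_rev]
  have hp := height_pos hζ hinj hb hc he a.succ.2
  rw [position, position, h1, h2]
  refine Real.log_lt_log (div_pos hp (hm _)) ?_
  rw [h1', h2']
  have k := key a a.2
  have u0 := numTau_pos hζ hinj hb hc he (show (a : ℕ) ≤ 2 * K + 1 by omega)
  have u1 := numTau_pos hζ hinj hb hc he (show (a : ℕ) + 1 ≤ 2 * K + 1 by omega)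
  have u2 := numTau_pos hζ hinj hb hc he (show (a : ℕ) + 2 ≤ 2 * K + 1 by omega)
  have v0 := denTau_pos hζ hinj hb hc he (show (a : ℕ) ≤ 2 * K + 1 by omega)
  have v1 := denTau_pos hζ hinj hb hc he (show (a : ℕ) + 1 ≤ 2 * K + 1 by omega)
  have v2 := denTau_pos hζ hinj hb hc he (show (a : ℕ) + 2 ≤ 2 * K + 1 by omega)
  have hE : 0 < ∏ i ∈ Finset.range a, eSeq m i := Finset.prod_pos fun i _ => he i
  have e1 : eSeq m a = 1 / fromRight m a.castSucc ^ 2 := eSeq_eq m a.castSucc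
  have f1 : fromRight m ⟨a + 1, by omega⟩ = m a.succ.rev := rfl
  have f2 : fromRight m ⟨a, by omega⟩ = m a.castSucc.rev := rfl
  rw [f1, f2] at k
  rw [fromRight] at e1
  rw [height, height, Fin.val_succ, Fin.val_castSucc, Finset.prod_range_succ, e1]
  have q1 := hm a.succ.rev
  have q2 := hm a.castSucc.rev
  rw [← sub_pos] at k ⊢
  have : 0 < (∏ i ∈ Finset.range a, eSeq m i) * numTau ζ b c (eSeq m) (a + 1) /
      (denTau ζ b c (eSeq m) (a + 1) * denTau ζ b c (eSeq m) (a + 2) * denTau ζ b c (eSeq m) a *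
        m a.succ.rev * m a.castSucc.rev ^ 2) := by positivity
  refine (mul_pos this k).trans_eq ?_
  field_simp

end Ordering

/-! ### Sums of exponentials with one dominant term -/

section ExpClose

lemma ExpCloseTop.of_le {f g : ℝ → ℝ} {α β : ℝ} (hαβ : β ≤ α)
    (h : (fun t => f t - g t) =O[atTop] fun t => Real.exp (-α * t)) :
    (fun t => f t - g t) =O[atTop] fun t => Real.exp (-β * t) := by
  refine h.trans (IsBigO.of_bound 1 ?_)
  filter_upwards [eventually_ge_atTop 0] with t ht
  rw [one_mul, Real.norm_of_nonneg (Real.exp_pos _).le, Real.norm_of_nonneg (Real.exp_pos _).le,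
    Real.exp_le_exp]
  nlinarith

lemma ExpCloseTop.add {f g f' g' : ℝ → ℝ} (h : ExpCloseTop f g) (h' : ExpCloseTop f' g') :
    ExpCloseTop (fun t => f t + f' t) (fun t => g t + g' t) := by
  obtain ⟨α, hα, h⟩ := h
  obtain ⟨α', hα', h'⟩ := h'
  refine ⟨min α α', lt_min hα hα', ?_⟩
  have := (ExpCloseTop.of_le (min_le_left _ _) h).add
    (ExpCloseTop.of_le (min_le_right _ _) h')
  exact this.congr_left fun t => by ring

lemma ExpCloseTop.neg {f g : ℝ → ℝ} (h : ExpCloseTop f g) :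
    ExpCloseTop (fun t => -f t) (fun t => -g t) := by
  obtain ⟨α, hα, h⟩ := h
  exact ⟨α, hα, h.neg_left.congr_left fun t => by ring⟩

lemma ExpCloseTop.sub {f g f' g' : ℝ → ℝ} (h : ExpCloseTop f g) (h' : ExpCloseTop f' g') :
    ExpCloseTop (fun t => f t - f' t) (fun t => g t - g' t) := by
  simpa only [sub_eq_add_neg] using h.add h'.neg

lemma ExpCloseTop.refl (f : ℝ → ℝ) : ExpCloseTop f f :=
  ⟨1, one_pos, by simpa using isBigO_zero _ _⟩

lemma ExpCloseTop.toBot {f g : ℝ → ℝ} (h : ExpCloseTop (fun t => f (-t)) (fun t => g (-t))) :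
    ExpCloseBot f g := by
  obtain ⟨α, hα, h⟩ := h
  refine ⟨α, hα, ?_⟩
  have := h.comp_tendsto tendsto_neg_atBot_atTop
  simpa [Function.comp_def] using this

/-- A sum of exponentials with a single dominant term. -/
lemma expClose_log_sum {κ : Type*} [DecidableEq κ] (T : Finset κ) (a ρ : κ → ℝ) {k₀ : κ}
    (hk₀ : k₀ ∈ T) (ha : 0 < a k₀) (h : ∀ k ∈ T, k ≠ k₀ → a k = 0 ∨ ρ k < ρ k₀) :
    ExpCloseTop (fun t => Real.log (∑ k ∈ T, a k * Real.exp (ρ k * t)))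
      (fun t => ρ k₀ * t + Real.log (a k₀)) := by
  -- There are finitely many rate gaps, so one `α > 0` lies below all of them. Terms with zero
  -- coefficient may have any rate.
  obtain ⟨α, hα, hgap⟩ : ∃ α > 0, ∀ k ∈ T.erase k₀, a k = 0 ∨ ρ k - ρ k₀ ≤ -α := by
    have hev : ∀ᶠ α : ℝ in nhdsWithin 0 (Set.Ioi 0),
        ∀ k ∈ T.erase k₀, a k = 0 ∨ ρ k - ρ k₀ ≤ -α := by
      refine (eventually_all_finset _).2 fun k hk => ?_
      rcases h k (Finset.mem_of_mem_erase hk) (Finset.ne_of_mem_erase hk) with h | h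
      · exact Eventually.of_forall fun _ => Or.inl h
      · have : ∀ᶠ α : ℝ in nhds 0, α < ρ k₀ - ρ k := eventually_lt_nhds (sub_pos.2 h)
        filter_upwards [nhdsWithin_le_nhds this] with α hα
        right; linarith
    obtain ⟨α, h1, h2⟩ := (hev.and self_mem_nhdsWithin).exists
    exact ⟨α, h2, h1⟩
  set R : ℝ → ℝ := fun t => ∑ k ∈ T.erase k₀, a k / a k₀ * Real.exp ((ρ k - ρ k₀) * t) with hR
  have hsum : ∀ t, ∑ k ∈ T, a k * Real.exp (ρ k * t) =
      a k₀ * Real.exp (ρ k₀ * t) * (1 + R t) := by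
    intro t
    rw [← Finset.add_sum_erase T _ hk₀, mul_add, mul_one, hR, Finset.mul_sum]
    congr 1
    refine Finset.sum_congr rfl fun k _ => ?_
    rw [sub_mul, Real.exp_sub]
    have := Real.exp_ne_zero (ρ k₀ * t)
    field_simp
  have hRO : R =O[atTop] fun t => Real.exp (-α * t) := by
    refine IsBigO.fun_sum (A := fun k t => a k / a k₀ * Real.exp ((ρ k - ρ k₀) * t)) fun k hk => ?_
    rcases hgap k hk with h0 | h0
    · simp only [h0, zero_div, zero_mul]
      exact isBigO_zero _ _
    · refine IsBigO.const_mul_left (IsBigO.of_bound 1 ?_) _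
      filter_upwards [eventually_ge_atTop 0] with t ht
      rw [one_mul, Real.norm_of_nonneg (Real.exp_pos _).le,
        Real.norm_of_nonneg (Real.exp_pos _).le, Real.exp_le_exp]
      exact mul_le_mul_of_nonneg_right h0 ht
  have hexp : Tendsto (fun t => Real.exp (-α * t)) atTop (nhds 0) :=
    Real.tendsto_exp_atBot.comp (tendsto_id.const_mul_atTop_of_neg (neg_neg_of_pos hα))
  have hR0 : Tendsto R atTop (nhds 0) := hRO.trans_tendsto hexp
  have h1R : Tendsto (fun t => 1 + R t) atTop (nhds 1) := by
    simpa using hR0.const_add 1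
  -- `log` is differentiable at `1` and vanishes there, so `log (1 + R) = O(R)` as `R → 0`.
  have hlog : (fun t => Real.log (1 + R t)) =O[atTop] R := by
    have := (Real.hasDerivAt_log one_ne_zero).isBigO_sub.comp_tendsto h1R
    simpa [Function.comp_def] using this
  refine ⟨α, hα, (hlog.trans hRO).congr' ?_ EventuallyEq.rfl⟩
  filter_upwards [h1R.eventually (lt_mem_nhds zero_lt_one)] with t ht
  have e1 : 0 < Real.exp (ρ k₀ * t) := Real.exp_pos _
  rw [hsum t, Real.log_mul (mul_pos ha e1).ne' ht.ne', Real.log_mul ha.ne' e1.ne', Real.log_exp]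
  ring

/-- After cancelling the common part, two sets of equal size remain, and every rate in one lies
below every rate in the other. -/
lemma sum_lt_sum_of_dominant {ι : Type*} [DecidableEq ι] {ρ : ι → ℝ} {I I₀ : Finset ι}
    (hc : I.card = I₀.card) (hne : I ≠ I₀) (h : ∀ j ∈ I, j ∉ I₀ → ∀ i ∈ I₀, ρ j < ρ i) :
    ∑ i ∈ I, ρ i < ∑ i ∈ I₀, ρ i := by
  have h1 := Finset.sum_inter_add_sum_sdiff I I₀ ρ
  have h2 := Finset.sum_inter_add_sum_sdiff I₀ I ρ
  rw [Finset.inter_comm] at h2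
  have hcard : (I \ I₀).card = (I₀ \ I).card := by
    have a1 := Finset.card_sdiff_add_card_inter I I₀
    have a2 := Finset.card_sdiff_add_card_inter I₀ I
    rw [Finset.inter_comm] at a2
    omega
  have hne1 : (I \ I₀).Nonempty := by
    rw [Finset.sdiff_nonempty]
    exact fun hsub => hne (Finset.eq_of_subset_of_card_le hsub hc.ge)
  obtain ⟨j, hj, hmax⟩ := Finset.exists_max_image (I \ I₀) ρ hne1
  rw [Finset.mem_sdiff] at hj
  have hne2 : (I₀ \ I).Nonempty := by rw [← Finset.card_pos, ← hcard]; exact hne1.card_pos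
  have s1 : ∑ i ∈ I \ I₀, ρ i ≤ (I \ I₀).card • ρ j := Finset.sum_le_card_nsmul _ _ _ hmax
  have s2 : (I₀ \ I).card • ρ j < ∑ i ∈ I₀ \ I, ρ i := by
    rw [← Finset.sum_const]
    exact Finset.sum_lt_sum_of_nonempty hne2 fun i hi =>
      h j hj.1 hj.2 i (Finset.mem_sdiff.1 hi).1
  rw [hcard] at s1
  linarith

/-- Expanding the products, each subset contributes one exponential whose rate is the sum of its
node rates. A competing subset either contains a node of weight zero or has a strictly smaller total
rate. -/
lemma expClose_log_hsum {ι : Type*} [Fintype ι] [DecidableEq ι] {ζ η : ι → ℝ}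
    (hbr : ∀ i j, i ≠ j → bracket ζ η i j ≠ 0) (w ρ : ι → ℝ) {I₀ : Finset ι} {l : ℕ}
    (hc : I₀.card = l) (hw : ∀ i ∈ I₀, 0 < w i)
    (hdom : ∀ j ∉ I₀, w j = 0 ∨ ∀ i ∈ I₀, ρ j < ρ i) :
    ExpCloseTop (fun t => Real.log (hsum ζ η Finset.univ l fun i => w i * Real.exp (ρ i * t)))
      (fun t => (∑ i ∈ I₀, ρ i) * t + Real.log ((∏ i ∈ I₀, w i) * discr ζ η I₀)) := by
  have key := expClose_log_sum ((Finset.univ : Finset ι).powersetCard l)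
    (fun I => (∏ i ∈ I, w i) * discr ζ η I) (fun I => ∑ i ∈ I, ρ i) (k₀ := I₀)
    (Finset.mem_powersetCard.2 ⟨Finset.subset_univ _, hc⟩)
    (mul_pos (Finset.prod_pos hw) (discr_pos hbr _)) (fun I hI hne => ?_)
  · convert key using 4
    refine Finset.sum_congr rfl fun I _ => ?_
    rw [Finset.prod_mul_distrib, Finset.sum_mul, Real.exp_sum]
    ring
  · by_cases h : ∀ j ∈ I, j ∉ I₀ → ∀ i ∈ I₀, ρ j < ρ i
    · exact Or.inr (sum_lt_sum_of_dominant ((Finset.mem_powersetCard.1 hI).2.trans hc.symm) hne h)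
    · push Not at h
      obtain ⟨j, hj, hj0, i, hi, hij⟩ := h
      left
      rcases hdom j hj0 with h0 | h0
      · rw [Finset.prod_eq_zero hj h0, zero_mul]
      · exact absurd (h0 i hi) hij.not_gt

end ExpClose

/-! ### Dominant subsets in the explicit solution -/

section HeightAsymptotics

variable {K : ℕ}

/-- The weights at time `t`. -/
def evolve (ζ b : Fin K → ℝ) (t : ℝ) (j : Fin K) : ℝ := b j * Real.exp (2 * t / ζ j)

lemma evolve_pos {ζ b : Fin K → ℝ} (hb : ∀ j, 0 < b j) (t : ℝ) (j : Fin K) :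
    0 < evolve ζ b t j := mul_pos (hb j) (Real.exp_pos _)

/-- The growth rates of the weights of the nodes. -/
def nodeRate (ζ : Fin K → ℝ) (i : Fin (K + 1)) : ℝ := 2 * nodeE K i / nodeZ ζ i

lemma nodeRate_strictAnti {ζ : Fin K → ℝ} (hζ : ∀ j, 0 < ζ j) (hmono : StrictMono ζ) :
    StrictAnti (nodeRate ζ) := by
  intro i j hij
  obtain ⟨i, rfl⟩ := Fin.exists_castSucc_eq.2 (hij.trans_le (Fin.le_last j)).ne
  induction j using Fin.lastCases with
  | last => simpa [nodeRate] using hζ i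
  | cast j =>
    simp only [nodeRate, nodeE_castSucc, nodeZ_castSucc, mul_one]
    exact div_lt_div_of_pos_left two_pos (hζ i) (hmono (by simpa using hij))

lemma tauWeight_evolve (ζ b : Fin K → ℝ) (c : ℝ) (e : ℕ → ℝ) (t : ℝ) (k : ℕ) (i : Fin (K + 1)) :
    tauWeight ζ (evolve ζ b t) c e k i =
      tauWeight ζ b c e k i * Real.exp (nodeRate ζ i * t) := by
  rw [tauWeight, tauWeight, div_mul_eq_mul_div]
  congr 1
  induction i using Fin.lastCases with
  | last => simp [nodeRate]
  | cast j => simp [nodeRate, evolve, div_mul_eq_mul_div]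

/-- `I` is the set of the `l` nodes with the largest rates among those on which the factor `f` does
not vanish. -/
structure Dominant (ρ f : Fin (K + 1) → ℝ) (l : ℕ) (I : Finset (Fin (K + 1))) : Prop where
  card : I.card = l
  pos : ∀ i ∈ I, 0 < f i
  dom : ∀ j ∉ I, f j = 0 ∨ ∀ i ∈ I, ρ j < ρ i

/-- The extra factor in `numSum`. -/
def numFactor (K k : ℕ) (i : Fin (K + 1)) : ℝ := if Even k then nodeE K i else 1

/-- The extra factor in `denSum`. -/
def denFactor (ζ : Fin K → ℝ) (k : ℕ) (i : Fin (K + 1)) : ℝ :=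
  if Even k then nodeZ ζ i else nodeZ ζ i * nodeE K i

/-- The coefficient of the term belonging to `I`. -/
def tauCoeff (ζ b : Fin K → ℝ) (c : ℝ) (e : ℕ → ℝ) (k : ℕ) (f : Fin (K + 1) → ℝ)
    (I : Finset (Fin (K + 1))) : ℝ :=
  (∏ i ∈ I, tauWeight ζ b c e k i * f i) * discr (nodeZ ζ) (nodeE K) I

lemma expClose_log_tau {ζ b : Fin K → ℝ} {c : ℝ} {e : ℕ → ℝ} (hζ : ∀ j, 0 < ζ j)
    (hmono : StrictMono ζ) (hb : ∀ j, 0 < b j) (hc : 0 < c) (he : ∀ a, 0 < e a) (σ : ℝ) {k l : ℕ}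
    {f : Fin (K + 1) → ℝ} {I : Finset (Fin (K + 1))}
    (hI : Dominant (fun i => σ * nodeRate ζ i) f l I) :
    ExpCloseTop (fun t => Real.log (hsum (nodeZ ζ) (nodeE K) Finset.univ l
        fun i => tauWeight ζ (evolve ζ b (σ * t)) c e k i * f i))
      (fun t => (∑ i ∈ I, σ * nodeRate ζ i) * t + Real.log (tauCoeff ζ b c e k f I)) := by
  have := expClose_log_hsum (node_bracket_ne_zero hmono.injective)
    (fun i => tauWeight ζ b c e k i * f i) (fun i => σ * nodeRate ζ i) hI.card
    (fun i hi => mul_pos (tauWeight_pos hζ hb hc he k i) (hI.pos i hi))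
    (fun j hj => (hI.dom j hj).imp (fun h => by rw [h, mul_zero]) id)
  unfold tauCoeff
  convert this using 5 with t i
  rw [tauWeight_evolve, mul_right_comm, ← mul_assoc, mul_comm (nodeRate ζ _) σ]

lemma tauCoeff_pos {ζ b : Fin K → ℝ} {c : ℝ} {e : ℕ → ℝ} (hζ : ∀ j, 0 < ζ j)
    (hmono : StrictMono ζ) (hb : ∀ j, 0 < b j) (hc : 0 < c) (he : ∀ a, 0 < e a) (k : ℕ)
    {f : Fin (K + 1) → ℝ} {I : Finset (Fin (K + 1))} (hf : ∀ i ∈ I, 0 < f i) :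
    0 < tauCoeff ζ b c e k f I :=
  mul_pos (Finset.prod_pos fun i hi => mul_pos (tauWeight_pos hζ hb hc he k i) (hf i hi))
    (discr_pos (node_bracket_ne_zero hmono.injective) _)

/-- The logarithm of a height splits into four logarithms of subset sums, each with its own dominant
set. `hr` and `hA` record what survives of the rates and the coefficients. The sign `σ` treats `t →
-∞` as `t → +∞` in reversed time. -/
lemma expClose_position {m : Fin (2 * K + 1) → ℝ} {ζ b : Fin K → ℝ} {c : ℝ} (hm : ∀ i, 0 < m i)
    (hζ : ∀ j, 0 < ζ j) (hmono : StrictMono ζ) (hb : ∀ j, 0 < b j) (hc : 0 < c) (σ : ℝ)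
    (a : Fin (2 * K + 1)) {I₁ I₀ J₁ J₀ : Finset (Fin (K + 1))}
    (hI₁ : Dominant (fun i => σ * nodeRate ζ i) (numFactor K (a + 1)) ((a + 1 + 1) / 2) I₁)
    (hI₀ : Dominant (fun i => σ * nodeRate ζ i) (numFactor K a) ((a + 1) / 2) I₀)
    (hJ₁ : Dominant (fun i => σ * nodeRate ζ i) (denFactor ζ (a + 1)) ((a + 1) / 2) J₁)
    (hJ₀ : Dominant (fun i => σ * nodeRate ζ i) (denFactor ζ a) (a / 2) J₀)
    {r A : ℝ} (hr : ∑ i ∈ I₁, nodeRate ζ i + ∑ i ∈ I₀, nodeRate ζ i =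
      r + (∑ i ∈ J₁, nodeRate ζ i + ∑ i ∈ J₀, nodeRate ζ i))
    (hA : tauCoeff ζ b c (eSeq m) (a + 1) (numFactor K (a + 1)) I₁ *
        tauCoeff ζ b c (eSeq m) a (numFactor K a) I₀ =
      A * (tauCoeff ζ b c (eSeq m) (a + 1) (denFactor ζ (a + 1)) J₁ *
        tauCoeff ζ b c (eSeq m) a (denFactor ζ a) J₀)) :
    ExpCloseTop (fun t => fromRight (position m ζ (evolve ζ b (σ * t)) c) a)
      (fun t => r * (σ * t) +
        Real.log ((∏ i ∈ Finset.range a, eSeq m i) * A / fromRight m a)) := by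
  have he := eSeq_pos hm
  have h1 := expClose_log_tau hζ hmono hb hc he σ (k := a + 1) hI₁
  have h2 := expClose_log_tau hζ hmono hb hc he σ (k := a) hI₀
  have h3 := expClose_log_tau hζ hmono hb hc he σ (k := a + 1) hJ₁
  have h4 := expClose_log_tau hζ hmono hb hc he σ (k := a) hJ₀
  have p1 := tauCoeff_pos hζ hmono hb hc he (a + 1) hI₁.pos
  have p2 := tauCoeff_pos hζ hmono hb hc he a hI₀.pos
  have p3 := tauCoeff_pos hζ hmono hb hc he (a + 1) hJ₁.pos
  have p4 := tauCoeff_pos hζ hmono hb hc he a hJ₀.pos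
  have hE : 0 < ∏ i ∈ Finset.range a, eSeq m i := Finset.prod_pos fun i _ => he i
  have hma : 0 < fromRight m a := hm _
  have hA' : A = tauCoeff ζ b c (eSeq m) (a + 1) (numFactor K (a + 1)) I₁ *
      tauCoeff ζ b c (eSeq m) a (numFactor K a) I₀ /
      (tauCoeff ζ b c (eSeq m) (a + 1) (denFactor ζ (a + 1)) J₁ *
        tauCoeff ζ b c (eSeq m) a (denFactor ζ a) J₀) := by
    rw [hA, mul_div_cancel_right₀ _ (mul_pos p3 p4).ne']
  have key := ((h1.add h2).sub (h3.add h4)).add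
    (ExpCloseTop.refl fun _ => Real.log (∏ i ∈ Finset.range a, eSeq m i) -
      Real.log (fromRight m a))
  convert key using 2 with t t
  · have hb' := evolve_pos (ζ := ζ) hb (σ * t)
    have hinj := hmono.injective
    have u1 := numTau_pos hζ hinj hb' hc he (show (a : ℕ) + 1 ≤ 2 * K + 1 by omega)
    have u0 := numTau_pos hζ hinj hb' hc he (show (a : ℕ) ≤ 2 * K + 1 by omega)
    have v1 := denTau_pos hζ hinj hb' hc he (show (a : ℕ) + 1 ≤ 2 * K + 1 by omega)
    have v0 := denTau_pos hζ hinj hb' hc he (show (a : ℕ) ≤ 2 * K + 1 by omega)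
    have e1 : fromRight m a = m a.rev := rfl
    rw [fromRight, position, Fin.rev_rev, height, ← e1,
      Real.log_div (by positivity) hma.ne', Real.log_div (by positivity) (by positivity),
      Real.log_mul hE.ne' (by positivity), Real.log_mul u1.ne' u0.ne', Real.log_mul v1.ne' v0.ne']
    simp only [numTau, denTau, numSum, denSum, numFactor, denFactor]
    ring
  · rw [hA', Real.log_div (by positivity) hma.ne', Real.log_mul hE.ne' (by positivity),
      Real.log_div (by positivity) (by positivity), Real.log_mul p1.ne' p2.ne',
      Real.log_mul p3.ne' p4.ne']
    simp only [← Finset.mul_sum]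
    linear_combination (-(σ * t)) * hr

end HeightAsymptotics

/-! ### The dominant sets for each peakon -/

section ExplicitAsymptotics

variable {K : ℕ}

/-- Rates decrease along the nodes, infinity being last with rate `0`, so initial segments dominate
in forward time. -/
lemma dominant_of_lower {ζ : Fin K → ℝ} (hζ : ∀ j, 0 < ζ j) (hmono : StrictMono ζ)
    {f : Fin (K + 1) → ℝ} {l : ℕ} {I : Finset (Fin (K + 1))} (hc : I.card = l)
    (hf : ∀ i ∈ I, 0 < f i) (h : ∀ j ∉ I, ∀ i ∈ I, i < j) :
    Dominant (fun i => 1 * nodeRate ζ i) f l I where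
  card := hc
  pos := hf
  dom j hj := Or.inr fun i hi => by
    simpa using nodeRate_strictAnti hζ hmono (h j hj i hi)

/-- In reversed time final segments dominate; they omit infinity when the factor `η` annihilates it.
-/
lemma dominant_of_upper {ζ : Fin K → ℝ} (hζ : ∀ j, 0 < ζ j) (hmono : StrictMono ζ)
    {f : Fin (K + 1) → ℝ} {l : ℕ} {I : Finset (Fin (K + 1))} (hc : I.card = l)
    (hf : ∀ i ∈ I, 0 < f i) (h : ∀ j ∉ I, f j = 0 ∨ ∀ i ∈ I, j < i) :
    Dominant (fun i => -1 * nodeRate ζ i) f l I where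
  card := hc
  pos := hf
  dom j hj := (h j hj).imp id fun h i hi => by
    simpa using nodeRate_strictAnti hζ hmono (h i hi)

lemma numFactor_even (j : ℕ) : numFactor K (2 * j) = nodeE K := by ext; simp [numFactor]

lemma numFactor_odd (j : ℕ) : numFactor K (2 * j + 1) = fun _ => 1 := by ext; simp [numFactor]

lemma denFactor_even (ζ : Fin K → ℝ) (j : ℕ) : denFactor ζ (2 * j) = nodeZ ζ := by
  ext; simp [denFactor]

lemma denFactor_odd (ζ : Fin K → ℝ) (j : ℕ) :
    denFactor ζ (2 * j + 1) = fun i => nodeZ ζ i * nodeE K i := by ext; simp [denFactor]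

lemma nodeE_of_lt {i j : Fin (K + 1)} (h : i < j) : nodeE K i = 1 :=
  nodeE_of_mem (Finset.mem_erase.2 ⟨(h.trans_le (Fin.le_last j)).ne, Finset.mem_univ i⟩)

/-- The part of `tauCoeff` without the extra factor. -/
def tauBase (ζ b : Fin K → ℝ) (c : ℝ) (e : ℕ → ℝ) (k : ℕ) (I : Finset (Fin (K + 1))) : ℝ :=
  (∏ i ∈ I, tauWeight ζ b c e k i) * discr (nodeZ ζ) (nodeE K) I

lemma tauCoeff_eq (ζ b : Fin K → ℝ) (c : ℝ) (e : ℕ → ℝ) (k : ℕ) (f : Fin (K + 1) → ℝ)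
    (I : Finset (Fin (K + 1))) :
    tauCoeff ζ b c e k f I = tauBase ζ b c e k I * ∏ i ∈ I, f i := by
  rw [tauCoeff, tauBase, Finset.prod_mul_distrib]; ring

lemma tauBase_insert (ζ b : Fin K → ℝ) (c : ℝ) (e : ℕ → ℝ) (k : ℕ) {s : Fin (K + 1)}
    {I : Finset (Fin (K + 1))} (hs : s ∉ I) :
    tauBase ζ b c e k (insert s I) = tauBase ζ b c e k I *
      (tauWeight ζ b c e k s * ∏ i ∈ I, bracket (nodeZ ζ) (nodeE K) s i ^ 2) := by
  rw [tauBase, tauBase, Finset.prod_insert hs, discr_insert _ _ hs]; ring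

lemma prod_nodeE_eq_one {I : Finset (Fin (K + 1))} (h : ∀ i ∈ I, i < Fin.last K) :
    ∏ i ∈ I, nodeE K i = 1 :=
  Finset.prod_eq_one fun i hi => nodeE_of_lt (h i hi)

lemma prod_bracket_last (ζ : Fin K → ℝ) {I : Finset (Fin (K + 1))} (h : ∀ i ∈ I, i < Fin.last K) :
    ∏ i ∈ I, bracket (nodeZ ζ) (nodeE K) (Fin.last K) i ^ 2 = 1 :=
  Finset.prod_eq_one fun i hi => by simp [bracket, nodeE_of_lt (h i hi)]

variable {m : Fin (2 * K + 1) → ℝ} {ζ b : Fin K → ℝ} {c : ℝ}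

/-- The four sets differ only in that the first contains `s`, so its rate and weight survive. Taking
`s` over all nodes, infinity included, covers the leftmost peakon, whose rate is `0`. -/
lemma top_odd (hm : ∀ i, 0 < m i) (hζ : ∀ j, 0 < ζ j) (hmono : StrictMono ζ) (hb : ∀ j, 0 < b j)
    (hc : 0 < c) (s : Fin (K + 1)) :
    ExpCloseTop (fun t => fromRight (position m ζ (evolve ζ b (1 * t)) c) ⟨2 * s, by omega⟩)
      (fun t => nodeRate ζ s * (1 * t) + Real.log ((∏ i ∈ Finset.range (2 * s), eSeq m i) *
        (tauWeight ζ b c (eSeq m) (2 * s + 1) s *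
          (∏ i ∈ Finset.Iio s, bracket (nodeZ ζ) (nodeE K) s i ^ 2) /
            (∏ i ∈ Finset.Iio s, nodeZ ζ i) ^ 2) / fromRight m ⟨2 * s, by omega⟩)) := by
  have hI : insert s (Finset.Iio s) = Finset.Iic s := Finset.Iio_insert s
  have hs : s ∉ Finset.Iio s := by simp
  have hfin : ∀ i ∈ Finset.Iio s, i < Fin.last K := fun i hi =>
    (Finset.mem_Iio.1 hi).trans_le (Fin.le_last s)
  have hZ : 0 < ∏ i ∈ Finset.Iio s, nodeZ ζ i := Finset.prod_pos fun i _ => nodeZ_pos hζ i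
  refine expClose_position hm hζ hmono hb hc 1 ⟨2 * s, by omega⟩ (I₁ := Finset.Iic s)
    (I₀ := Finset.Iio s) (J₁ := Finset.Iio s) (J₀ := Finset.Iio s) ?_ ?_ ?_ ?_ ?_ ?_
  · refine dominant_of_lower hζ hmono ?_ ?_ ?_
    · rw [Fin.card_Iic]; simp only; omega
    · intro i _; simp only [numFactor_odd]; exact one_pos
    · intro j hj i hi
      simp only [Finset.mem_Iic, not_le] at hi hj
      exact hi.trans_lt hj
  · refine dominant_of_lower hζ hmono ?_ ?_ ?_
    · rw [Fin.card_Iio]; simp only; omega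
    · intro i hi; simp only [numFactor_even, nodeE_of_lt (hfin i hi)]; exact one_pos
    · intro j hj i hi
      simp only [Finset.mem_Iio, not_lt] at hi hj
      exact hi.trans_le hj
  · refine dominant_of_lower hζ hmono ?_ ?_ ?_
    · rw [Fin.card_Iio]; simp only; omega
    · intro i hi
      simp only [denFactor_odd, nodeE_of_lt (hfin i hi), mul_one]; exact nodeZ_pos hζ i
    · intro j hj i hi
      simp only [Finset.mem_Iio, not_lt] at hi hj
      exact hi.trans_le hj
  · refine dominant_of_lower hζ hmono ?_ ?_ ?_
    · rw [Fin.card_Iio]; simp only; omega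
    · intro i hi
      simp only [denFactor_even]; exact nodeZ_pos hζ i
    · intro j hj i hi
      simp only [Finset.mem_Iio, not_lt] at hi hj
      exact hi.trans_le hj
  · rw [← hI, Finset.sum_insert hs]; ring
  · simp only [tauCoeff_eq, numFactor_odd, numFactor_even, denFactor_odd, denFactor_even,
      Finset.prod_mul_distrib, prod_nodeE_eq_one hfin, Finset.prod_const_one, ← hI,
      tauBase_insert _ _ _ _ _ hs]
    field_simp

/-- Only the last denominator set lacks `s`. Its level is `k - 1`, so `Γ` stops at `k - 1`, and the
factor `ζ` of the larger denominator set leaves the extra `ζ_j`. -/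
lemma top_even (hm : ∀ i, 0 < m i) (hζ : ∀ j, 0 < ζ j) (hmono : StrictMono ζ) (hb : ∀ j, 0 < b j)
    (hc : 0 < c) (j : Fin K) :
    ExpCloseTop (fun t => fromRight (position m ζ (evolve ζ b (1 * t)) c) ⟨2 * j + 1, by omega⟩)
      (fun t => nodeRate ζ j.castSucc * (1 * t) +
        Real.log ((∏ i ∈ Finset.range (2 * j + 1), eSeq m i) *
        (tauWeight ζ b c (eSeq m) (2 * j + 1) j.castSucc *
          (∏ i ∈ Finset.Iio j.castSucc, bracket (nodeZ ζ) (nodeE K) j.castSucc i ^ 2) /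
            ((∏ i ∈ Finset.Iio j.castSucc, nodeZ ζ i) ^ 2 * ζ j)) /
              fromRight m ⟨2 * j + 1, by omega⟩)) := by
  set s := j.castSucc with hsj
  have hI : insert s (Finset.Iio s) = Finset.Iic s := Finset.Iio_insert s
  have hs : s ∉ Finset.Iio s := by simp
  have hsl : s < Fin.last K := Fin.castSucc_lt_last j
  have hfin : ∀ i ∈ Finset.Iio s, i < Fin.last K := fun i hi =>
    (Finset.mem_Iio.1 hi).trans_le (Fin.le_last s)
  have hfin' : ∀ i ∈ insert s (Finset.Iio s), i < Fin.last K := fun i hi => by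
    rw [hI, Finset.mem_Iic] at hi; exact hi.trans_lt hsl
  have hZ : 0 < ∏ i ∈ Finset.Iio s, nodeZ ζ i := Finset.prod_pos fun i _ => nodeZ_pos hζ i
  have hZs : nodeZ ζ s = ζ j := nodeZ_castSucc ζ j
  have hval : (s : ℕ) = j := rfl
  have e2 : 2 * (j : ℕ) + 1 + 1 = 2 * (j + 1) := by ring
  have hlow : ∀ j ∉ Finset.Iic s, ∀ i ∈ Finset.Iic s, i < j := by
    intro j hj i hi
    simp only [Finset.mem_Iic, not_le] at hi hj
    exact hi.trans_lt hj
  have hζj := hζ j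
  refine expClose_position hm hζ hmono hb hc 1 ⟨2 * j + 1, by omega⟩ (I₁ := Finset.Iic s)
    (I₀ := Finset.Iic s) (J₁ := Finset.Iic s) (J₀ := Finset.Iio s) ?_ ?_ ?_ ?_ ?_ ?_
  · refine dominant_of_lower hζ hmono ?_ ?_ hlow
    · rw [Fin.card_Iic]; simp only; omega
    · intro i hi
      simp only [e2, numFactor_even, nodeE_of_lt (hfin' i (hI ▸ hi))]; exact one_pos
  · refine dominant_of_lower hζ hmono ?_ ?_ hlow
    · rw [Fin.card_Iic]; simp only; omega
    · intro i hi; simp only [numFactor_odd]; exact one_pos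
  · refine dominant_of_lower hζ hmono ?_ ?_ hlow
    · rw [Fin.card_Iic]; simp only; omega
    · intro i hi
      simp only [e2, denFactor_even]; exact nodeZ_pos hζ i
  · refine dominant_of_lower hζ hmono ?_ ?_ ?_
    · rw [Fin.card_Iio]; simp only; omega
    · intro i hi
      simp only [denFactor_odd, nodeE_of_lt (hfin i hi), mul_one]; exact nodeZ_pos hζ i
    · intro j hj i hi
      simp only [Finset.mem_Iio, not_lt] at hi hj
      exact hi.trans_le hj
  · rw [← hI, Finset.sum_insert hs]; ring
  · simp only [e2]
    simp only [tauCoeff_eq, numFactor_odd, numFactor_even, denFactor_odd, denFactor_even,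
      Finset.prod_mul_distrib, ← hI, prod_nodeE_eq_one hfin, prod_nodeE_eq_one hfin',
      Finset.prod_const_one, tauBase_insert _ _ _ _ _ hs, Finset.prod_insert hs, hZs]
    field_simp

/-- Infinity belongs to the odd numerator set and the even denominator set but to neither of the
other two, so the weight `c` cancels. -/
lemma bot_odd (hm : ∀ i, 0 < m i) (hζ : ∀ j, 0 < ζ j) (hmono : StrictMono ζ) (hb : ∀ j, 0 < b j)
    (hc : 0 < c) (j : Fin K) :
    ExpCloseTop (fun t => fromRight (position m ζ (evolve ζ b (-1 * t)) c) ⟨2 * j + 2, by omega⟩)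
      (fun t => nodeRate ζ j.rev.castSucc * (-1 * t) +
        Real.log ((∏ i ∈ Finset.range (2 * j + 2), eSeq m i) *
        (tauWeight ζ b c (eSeq m) (2 * j + 2) j.rev.castSucc *
          (∏ i ∈ Finset.Ioo j.rev.castSucc (Fin.last K),
            bracket (nodeZ ζ) (nodeE K) j.rev.castSucc i ^ 2) /
            ((∏ i ∈ Finset.Ioo j.rev.castSucc (Fin.last K), nodeZ ζ i) ^ 2 * ζ j.rev)) /
              fromRight m ⟨2 * j + 2, by omega⟩)) := by
  set s := j.rev.castSucc with hsj
  have hsl : s < Fin.last K := Fin.castSucc_lt_last j.rev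
  have i1 : insert s (Finset.Ioo s (Fin.last K)) = Finset.Ico s (Fin.last K) :=
    Finset.Ioo_insert_left hsl
  have i2 : insert (Fin.last K) (Finset.Ioo s (Fin.last K)) = Finset.Ioc s (Fin.last K) :=
    Finset.Ioo_insert_right hsl
  have i3 : insert (Fin.last K) (Finset.Ico s (Fin.last K)) = Finset.Icc s (Fin.last K) :=
    Finset.Ico_insert_right hsl.le
  have n1 : s ∉ Finset.Ioo s (Fin.last K) := by simp
  have n2 : Fin.last K ∉ Finset.Ioo s (Fin.last K) := by simp
  have n3 : Fin.last K ∉ insert s (Finset.Ioo s (Fin.last K)) := by rw [i1]; simp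
  have hfin : ∀ i ∈ Finset.Ioo s (Fin.last K), i < Fin.last K := fun i hi =>
    (Finset.mem_Ioo.1 hi).2
  have hfin' : ∀ i ∈ insert s (Finset.Ioo s (Fin.last K)), i < Fin.last K := fun i hi => by
    rw [i1] at hi; exact (Finset.mem_Ico.1 hi).2
  have hZ : 0 < ∏ i ∈ Finset.Ioo s (Fin.last K), nodeZ ζ i :=
    Finset.prod_pos fun i _ => nodeZ_pos hζ i
  have hZs : nodeZ ζ s = ζ j.rev := nodeZ_castSucc ζ j.rev
  have hval : (s : ℕ) = K - (j + 1) := by rw [hsj, Fin.val_castSucc, Fin.val_rev]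
  have hjK := j.2
  have e2 : 2 * (j : ℕ) + 2 = 2 * (j + 1) := by ring
  have hζj := hζ j.rev
  refine expClose_position hm hζ hmono hb hc (-1) ⟨2 * j + 2, by omega⟩
    (I₁ := Finset.Icc s (Fin.last K)) (I₀ := Finset.Ico s (Fin.last K))
    (J₁ := Finset.Ico s (Fin.last K)) (J₀ := Finset.Ioc s (Fin.last K)) ?_ ?_ ?_ ?_ ?_ ?_
  · refine dominant_of_upper hζ hmono ?_ ?_ ?_
    · rw [Fin.card_Icc, Fin.val_last]; simp only; omega
    · intro i hi; simp only [e2, numFactor_odd]; exact one_pos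
    · intro i hi
      simp only [Finset.mem_Icc, not_and, not_le] at hi
      right
      intro i' hi'
      by_contra hcon
      have := hi ((Finset.mem_Icc.1 hi').1.trans (not_lt.1 hcon))
      exact absurd (Fin.le_last i) this.not_ge
  · refine dominant_of_upper hζ hmono ?_ ?_ ?_
    · rw [Fin.card_Ico, Fin.val_last]; simp only; omega
    · intro i hi
      simp only [e2, numFactor_even, nodeE_of_lt (Finset.mem_Ico.1 hi).2]; exact one_pos
    · intro i hi
      simp only [e2, numFactor_even]
      rcases (Fin.le_last i).eq_or_lt with h | h
      · left; rw [h, nodeE_last]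
      · right
        intro i' hi'
        by_contra hcon
        exact hi (Finset.mem_Ico.2 ⟨(Finset.mem_Ico.1 hi').1.trans (not_lt.1 hcon), h⟩)
  · refine dominant_of_upper hζ hmono ?_ ?_ ?_
    · rw [Fin.card_Ico, Fin.val_last]; simp only; omega
    · intro i hi
      simp only [e2, denFactor_odd, nodeE_of_lt (Finset.mem_Ico.1 hi).2, mul_one]
      exact nodeZ_pos hζ i
    · intro i hi
      simp only [e2, denFactor_odd]
      rcases (Fin.le_last i).eq_or_lt with h | h
      · left; rw [h, nodeE_last, mul_zero]
      · right
        intro i' hi'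
        by_contra hcon
        exact hi (Finset.mem_Ico.2 ⟨(Finset.mem_Ico.1 hi').1.trans (not_lt.1 hcon), h⟩)
  · refine dominant_of_upper hζ hmono ?_ ?_ ?_
    · rw [Fin.card_Ioc, Fin.val_last]; simp only; omega
    · intro i hi; simp only [e2, denFactor_even]; exact nodeZ_pos hζ i
    · intro i hi
      right
      intro i' hi'
      by_contra hcon
      exact hi (Finset.mem_Ioc.2 ⟨(Finset.mem_Ioc.1 hi').1.trans_le (not_lt.1 hcon),
        Fin.le_last i⟩)
  · rw [← i3, ← i2, ← i1, Finset.sum_insert n3, Finset.sum_insert n1, Finset.sum_insert n2]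
    ring
  · simp only [e2]
    simp only [← i3, ← i2, ← i1]
    simp only [tauCoeff_eq, numFactor_odd, numFactor_even, denFactor_odd, denFactor_even,
      Finset.prod_mul_distrib, prod_nodeE_eq_one hfin, prod_nodeE_eq_one hfin',
      Finset.prod_const_one, tauBase_insert _ _ _ _ _ n1, tauBase_insert _ _ _ _ _ n2,
      tauBase_insert _ _ _ _ _ n3, Finset.prod_insert n1, Finset.prod_insert n2,
      prod_bracket_last ζ hfin, hZs, nodeZ_last, tauWeight_last]
    have hbl : bracket (nodeZ ζ) (nodeE K) (Fin.last K) s ^ 2 = 1 := by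
      simp [bracket, nodeE_of_lt hsl]
    simp only [hbl, nodeE_of_lt hsl]
    field_simp

/-- As in the odd case infinity occurs once above and once below, so `c` cancels. The surviving
weight of `s` has level `2j + 2`, so `Γ` includes the index of this peakon itself. -/
lemma bot_even (hm : ∀ i, 0 < m i) (hζ : ∀ j, 0 < ζ j) (hmono : StrictMono ζ) (hb : ∀ j, 0 < b j)
    (hc : 0 < c) (j : Fin K) :
    ExpCloseTop (fun t => fromRight (position m ζ (evolve ζ b (-1 * t)) c) ⟨2 * j + 1, by omega⟩)
      (fun t => nodeRate ζ j.rev.castSucc * (-1 * t) +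
        Real.log ((∏ i ∈ Finset.range (2 * j + 1), eSeq m i) *
        (tauWeight ζ b c (eSeq m) (2 * j + 2) j.rev.castSucc *
          (∏ i ∈ Finset.Ioo j.rev.castSucc (Fin.last K),
            bracket (nodeZ ζ) (nodeE K) j.rev.castSucc i ^ 2) /
            (∏ i ∈ Finset.Ioo j.rev.castSucc (Fin.last K), nodeZ ζ i) ^ 2) /
              fromRight m ⟨2 * j + 1, by omega⟩)) := by
  set s := j.rev.castSucc with hsj
  have hsl : s < Fin.last K := Fin.castSucc_lt_last j.rev
  have i1 : insert s (Finset.Ioo s (Fin.last K)) = Finset.Ico s (Fin.last K) :=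
    Finset.Ioo_insert_left hsl
  have i2 : insert (Fin.last K) (Finset.Ioo s (Fin.last K)) = Finset.Ioc s (Fin.last K) :=
    Finset.Ioo_insert_right hsl
  have n1 : s ∉ Finset.Ioo s (Fin.last K) := by simp
  have n2 : Fin.last K ∉ Finset.Ioo s (Fin.last K) := by simp
  have hfin : ∀ i ∈ Finset.Ioo s (Fin.last K), i < Fin.last K := fun i hi =>
    (Finset.mem_Ioo.1 hi).2
  have hfin' : ∀ i ∈ insert s (Finset.Ioo s (Fin.last K)), i < Fin.last K := fun i hi => by
    rw [i1] at hi; exact (Finset.mem_Ico.1 hi).2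
  have hZ : 0 < ∏ i ∈ Finset.Ioo s (Fin.last K), nodeZ ζ i :=
    Finset.prod_pos fun i _ => nodeZ_pos hζ i
  have hval : (s : ℕ) = K - (j + 1) := by rw [hsj, Fin.val_castSucc, Fin.val_rev]
  have hjK := j.2
  have e2 : 2 * (j : ℕ) + 1 + 1 = 2 * (j + 1) := by ring
  refine expClose_position hm hζ hmono hb hc (-1) ⟨2 * j + 1, by omega⟩
    (I₁ := Finset.Ico s (Fin.last K)) (I₀ := Finset.Ioc s (Fin.last K))
    (J₁ := Finset.Ioc s (Fin.last K)) (J₀ := Finset.Ioo s (Fin.last K)) ?_ ?_ ?_ ?_ ?_ ?_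
  · refine dominant_of_upper hζ hmono ?_ ?_ ?_
    · rw [Fin.card_Ico, Fin.val_last]; simp only; omega
    · intro i hi
      simp only [e2, numFactor_even, nodeE_of_lt (Finset.mem_Ico.1 hi).2]; exact one_pos
    · intro i hi
      simp only [e2, numFactor_even]
      rcases (Fin.le_last i).eq_or_lt with h | h
      · left; rw [h, nodeE_last]
      · right
        intro i' hi'
        by_contra hcon
        exact hi (Finset.mem_Ico.2 ⟨(Finset.mem_Ico.1 hi').1.trans (not_lt.1 hcon), h⟩)
  · refine dominant_of_upper hζ hmono ?_ ?_ ?_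
    · rw [Fin.card_Ioc, Fin.val_last]; simp only; omega
    · intro i hi; simp only [numFactor_odd]; exact one_pos
    · intro i hi
      right
      intro i' hi'
      by_contra hcon
      exact hi (Finset.mem_Ioc.2 ⟨(Finset.mem_Ioc.1 hi').1.trans_le (not_lt.1 hcon),
        Fin.le_last i⟩)
  · refine dominant_of_upper hζ hmono ?_ ?_ ?_
    · rw [Fin.card_Ioc, Fin.val_last]; simp only; omega
    · intro i hi; simp only [e2, denFactor_even]; exact nodeZ_pos hζ i
    · intro i hi
      right
      intro i' hi'
      by_contra hcon
      exact hi (Finset.mem_Ioc.2 ⟨(Finset.mem_Ioc.1 hi').1.trans_le (not_lt.1 hcon),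
        Fin.le_last i⟩)
  · refine dominant_of_upper hζ hmono ?_ ?_ ?_
    · rw [Fin.card_Ioo, Fin.val_last]; simp only; omega
    · intro i hi
      simp only [denFactor_odd, nodeE_of_lt (Finset.mem_Ioo.1 hi).2, mul_one]
      exact nodeZ_pos hζ i
    · intro i hi
      simp only [denFactor_odd]
      rcases (Fin.le_last i).eq_or_lt with h | h
      · left; rw [h, nodeE_last, mul_zero]
      · right
        intro i' hi'
        by_contra hcon
        exact hi (Finset.mem_Ioo.2 ⟨(Finset.mem_Ioo.1 hi').1.trans_le (not_lt.1 hcon), h⟩)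
  · rw [← i2, ← i1, Finset.sum_insert n1, Finset.sum_insert n2]
    ring
  · simp only [e2]
    simp only [← i2, ← i1]
    simp only [tauCoeff_eq, numFactor_odd, numFactor_even, denFactor_odd, denFactor_even,
      Finset.prod_mul_distrib, prod_nodeE_eq_one hfin, prod_nodeE_eq_one hfin',
      Finset.prod_const_one, tauBase_insert _ _ _ _ _ n1, tauBase_insert _ _ _ _ _ n2,
      Finset.prod_insert n2, prod_bracket_last ζ hfin, nodeZ_last, tauWeight_last]
    field_simp

/-- In reversed time infinity has the largest rate, `0`, so the sum over single nodes tends to `c`.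
-/
lemma bot_rightmost (hm : ∀ i, 0 < m i) (hζ : ∀ j, 0 < ζ j) (hmono : StrictMono ζ)
    (hb : ∀ j, 0 < b j) (hc : 0 < c) :
    ExpCloseTop (fun t => fromRight (position m ζ (evolve ζ b (-1 * t)) c) 0)
      (fun _ => Real.log (c / fromRight m 0)) := by
  have key := expClose_position hm hζ hmono hb hc (-1) (0 : Fin (2 * K + 1))
    (I₁ := {Fin.last K}) (I₀ := ∅) (J₁ := ∅) (J₀ := ∅) (r := 0) (A := c) ?_ ?_ ?_ ?_ ?_ ?_
  · simpa using key
  · refine dominant_of_upper hζ hmono (by simp) ?_ ?_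
    · intro i hi; simp [numFactor]
    · intro i hi
      right
      intro i' hi'
      rw [Finset.mem_singleton] at hi hi'
      rw [hi']
      exact (Fin.le_last i).lt_of_ne hi
  · exact dominant_of_upper hζ hmono (by simp) (by simp) (by simp)
  · exact dominant_of_upper hζ hmono (by simp) (by simp) (by simp)
  · exact dominant_of_upper hζ hmono (by simp) (by simp) (by simp)
  · simp [nodeRate]
  · simp [tauCoeff, tauWeight_last, discr, numFactor]

end ExplicitAsymptotics

/-! ### Translation into multi-index notation -/

section Constants

variable {K : ℕ}

lemma prod_range_eq_prod_Iio {n : ℕ} (f : ℕ → ℝ) (a : Fin n) :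
    ∏ i ∈ Finset.range a, f i = ∏ i ∈ Finset.Iio a, f i := by
  rw [← Nat.Iio_eq_range, ← Fin.map_valEmbedding_Iio, Finset.prod_map]
  rfl

lemma prod_range_succ_eq_prod_Iic {n : ℕ} (f : ℕ → ℝ) (a : Fin n) :
    ∏ i ∈ Finset.range (a + 1), f i = ∏ i ∈ Finset.Iic a, f i := by
  rw [← Finset.Iio_insert, Finset.prod_insert (by simp), ← prod_range_eq_prod_Iio,
    Finset.prod_range_succ, mul_comm]

lemma eSeq_val {n : ℕ} (m : Fin n → ℝ) (a : Fin n) : eSeq m a = eVec m a := dif_pos a.2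

lemma prod_range_eSeq {n : ℕ} (m : Fin n → ℝ) (a : Fin n) :
    ∏ i ∈ Finset.range a, eSeq m i = multi (eVec m) (Finset.Iio a) := by
  simp only [prod_range_eq_prod_Iio, eSeq_val, multi]

lemma tauWeight_Iio {n : ℕ} (m : Fin n → ℝ) (ζ b : Fin K → ℝ) (c : ℝ) (a : Fin n) (j : Fin K) :
    tauWeight ζ b c (eSeq m) a j.castSucc = b j / Gam (Finset.Iio a) {j} (eVec m) ζ := by
  simp only [tauWeight, Gam, nodeB, Fin.snoc_castSucc, nodeZ_castSucc, nodeE_castSucc, mul_one,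
    prod_range_eq_prod_Iio, eSeq_val, Finset.prod_singleton, add_comm]

lemma tauWeight_Iic {n : ℕ} (m : Fin n → ℝ) (ζ b : Fin K → ℝ) (c : ℝ) (a : Fin n) (j : Fin K) :
    tauWeight ζ b c (eSeq m) (a + 1) j.castSucc = b j / Gam (Finset.Iic a) {j} (eVec m) ζ := by
  simp only [tauWeight, Gam, nodeB, Fin.snoc_castSucc, nodeZ_castSucc, nodeE_castSucc, mul_one,
    prod_range_succ_eq_prod_Iic, eSeq_val, Finset.prod_singleton, add_comm (ζ j)]

lemma prod_bracket_castSucc (ζ : Fin K → ℝ) (j : Fin K) (I : Finset (Fin K)) :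
    ∏ i ∈ I.map Fin.castSuccEmb, bracket (nodeZ ζ) (nodeE K) j.castSucc i ^ 2 =
      Delta I {j} ζ ζ ^ 2 := by
  rw [Finset.prod_map, Delta, ← Finset.prod_pow]
  refine Finset.prod_congr rfl fun i _ => ?_
  simp only [bracket, Fin.coe_castSuccEmb, nodeZ_castSucc, nodeE_castSucc, Finset.prod_singleton]
  ring

lemma prod_nodeZ_castSucc (ζ : Fin K → ℝ) (I : Finset (Fin K)) :
    ∏ i ∈ I.map Fin.castSuccEmb, nodeZ ζ i = multi ζ I := by
  rw [Finset.prod_map, multi]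
  exact Finset.prod_congr rfl fun i _ => nodeZ_castSucc ζ i

lemma nodeRate_castSucc (ζ : Fin K → ℝ) (j : Fin K) : nodeRate ζ j.castSucc = 2 / ζ j := by
  simp [nodeRate]

lemma map_castSuccEmb_univ (K : ℕ) :
    (Finset.univ : Finset (Fin K)).map Fin.castSuccEmb = Finset.Iio (Fin.last K) := by
  ext i
  induction i using Fin.lastCases with
  | last => simp
  | cast j => simp

lemma multi_pos {ι : Type*} {v : ι → ℝ} (hv : ∀ i, 0 < v i) (I : Finset ι) : 0 < multi v I :=
  Finset.prod_pos fun i _ => hv i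

lemma Gam_pos {ι κ : Type*} {v : ι → ℝ} {w : κ → ℝ} (hv : ∀ i, 0 < v i) (hw : ∀ i, 0 < w i)
    (I : Finset ι) (J : Finset κ) : 0 < Gam I J v w :=
  Finset.prod_pos fun i _ => Finset.prod_pos fun j _ => add_pos (hv i) (hw j)

lemma Delta_ne_zero {ζ : Fin K → ℝ} (hinj : Function.Injective ζ) {I : Finset (Fin K)} {j : Fin K}
    (hj : j ∉ I) : Delta I {j} ζ ζ ≠ 0 :=
  Finset.prod_ne_zero_iff.2 fun i hi => by
    rw [Finset.prod_singleton, sub_ne_zero]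
    exact hinj.ne fun h => hj (h ▸ hi)

lemma eVec_pos {n : ℕ} {m : Fin n → ℝ} (hm : ∀ i, 0 < m i) (a : Fin n) : 0 < eVec m a :=
  one_div_pos.2 (pow_pos (hm _) 2)

lemma ExpCloseTop.congr {f g f' g' : ℝ → ℝ} (h : ExpCloseTop f g) (hf : ∀ t, f' t = f t)
    (hg : ∀ t, g' t = g t) : ExpCloseTop f' g' := by
  rwa [funext hf, funext hg]

end Constants

/-! ### Asymptotics of the explicit solution -/

section Asymptotics

variable {K : ℕ} {m : Fin (2 * K + 1) → ℝ} {ζ b : Fin K → ℝ} {c : ℝ}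

lemma asymptoticsTop_position (hm : ∀ i, 0 < m i) (hζ : ∀ j, 0 < ζ j) (hmono : StrictMono ζ)
    (hb : ∀ j, 0 < b j) (hc : 0 < c) :
    AsymptoticsTop m ζ b c (fun t => position m ζ (evolve ζ b t) c) := by
  have hodd : ∀ j : Fin K, ExpCloseTop
      (fun t => fromRight (position m ζ (evolve ζ b t) c) (r₁ j)) fun t =>
      2 * t / ζ j + Real.log
      (b j * multi (eVec m) (Finset.Iio (r₁ j)) * Delta (Finset.Iio j) {j} ζ ζ ^ 2 /
        (fromRight m (r₁ j) * Gam (Finset.Iic (r₁ j)) {j} (eVec m) ζ *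
          multi ζ (Finset.Iio j) ^ 2)) := by
    intro j
    refine (top_odd hm hζ hmono hb hc j.castSucc).congr (fun t => by rw [one_mul]; rfl) fun t => ?_
    · rw [one_mul, nodeRate_castSucc, div_mul_eq_mul_div]
      congr 2
      have e1 := prod_range_eSeq m (r₁ j)
      have e2 := tauWeight_Iic m ζ b c (r₁ j) j
      simp only [r₁] at e1 e2
      simp only [Fin.val_castSucc, r₁]
      rw [e1, e2, ← Fin.map_castSuccEmb_Iio, prod_bracket_castSucc, prod_nodeZ_castSucc]
      field_simp
  have heven : ∀ j : Fin K, ExpCloseTop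
      (fun t => fromRight (position m ζ (evolve ζ b t) c) (r₂ j)) fun t =>
      2 * t / ζ j + Real.log
      (b j * multi (eVec m) (Finset.Iio (r₂ j)) * Delta (Finset.Iio j) {j} ζ ζ ^ 2 /
        (fromRight m (r₂ j) * Gam (Finset.Iio (r₂ j)) {j} (eVec m) ζ *
          multi ζ (Finset.Iio j) ^ 2 * ζ j)) := by
    intro j
    refine (top_even hm hζ hmono hb hc j).congr (fun t => by rw [one_mul]; rfl) fun t => ?_
    · rw [one_mul, nodeRate_castSucc, div_mul_eq_mul_div]
      congr 2
      have e1 := prod_range_eSeq m (r₂ j)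
      have e2 := tauWeight_Iio m ζ b c (r₂ j) j
      simp only [r₂] at e1 e2
      simp only [r₂]
      rw [e1, e2, ← Fin.map_castSuccEmb_Iio, prod_bracket_castSucc, prod_nodeZ_castSucc]
      field_simp
  refine ⟨hodd, ?_, heven, fun j => ?_⟩
  · refine (top_odd hm hζ hmono hb hc (Fin.last K)).congr (fun t => by rw [one_mul]; rfl)
      fun t => ?_
    · have e1 := prod_range_eSeq m (Fin.last (2 * K))
      simp only [Fin.val_last] at e1
      simp only [nodeRate, nodeE_last, mul_zero, zero_div, zero_mul, zero_add, Fin.val_last]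
      have e2 := prod_nodeZ_castSucc ζ Finset.univ
      rw [map_castSuccEmb_univ] at e2
      rw [e1, e2, tauWeight_last, prod_bracket_last ζ fun i hi => Finset.mem_Iio.1 hi]
      congr 1
      have : (⟨2 * K, by omega⟩ : Fin (2 * K + 1)) = Fin.last (2 * K) := rfl
      rw [this]
      field_simp
  · convert (hodd j).sub (heven j) using 2 with t
    have q1 : 0 < fromRight m (r₁ j) := hm _
    have q2 : 0 < fromRight m (r₂ j) := hm _
    have q3 := multi_pos (eVec_pos hm) (Finset.Iio (r₁ j))
    have q4 := multi_pos (eVec_pos hm) (Finset.Iio (r₂ j))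
    have q5 := Delta_ne_zero hmono.injective (show j ∉ Finset.Iio j by simp)
    have q6 := Gam_pos (eVec_pos hm) hζ (Finset.Iic (r₁ j)) {j}
    have q7 := Gam_pos (eVec_pos hm) hζ (Finset.Iio (r₂ j)) {j}
    have q8 := multi_pos hζ (Finset.Iio j)
    have q9 := hb j
    have q10 := hζ j
    -- The pair formula is the difference of the two position formulas. The linear terms and, by
    -- this equality, the `Γ` factors cancel; the remaining `e` factor contributes the square of a
    -- mass.
    have hset : Finset.Iio (r₂ j) = Finset.Iic (r₁ j) := by
      ext i; simp only [Finset.mem_Iio, Finset.mem_Iic, Fin.lt_def, Fin.le_def, r₁, r₂]; omega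
    have hmul : multi (eVec m) (Finset.Iio (r₂ j)) =
        1 / fromRight m (r₁ j) ^ 2 * multi (eVec m) (Finset.Iio (r₁ j)) := by
      rw [hset, multi, ← Finset.Iio_insert, Finset.prod_insert (by simp)]; rfl
    rw [add_sub_add_left_eq_sub, ← Real.log_div (by positivity) (by positivity), hset] 
    rw [hset] at hmul
    rw [hmul]
    congr 1
    field_simp

lemma asymptoticsBot_position (hm : ∀ i, 0 < m i) (hζ : ∀ j, 0 < ζ j) (hmono : StrictMono ζ)
    (hb : ∀ j, 0 < b j) (hc : 0 < c) :
    AsymptoticsBot m ζ b c (fun t => position m ζ (evolve ζ b t) c) := by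
  have hodd : ∀ j : Fin K, ExpCloseTop
      (fun t => fromRight (position m ζ (evolve ζ b (-t)) c) (r₃ j)) fun t =>
      2 * -t / ζ j.rev + Real.log
      (b j.rev * multi (eVec m) (Finset.Iio (r₃ j)) *
          Delta (Finset.Ioi j.rev) {j.rev} ζ ζ ^ 2 /
        (fromRight m (r₃ j) * Gam (Finset.Iio (r₃ j)) {j.rev} (eVec m) ζ *
          multi ζ (Finset.Ioi j.rev) ^ 2 * ζ j.rev)) := by
    intro j
    refine (bot_odd hm hζ hmono hb hc j).congr (fun t => by rw [neg_one_mul]; rfl) fun t => ?_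
    · rw [neg_one_mul, nodeRate_castSucc, div_mul_eq_mul_div]
      congr 2
      have e1 := prod_range_eSeq m (r₃ j)
      have e2 := tauWeight_Iio m ζ b c (r₃ j) j.rev
      simp only [r₃] at e1 e2
      simp only [r₃]
      rw [e1, e2, ← Fin.map_castSuccEmb_Ioi, prod_bracket_castSucc, prod_nodeZ_castSucc]
      field_simp
  have heven : ∀ j : Fin K, ExpCloseTop
      (fun t => fromRight (position m ζ (evolve ζ b (-t)) c) (r₂ j)) fun t =>
      2 * -t / ζ j.rev + Real.log
      (b j.rev * multi (eVec m) (Finset.Iio (r₂ j)) *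
          Delta (Finset.Ioi j.rev) {j.rev} ζ ζ ^ 2 /
        (fromRight m (r₂ j) * Gam (Finset.Iic (r₂ j)) {j.rev} (eVec m) ζ *
          multi ζ (Finset.Ioi j.rev) ^ 2)) := by
    intro j
    refine (bot_even hm hζ hmono hb hc j).congr (fun t => by rw [neg_one_mul]; rfl) fun t => ?_
    · rw [neg_one_mul, nodeRate_castSucc, div_mul_eq_mul_div]
      congr 2
      have e1 := prod_range_eSeq m (r₂ j)
      have e2 := tauWeight_Iic m ζ b c (r₂ j) j.rev
      simp only [r₂] at e1 e2
      simp only [r₂]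
      rw [e1, e2, ← Fin.map_castSuccEmb_Ioi, prod_bracket_castSucc, prod_nodeZ_castSucc]
      field_simp
  refine ⟨fun j => ExpCloseTop.toBot (hodd j), ExpCloseTop.toBot ?_,
    fun j => ExpCloseTop.toBot (heven j), fun j => ExpCloseTop.toBot ?_⟩
  · simpa only [neg_one_mul] using bot_rightmost hm hζ hmono hb hc
  · convert (heven j).sub (hodd j) using 2 with t
    have q1 : 0 < fromRight m (r₃ j) := hm _
    have q2 : 0 < fromRight m (r₂ j) := hm _
    have q3 := multi_pos (eVec_pos hm) (Finset.Iio (r₂ j))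
    have q5 := Delta_ne_zero hmono.injective (show j.rev ∉ Finset.Ioi j.rev by simp)
    have q6 := Gam_pos (eVec_pos hm) hζ (Finset.Iic (r₂ j)) {j.rev}
    have q8 := multi_pos hζ (Finset.Ioi j.rev)
    have q9 := hb j.rev
    have q10 := hζ j.rev
    -- As for `t → +∞`, adjacent index ranges make the `Γ` factors of the pair equal.
    have hset : Finset.Iio (r₃ j) = Finset.Iic (r₂ j) := by
      ext i; simp only [Finset.mem_Iio, Finset.mem_Iic, Fin.lt_def, Fin.le_def, r₃, r₂]; omega
    have hmul : multi (eVec m) (Finset.Iic (r₂ j)) =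
        1 / fromRight m (r₂ j) ^ 2 * multi (eVec m) (Finset.Iio (r₂ j)) := by
      rw [multi, ← Finset.Iio_insert, Finset.prod_insert (by simp)]; rfl
    rw [add_sub_add_left_eq_sub, hset, hmul, ← Real.log_div (by positivity) (by positivity)]
    congr 1
    field_simp

end Asymptotics

/-! ### The explicit curve as the unique global solution -/

/-- The absolute values are smooth away from collisions, so the local existence theorem applies at
every ordered configuration. -/
lemma contDiffAt_velocity {n : ℕ} (m : Fin n → ℝ) {x : Fin n → ℝ} (hx : StrictMono x) :
    ContDiffAt ℝ 1 (velocity m) x := by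
  have hexp : ∀ {i k : Fin n}, i ≠ k →
      ContDiffAt ℝ 1 (fun y : Fin n → ℝ => Real.exp (-|y i - y k|)) x := by
    intro i k hik
    refine ContDiffAt.exp (ContDiffAt.neg ?_)
    exact (contDiffAt_abs (sub_ne_zero.2 (hx.injective.ne hik))).comp x
      (f := fun y : Fin n → ℝ => y i - y k)
      ((contDiff_apply ℝ ℝ i).contDiffAt.sub (contDiff_apply ℝ ℝ k).contDiffAt)
  refine contDiffAt_pi.2 fun j => ?_
  unfold velocity
  refine (contDiffAt_const.mul (ContDiffAt.sum fun k hk => contDiffAt_const.mul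
    (hexp (Finset.ne_of_mem_erase hk).symm))).add (contDiffAt_const.mul
      (ContDiffAt.sum fun i hi => ContDiffAt.sum fun k hk => contDiffAt_const.mul (hexp ?_)))
  exact ((Finset.mem_Iio.1 hi).trans (Finset.mem_Ioi.1 hk)).ne

lemma eventually_strictMono {n : ℕ} {x : Fin n → ℝ} (hx : StrictMono x) :
    ∀ᶠ y in nhds x, StrictMono y := by
  have h : ∀ᶠ y in nhds x, ∀ i k : Fin n, i < k → y i < y k := by
    refine eventually_all.2 fun i => eventually_all.2 fun k => ?_
    by_cases hik : i < k
    · filter_upwards [(continuous_apply i).continuousAt.eventually_lt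
        (continuous_apply k).continuousAt (hx hik)] with y hy _ using hy
    · exact Eventually.of_forall fun y h => absurd h hik
  filter_upwards [h] with y hy i k hik using hy i k hik

section Solution

variable {K : ℕ} {m : Fin (2 * K + 1) → ℝ} {ζ b : Fin K → ℝ} {c : ℝ}

lemma evolve_zero (ζ b : Fin K → ℝ) : evolve ζ b 0 = b := by
  ext j; simp [evolve]

lemma evolve_sub (ζ b : Fin K → ℝ) (s t : ℝ) :
    (fun j => evolve ζ b s j * Real.exp (2 * (t - s) / ζ j)) = evolve ζ b t := by
  ext j
  rw [evolve, evolve, mul_assoc, ← Real.exp_add]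
  congr 2
  ring

/-- The explicit curve is not differentiated directly: near each time it is identified with a local
solution, whose derivative is known. -/
lemma isGlobalMultipeakon_position (hm : ∀ i, 0 < m i) (hζ : ∀ j, 0 < ζ j) (hmono : StrictMono ζ)
    (hb : ∀ j, 0 < b j) (hc : 0 < c) (hmass : MassCondition m ζ) :
    IsGlobalMultipeakon m (fun t => position m ζ (evolve ζ b t) c) := by
  have hord : ∀ t, StrictMono (position m ζ (evolve ζ b t) c) := fun t =>
    strictMono_position hm hζ hmono (evolve_pos hb t) hc hmass
  have hsp : ∀ t, spectralPoly m (position m ζ (evolve ζ b t) c) =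
      (numPoly ζ (evolve ζ b t) c, denPoly ζ) := fun t =>
    spectralPoly_position hm hζ hmono.injective (evolve_pos hb t) hc
  refine ⟨hord, fun t₀ => ?_⟩
  obtain ⟨α, hα0, ε, hε, hα⟩ := (contDiffAt_velocity m
    (hord t₀)).exists_forall_mem_closedBall_exists_eq_forall_mem_Ioo_hasDerivAt₀ t₀
  have ht₀ : t₀ ∈ Set.Ioo (t₀ - ε) (t₀ + ε) := ⟨by linarith, by linarith⟩
  -- The evolution of spectral data requires ordered peakons, so the interval is shrunk until the
  -- local solution stays ordered.
  have hev : ∀ᶠ t in nhds t₀, StrictMono (α t) :=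
    (hα t₀ ht₀).continuousAt.eventually (by rw [hα0]; exact eventually_strictMono (hord t₀))
  obtain ⟨δ, hδ, hball⟩ := Metric.eventually_nhds_iff_ball.1 hev
  set J := Set.Ioo (t₀ - ε) (t₀ + ε) ∩ Metric.ball t₀ δ with hJ
  have hJo : IsOpen J := isOpen_Ioo.inter Metric.isOpen_ball
  have hJc : IsPreconnected J := by
    rw [hJ, Real.ball_eq_Ioo, Set.Ioo_inter_Ioo]
    exact isPreconnected_Ioo
  have htJ : t₀ ∈ J := ⟨ht₀, Metric.mem_ball_self hδ⟩
  have heq : ∀ t ∈ J, α t = position m ζ (evolve ζ b t) c := by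
    intro t ht
    refine eq_of_spectralPoly_eq hm ?_
    rw [hsp, ← evolve_sub ζ b t₀ t]
    exact spectralPoly_evolution hζ hmono.injective hJo hJc (fun u hu => hball u hu.2)
      (fun u hu => hasDerivAt_pi.1 (hα u hu.1)) htJ (by rw [hα0]; exact hsp t₀) ht
  have hαt := hα t₀ ht₀
  rw [heq t₀ htJ] at hαt
  exact hasDerivAt_pi.1 (hαt.congr_of_eventuallyEq
    (eventually_of_mem (hJo.mem_nhds htJ) fun t ht => (heq t ht).symm))

lemma hasSpectralData_position (hm : ∀ i, 0 < m i) (hζ : ∀ j, 0 < ζ j)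
    (hinj : Function.Injective ζ) (hb : ∀ j, 0 < b j) (hc : 0 < c) :
    HasSpectralData m (position m ζ b c) ζ b c :=
  HasSpectralData.of_spectralPoly_eq hζ (spectralPoly_position hm hζ hinj hb hc)

/-- The spectral polynomials at time `t` are forced by those at time `0`, and with the given masses
they determine the positions. -/
lemma IsGlobalMultipeakon.eq_position (hm : ∀ i, 0 < m i) (hζ : ∀ j, 0 < ζ j)
    (hinj : Function.Injective ζ) (hb : ∀ j, 0 < b j) (hc : 0 < c)
    {x : ℝ → Fin (2 * K + 1) → ℝ} (hx : IsGlobalMultipeakon m x)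
    (h0 : HasSpectralData m (x 0) ζ b c) :
    x = fun t => position m ζ (evolve ζ b t) c := by
  funext t
  refine eq_of_spectralPoly_eq hm ?_
  rw [spectralPoly_position hm hζ hinj (evolve_pos hb t) hc,
    spectralPoly_evolution hζ hinj isOpen_univ isPreconnected_univ (fun t _ => hx.ordered t)
      (fun t _ => hx.hasDerivAt t) (Set.mem_univ 0) (h0.spectralPoly_eq hζ hinj) (Set.mem_univ t)]
  simp only [sub_zero]
  rfl

end Solution

end

end MCHPeakon

theorem theorem6p5 (K : ℕ) (m : Fin (2 * K + 1) → ℝ) (ζ b : Fin K → ℝ) (c : ℝ)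
    (hm : ∀ i, 0 < m i) (hζ_pos : ∀ j, 0 < ζ j) (hζ_mono : StrictMono ζ)
    (hb : ∀ j, 0 < b j) (hc : 0 < c) (hmass : MCHPeakon.MassCondition m ζ) :
    (∃ x : ℝ → Fin (2 * K + 1) → ℝ,
      MCHPeakon.IsGlobalMultipeakon m x ∧ MCHPeakon.HasSpectralData m (x 0) ζ b c) ∧
    ∀ x : ℝ → Fin (2 * K + 1) → ℝ,
      MCHPeakon.IsGlobalMultipeakon m x → MCHPeakon.HasSpectralData m (x 0) ζ b c →
        MCHPeakon.AsymptoticsTop m ζ b c x ∧ MCHPeakon.AsymptoticsBot m ζ b c x := by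
  have hinj := hζ_mono.injective
  refine ⟨⟨fun t => MCHPeakon.position m ζ (MCHPeakon.evolve ζ b t) c,
    MCHPeakon.isGlobalMultipeakon_position hm hζ_pos hζ_mono hb hc hmass, ?_⟩, fun x hx h0 => ?_⟩
  · simp only [MCHPeakon.evolve_zero]
    exact MCHPeakon.hasSpectralData_position hm hζ_pos hinj hb hc
  · rw [hx.eq_position hm hζ_pos hinj hb hc h0]
    exact ⟨MCHPeakon.asymptoticsTop_position hm hζ_pos hζ_mono hb hc,
      MCHPeakon.asymptoticsBot_position hm hζ_pos hζ_mono hb hc⟩
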